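/- **Setting.** Let $\Sigma$ be a finite alphabet, $\#\notin\Sigma$, and let $M$ be an operator precedence matrix: each ordered pair of symbols of $\Sigma\cup\{\#\}$ is assigned at most one of the relations $\lessdot,\doteq,\gtrdot$, with $\#\lessdot a$ and $a\gtrdot\#$ for all $a\in\Sigma$. For $w=a_1\cdots a_n\in\Sigma^+$ put $a_0=a_{n+1}=\#$. The chain relation $\curvearrowright$ on $\{0,\dots,n+1\}$ is defined inductively: $i\curvearrowright j$ iff there are $m\ge 3$ and positions $i=k_1<\dots<k_m=j$ with $a_{k_1}\lessdot a_{k_2}\doteq\dots\doteq a_{k_{m-1}}\gtrdot a_{k_m}$ such that for each $s<m$ either $k_s+1=k_{s+1}$ or $k_s\curvearrowright k_{s+1}$. Let $(\Sigma,M)^+$ be the set of all $w\in\Sigma^+$ with $0\curvearrowright n+1$. Let $\mathbb K=(K,+,\cdot,0,1)$ be a semiring; a series is a map $(\Sigma,M)^+\to K$. **Automata.** A weighted operator precedence automaton (wOPA) $\mathcal A$ consists of a finite set $Q$ of states, sets $I,F\subseteq Q$ of initial and final states, transition relations $\delta_{\mathrm{push}},\delta_{\mathrm{shift}}\subseteq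 Q\times\Sigma\times Q$ and $\delta_{\mathrm{pop}}\subseteq Q\times Q\times Q$, and weight functions $\mathrm{wt}_{op}:\delta_{op}\to K$ for $op\in\{\mathrm{push},\mathrm{shift},\mathrm{pop}\}$. It is *restricted* if $\mathrm{wt}_{\mathrm{pop}}\equiv 1$. A configuration is $\langle\Pi,q,x\#,k\rangle$ with a stack $\Pi\in\bot(\Sigma\times Q)^*$, a state $q$, the remaining input $x$ and a weight $k\in K$. Let $a$ be the topmost alphabet symbol of the stack ($a=\#$ if the stack is $\bot$) and $b$ the next symbol of the remaining input (including the end marker). The moves are: - push: $\langle\Pi,q,bx,k\rangle\vdash\langle\Pi[b,q],r,x,k\cdot\mathrm{wt}_{\mathrm{push}}(q,b,r)\rangle$ if $a\lessdot b$ and $(q,b,r)\in\delta_{\mathrm{push}}$; - shift: $\langle\Pi[a,p],q,bx,k\rangle\vdash\langle\Pi[b,p],r,x,k\cdot\mathrm{wt}_{\mathrm{shift}}(q,b,r)\rangle$ if $a\doteq b$ and $(q,b,r)\in\delta_{\mathrm{shift}}$; - pop: $\langle\Pi[a,p],q,bx,k\rangle\vdash\langle\Pi,r,bx,k\cdot\mathrm{wt}_{\mathrm{pop}}(q,p,r)\rangle$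 if $a\gtrdot b$ and $(q,p,r)\in\delta_{\mathrm{pop}}$. An accepting run on $w$ is a finite sequence of moves from $\langle\bot,q_I,w\#,1\rangle$ with $q_I\in I$ to some $\langle\bot,q_F,\#,k\rangle$ with $q_F\in F$; its weight is $k$. The behavior $\llbracket\mathcal A\rrbracket:(\Sigma,M)^+\to K$ maps $w$ to the (finite) sum of the weights of all accepting runs of $\mathcal A$ on $w$. **Logic.** The formulas of $\mathrm{MSO}(\mathbb K)$ are given, with first-order variables $x,y$, second-order variables $X$, $a\in\Sigma\cup\{\#\}$ and $k\in K$, by $$\beta::=\mathrm{Lab}_a(x)\mid x\le y\mid x\curvearrowright y\mid x\in X\mid\neg\beta\mid\beta\vee\beta\mid\exists x.\beta\mid\exists X.\beta,$$ $$\varphi::=\beta\mid k\mid\varphi\oplus\varphi\mid\varphi\otimes\varphi\mid\textstyle\bigoplus_x\varphi\mid\bigoplus_X\varphi\mid\prod_x\varphi .$$ Boolean formulas $\beta$ are interpreted in $\#w\#$ in the natural way, their quantifiers ranging over positions, resp. sets of positions, of $\#w\#$, i.e. over $\{0,\dots,n+1\}$. A weighted formula takes the following value at $w$ and an assignment $\sigma$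 of its free variables: $\llbracket\beta\rrbracket$ is $1$ if $(w,\sigma)\models\beta$ and $0$ otherwise; $\llbracket k\rrbracket=k$; $\oplus$ and $\otimes$ are interpreted by $+$ and $\cdot$; $\bigoplus_x$, $\bigoplus_X$ by the sums over all $i\in\{1,\dots,n\}$, resp. all $I\subseteq\{1,\dots,n\}$, of the values under $\sigma[x\to i]$, resp. $\sigma[X\to I]$; and $\prod_x$ by the product of the values under $\sigma[x\to i]$ over $i=1,\dots,n$ in this order. A sentence $\varphi$ (a formula without free variables) thus defines a series $\llbracket\varphi\rrbracket:(\Sigma,M)^+\to K$. The *almost boolean* formulas form the smallest set of formulas that contains all $k\in K$ and all boolean formulas and is closed under $\oplus$ and $\otimes$. A formula $\varphi$ is *restricted* if (1) for every subformula $\psi\otimes\theta$ of $\varphi$, either $\psi$ is almost boolean or every element of $K$ occurring as a constant in $\psi$ commutes with every element of $K$ occurring as a constant in $\theta$, and (2) for every subformula $\prod_x\psi$ of $\varphi$, $\psi$ is almost boolean. **Theorem.** Let $\mathbb K$ be a semiring and $S:(\Sigma,M)^+\to K$ a series. 1. The following are equivalent: (i) $S=\llbracket\mathcal A\rrbracket$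 for some restricted wOPA $\mathcal A$; (ii) $S=\llbracket\varphi\rrbracket$ for some restricted sentence $\varphi$ of $\mathrm{MSO}(\mathbb K)$. 2. Let $\mathbb K$ be commutative. Then the following are equivalent: (i) $S=\llbracket\mathcal A\rrbracket$ for some wOPA $\mathcal A$; (ii) $S=\llbracket\varphi\rrbracket$ for some restricted sentence $\varphi$ of $\mathrm{MSO}(\mathbb K)$. -/

import Mathlib

namespace OPL

universe u v

/-! ## Operator precedence alphabets and the chain relation -/

/-- The three operator precedence relations. -/
inductive Prec : Type
  /-- yields precedence, `⋖` -/
  | yields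
  /-- equal in precedence, `≐` -/
  | equal
  /-- takes precedence, `⋗` -/
  | takes

/-- An operator precedence matrix over the alphabet `A`. The end marker `#` is `none : Option A`;
an empty entry of the matrix is `none : Option Prec`. -/
structure OPM (A : Type u) where
  /-- the entries of the matrix -/
  rel : Option A → Option A → Option Prec
  /-- `# ⋖ a` for every letter `a` -/
  hash_left : ∀ a : A, rel none (some a) = some Prec.yields
  /-- `a ⋗ #` for every letter `a` -/
  hash_right : ∀ a : A, rel (some a) none = some Prec.takes

/-- The symbol at position `i` of `#w#`: positions `1, …, |w|` carry the letters of `w`,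
positions `0` and `|w| + 1` carry `#`. -/
def letterAt {A : Type u} (w : List A) : ℕ → Option A
  | 0 => none
  | i + 1 => w[i]?

/-- The chain relation `i ↷ j` on the positions `0, …, |w| + 1` of `#w#`: there are positions
`i = k 0 < k 1 < ⋯ < k (m + 2) = j` whose symbols satisfy
`k 0 ⋖ k 1 ≐ ⋯ ≐ k (m + 1) ⋗ k (m + 2)` and such that any two consecutive ones are
adjacent or are themselves in the chain relation. -/
inductive Chain {A : Type u} (M : OPM A) (w : List A) : ℕ → ℕ → Prop
  | intro (i j m : ℕ) (k : ℕ → ℕ)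
      (first : k 0 = i) (last : k (m + 2) = j) (bound : j ≤ w.length + 1)
      (mono : ∀ s, s < m + 2 → k s < k (s + 1))
      (yields : M.rel (letterAt w (k 0)) (letterAt w (k 1)) = some Prec.yields)
      (equal : ∀ s, 1 ≤ s → s < m + 1 →
        M.rel (letterAt w (k s)) (letterAt w (k (s + 1))) = some Prec.equal)
      (takes : M.rel (letterAt w (k (m + 1))) (letterAt w (k (m + 2))) = some Prec.takes)
      (step : ∀ s, s < m + 2 → k s + 1 ≠ k (s + 1) → Chain M w (k s) (k (s + 1))) :
      Chain M w i j

/-- A word is compatible with `M` if `0 ↷ |w| + 1` holds in `#w#`. -/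
def Compatible {A : Type u} (M : OPM A) (w : List A) : Prop :=
  Chain M w 0 (w.length + 1)

/-- `(A, M)⁺`, the set of all non-empty words compatible with `M`. -/
abbrev OPWord {A : Type u} (M : OPM A) : Type u :=
  {w : List A // w ≠ [] ∧ Compatible M w}

/-! ## Weighted operator precedence automata -/

/-- A weighted operator precedence automaton over the alphabet `A` and the weights `K`
with set of states `Q`. -/
structure WOPA (A : Type u) (K : Type v) (Q : Type) where
  /-- initial states -/
  init : Set Q
  /-- final states -/
  final : Set Q
  /-- push transitions -/
  push : Set (Q × A × Q)
  /-- shift transitions -/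
  shift : Set (Q × A × Q)
  /-- pop transitions -/
  pop : Set (Q × Q × Q)
  /-- weights of the push transitions -/
  wtPush : push → K
  /-- weights of the shift transitions -/
  wtShift : shift → K
  /-- weights of the pop transitions -/
  wtPop : pop → K

/-- A configuration `⟨Π, q, x#, k⟩`. The stack `Π` is a list whose head is its top element
(the empty list is the empty stack `⊥`); the end marker after the remaining input is implicit. -/
@[ext]
structure Config (A : Type u) (K : Type v) (Q : Type) where
  /-- the stack -/
  stack : List (A × Q)
  /-- the current state -/
  state : Q
  /-- the remaining input, without the end marker -/
  rest : List A
  /-- the weight accumulated so far -/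
  weight : K

/-- The topmost alphabet symbol of a stack, `#` for the empty stack. -/
def topSymbol {A : Type u} {Q : Type} (stack : List (A × Q)) : Option A :=
  stack.head?.map Prod.fst

namespace WOPA

variable {A : Type u} {K : Type v} {Q : Type}

/-- A wOPA is restricted if all its pop transitions have weight `1`. -/
def Restricted [One K] (𝒜 : WOPA A K Q) : Prop :=
  ∀ t : 𝒜.pop, 𝒜.wtPop t = 1

/-- One move of a wOPA. -/
inductive Step [Mul K] (M : OPM A) (𝒜 : WOPA A K Q) : Config A K Q → Config A K Q → Prop
  | push (stack : List (A × Q)) (q r : Q) (b : A) (x : List A) (k : K)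
      (prec : M.rel (topSymbol stack) (some b) = some Prec.yields)
      (mem : (q, b, r) ∈ 𝒜.push) :
      Step M 𝒜 ⟨stack, q, b :: x, k⟩ ⟨(b, q) :: stack, r, x, k * 𝒜.wtPush ⟨(q, b, r), mem⟩⟩
  | shift (stack : List (A × Q)) (a : A) (p q r : Q) (b : A) (x : List A) (k : K)
      (prec : M.rel (some a) (some b) = some Prec.equal)
      (mem : (q, b, r) ∈ 𝒜.shift) :
      Step M 𝒜 ⟨(a, p) :: stack, q, b :: x, k⟩
        ⟨(b, p) :: stack, r, x, k * 𝒜.wtShift ⟨(q, b, r), mem⟩⟩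
  | pop (stack : List (A × Q)) (a : A) (p q r : Q) (y : List A) (k : K)
      (prec : M.rel (some a) y.head? = some Prec.takes)
      (mem : (q, p, r) ∈ 𝒜.pop) :
      Step M 𝒜 ⟨(a, p) :: stack, q, y, k⟩ ⟨stack, r, y, k * 𝒜.wtPop ⟨(q, p, r), mem⟩⟩

/-- The accepting runs of `𝒜` on `w`: the finite sequences of configurations, each obtained from
the previous one by a move, that lead from `⟨⊥, q, w#, 1⟩` with `q` initial to `⟨⊥, q', #, k⟩`
with `q'` final. -/
def acc [Monoid K] (M : OPM A) (𝒜 : WOPA A K Q) (w : List A) : Set (List (Config A K Q)) :=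
  {ρ | ρ.IsChain (Step M 𝒜) ∧
    (∃ q ∈ 𝒜.init, ρ.head? = some ⟨[], q, w, 1⟩) ∧
    (∃ q ∈ 𝒜.final, ∃ k : K, ρ.getLast? = some ⟨[], q, [], k⟩)}

/-- The weight of a run: the weight of its last configuration. (Runs are non-empty sequences;
the value `0` for the empty list is never used.) -/
def runWeight [Zero K] (ρ : List (Config A K Q)) : K :=
  (ρ.getLast?.map Config.weight).getD 0

theorem step_finite [Mul K] [Finite A] [Finite Q] (M : OPM A) (𝒜 : WOPA A K Q)
    (c : Config A K Q) : {d | Step M 𝒜 c d}.Finite := by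
  classical
  have h : {d | Step M 𝒜 c d} ⊆
      (Set.range (fun t : 𝒜.push => (⟨(t.1.2.1, t.1.1) :: c.stack, t.1.2.2, c.rest.tail,
          c.weight * 𝒜.wtPush t⟩ : Config A K Q)) ∪
        Set.range (fun t : 𝒜.shift × Q => (⟨(t.1.1.2.1, t.2) :: c.stack.tail, t.1.1.2.2,
          c.rest.tail, c.weight * 𝒜.wtShift t.1⟩ : Config A K Q))) ∪
        Set.range (fun t : 𝒜.pop => (⟨c.stack.tail, t.1.2.2, c.rest,
          c.weight * 𝒜.wtPop t⟩ : Config A K Q)) := by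
    intro d hd
    cases hd with
    | push stack q r b x k prec mem => exact Or.inl (Or.inl ⟨⟨_, mem⟩, rfl⟩)
    | shift stack a p q r b x k prec mem => exact Or.inl (Or.inr ⟨(⟨_, mem⟩, p), rfl⟩)
    | pop stack a p q r y k prec mem => exact Or.inr ⟨⟨_, mem⟩, rfl⟩
  exact (((Set.finite_range _).union (Set.finite_range _)).union (Set.finite_range _)).subset h

theorem runs_finite [Mul K] [Finite A] [Finite Q] (M : OPM A) (𝒜 : WOPA A K Q) (n : ℕ) :
    ∀ c : Config A K Q, 2 * c.rest.length + c.stack.length < n →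
      {ρ : List (Config A K Q) | ρ.IsChain (Step M 𝒜) ∧ ρ.head? = some c}.Finite := by
  induction n with
  | zero => intro c hc; omega
  | succ n ih =>
    intro c hc
    have key : ∀ d, Step M 𝒜 c d → 2 * d.rest.length + d.stack.length < n := by
      intro d hd
      cases hd <;> simp at hc ⊢ <;> omega
    refine Set.Finite.subset ((Set.finite_singleton [c]).union
      (((step_finite M 𝒜 c).biUnion fun d hd => ih d (key d hd)).image (List.cons c))) ?_
    rintro ρ ⟨hρ, hh⟩
    match ρ, hρ, hh with
    | [c'], _, hh => left; simpa using hh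
    | c' :: d :: l, hρ, hh =>
      right
      have e : c' = c := by simpa using hh
      subst e
      rw [List.isChain_cons_cons] at hρ
      exact ⟨d :: l, Set.mem_biUnion (x := d) hρ.1 ⟨hρ.2, rfl⟩, rfl⟩

/-- There are only finitely many accepting runs on a given word. -/
theorem acc_finite [Monoid K] [Finite A] [Finite Q] (M : OPM A) (𝒜 : WOPA A K Q)
    (w : List A) : (acc M 𝒜 w).Finite := by
  refine Set.Finite.subset (Set.finite_iUnion fun q : Q =>
    runs_finite M 𝒜 (2 * w.length + 1) ⟨[], q, w, 1⟩ (by simp)) ?_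
  rintro ρ ⟨h, ⟨q, -, hq⟩, -⟩
  exact Set.mem_iUnion.2 ⟨q, h, hq⟩

/-- The behavior of a wOPA: the sum of the weights of the accepting runs. -/
noncomputable def behavior [Semiring K] [Finite A] [Finite Q] (M : OPM A) (𝒜 : WOPA A K Q)
    (w : OPWord M) : K :=
  ∑ ρ ∈ (acc_finite M 𝒜 w.1).toFinset, runWeight ρ

end WOPA

/-! ## The weighted logic -/

/-- Boolean formulas. First-order and second-order variables are both named by natural numbers;
the label predicates range over the letters and `#`. -/
inductive BFormula (A : Type u) : Type u
  | lab (a : Option A) (x : ℕ)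
  | le (x y : ℕ)
  | chain (x y : ℕ)
  | mem (x X : ℕ)
  | not (β : BFormula A)
  | or (β γ : BFormula A)
  | exFO (x : ℕ) (β : BFormula A)
  | exSO (X : ℕ) (β : BFormula A)

/-- Weighted formulas. -/
inductive WFormula (A : Type u) (K : Type v) : Type (max u v)
  | bool (β : BFormula A)
  | const (k : K)
  | add (φ ψ : WFormula A K)
  | mul (φ ψ : WFormula A K)
  | sumFO (x : ℕ) (φ : WFormula A K)
  | sumSO (X : ℕ) (φ : WFormula A K)
  | prodFO (x : ℕ) (φ : WFormula A K)

/-- An assignment of positions to first-order variables and of finite sets of positions to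
second-order variables. -/
structure Assignment where
  /-- values of the first-order variables -/
  fo : ℕ → ℕ
  /-- values of the second-order variables -/
  so : ℕ → Finset ℕ

namespace Assignment

/-- `σ[x → i]` -/
def updFO (σ : Assignment) (x i : ℕ) : Assignment :=
  ⟨Function.update σ.fo x i, σ.so⟩

/-- `σ[X → I]` -/
def updSO (σ : Assignment) (X : ℕ) (I : Finset ℕ) : Assignment :=
  ⟨σ.fo, Function.update σ.so X I⟩

end Assignment

namespace BFormula

variable {A : Type u}

/-- Free first-order variables. -/
def freeFO : BFormula A → Finset ℕ
  | lab _ x => {x}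
  | le x y => {x, y}
  | chain x y => {x, y}
  | mem x _ => {x}
  | not β => β.freeFO
  | or β γ => β.freeFO ∪ γ.freeFO
  | exFO x β => β.freeFO.erase x
  | exSO _ β => β.freeFO

/-- Free second-order variables. -/
def freeSO : BFormula A → Finset ℕ
  | lab _ _ => ∅
  | le _ _ => ∅
  | chain _ _ => ∅
  | mem _ X => {X}
  | not β => β.freeSO
  | or β γ => β.freeSO ∪ γ.freeSO
  | exFO _ β => β.freeSO
  | exSO X β => β.freeSO.erase X

/-- `(w, σ) ⊨ β`. The quantifiers of boolean formulas range over (sets of) positions of `#w#`,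
that is, over `0, …, |w| + 1`. -/
def Sat (M : OPM A) (w : List A) : BFormula A → Assignment → Prop
  | lab a x, σ => letterAt w (σ.fo x) = a
  | le x y, σ => σ.fo x ≤ σ.fo y
  | chain x y, σ => Chain M w (σ.fo x) (σ.fo y)
  | mem x X, σ => σ.fo x ∈ σ.so X
  | not β, σ => ¬ Sat M w β σ
  | or β γ, σ => Sat M w β σ ∨ Sat M w γ σ
  | exFO x β, σ => ∃ i, i ≤ w.length + 1 ∧ Sat M w β (σ.updFO x i)
  | exSO X β, σ => ∃ I : Finset ℕ, (∀ i ∈ I, i ≤ w.length + 1) ∧ Sat M w β (σ.updSO X I)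

end BFormula

namespace WFormula

variable {A : Type u} {K : Type v}

/-- Free first-order variables. -/
def freeFO : WFormula A K → Finset ℕ
  | bool β => β.freeFO
  | const _ => ∅
  | add φ ψ => φ.freeFO ∪ ψ.freeFO
  | mul φ ψ => φ.freeFO ∪ ψ.freeFO
  | sumFO x φ => φ.freeFO.erase x
  | sumSO _ φ => φ.freeFO
  | prodFO x φ => φ.freeFO.erase x

/-- Free second-order variables. -/
def freeSO : WFormula A K → Finset ℕ
  | bool β => β.freeSO
  | const _ => ∅
  | add φ ψ => φ.freeSO ∪ ψ.freeSO
  | mul φ ψ => φ.freeSO ∪ ψ.freeSO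
  | sumFO _ φ => φ.freeSO
  | sumSO X φ => φ.freeSO.erase X
  | prodFO _ φ => φ.freeSO

/-- A sentence is a formula without free variables. -/
def IsSentence (φ : WFormula A K) : Prop :=
  φ.freeFO = ∅ ∧ φ.freeSO = ∅

open Classical in
/-- The semantics of weighted formulas. Weighted quantifiers range over the positions
`1, …, |w|` of `w`; the product is taken in increasing order of the positions. -/
noncomputable def sem [Semiring K] (M : OPM A) (w : List A) : WFormula A K → Assignment → K
  | bool β, σ => if β.Sat M w σ then 1 else 0
  | const k, _ => k
  | add φ ψ, σ => sem M w φ σ + sem M w ψ σ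
  | mul φ ψ, σ => sem M w φ σ * sem M w ψ σ
  | sumFO x φ, σ => ∑ i ∈ Finset.Icc 1 w.length, sem M w φ (σ.updFO x i)
  | sumSO X φ, σ => ∑ I ∈ (Finset.Icc 1 w.length).powerset, sem M w φ (σ.updSO X I)
  | prodFO x φ, σ => ((List.range' 1 w.length).map fun i => sem M w φ (σ.updFO x i)).prod

/-- The series defined by a sentence. A sentence has no free variables, so its value does not
depend on the assignment used here (see `sem_eq_series`). -/
noncomputable def series [Semiring K] (M : OPM A) (φ : WFormula A K) (w : OPWord M) : K :=
  φ.sem M w.1 ⟨fun _ => 1, fun _ => ∅⟩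

/-- Almost boolean formulas: the smallest set of formulas that contains the constants and the
boolean formulas and is closed under `⊕` and `⊗`. -/
inductive AlmostBoolean : WFormula A K → Prop
  | bool (β : BFormula A) : AlmostBoolean (bool β)
  | const (k : K) : AlmostBoolean (const k)
  | add {φ ψ : WFormula A K} : AlmostBoolean φ → AlmostBoolean ψ → AlmostBoolean (add φ ψ)
  | mul {φ ψ : WFormula A K} : AlmostBoolean φ → AlmostBoolean ψ → AlmostBoolean (mul φ ψ)

/-- The weights occurring in a formula. -/
def consts : WFormula A K → Set K
  | bool _ => ∅
  | const k => {k}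
  | add φ ψ => φ.consts ∪ ψ.consts
  | mul φ ψ => φ.consts ∪ ψ.consts
  | sumFO _ φ => φ.consts
  | sumSO _ φ => φ.consts
  | prodFO _ φ => φ.consts

/-- The subformulas of a weighted formula; a boolean formula counts as one unit, since its proper
subformulas are boolean and contain neither `⊗` nor a weighted product. -/
def subformulas : WFormula A K → Set (WFormula A K)
  | bool β => {bool β}
  | const k => {const k}
  | add φ ψ => {add φ ψ} ∪ φ.subformulas ∪ ψ.subformulas
  | mul φ ψ => {mul φ ψ} ∪ φ.subformulas ∪ ψ.subformulas
  | sumFO x φ => {sumFO x φ} ∪ φ.subformulas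
  | sumSO X φ => {sumSO X φ} ∪ φ.subformulas
  | prodFO x φ => {prodFO x φ} ∪ φ.subformulas

/-- `⊗`-restricted formulas. -/
def MulRestricted [Mul K] (φ : WFormula A K) : Prop :=
  ∀ ψ θ : WFormula A K, mul ψ θ ∈ φ.subformulas →
    ψ.AlmostBoolean ∨ ∀ k ∈ ψ.consts, ∀ l ∈ θ.consts, k * l = l * k

/-- `∏`-restricted formulas. -/
def ProdRestricted (φ : WFormula A K) : Prop :=
  ∀ (x : ℕ) (ψ : WFormula A K), prodFO x ψ ∈ φ.subformulas → ψ.AlmostBoolean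

/-- Restricted formulas. -/
def Restricted [Mul K] (φ : WFormula A K) : Prop :=
  φ.MulRestricted ∧ φ.ProdRestricted

end WFormula

/-! ### The value of a formula depends only on its free variables -/

theorem BFormula.sat_congr {A : Type u} (M : OPM A) (w : List A) (β : BFormula A) :
    ∀ σ τ : Assignment, (∀ x ∈ β.freeFO, σ.fo x = τ.fo x) →
      (∀ X ∈ β.freeSO, σ.so X = τ.so X) → (β.Sat M w σ ↔ β.Sat M w τ) := by
  induction β with
  | lab a x => intro σ τ h _; simp_all [BFormula.freeFO, BFormula.Sat]
  | le x y => intro σ τ h _; simp_all [BFormula.freeFO, BFormula.Sat]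
  | chain x y => intro σ τ h _; simp_all [BFormula.freeFO, BFormula.Sat]
  | mem x X => intro σ τ h h'; simp_all [BFormula.freeFO, BFormula.freeSO, BFormula.Sat]
  | not β ih => intro σ τ h h'; exact not_congr (ih σ τ h h')
  | or β γ ihβ ihγ =>
    intro σ τ h h'
    simp only [BFormula.freeFO, BFormula.freeSO, Finset.mem_union] at h h'
    exact or_congr (ihβ σ τ (fun x hx => h x (Or.inl hx)) fun x hx => h' x (Or.inl hx))
      (ihγ σ τ (fun x hx => h x (Or.inr hx)) fun x hx => h' x (Or.inr hx))
  | exFO x β ih =>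
    intro σ τ h h'
    refine exists_congr fun i => and_congr_right fun _ => ih _ _ (fun y hy => ?_) h'
    by_cases e : y = x
    · subst e; simp [Assignment.updFO]
    · simpa [Assignment.updFO, e] using h y (by simp [BFormula.freeFO, e, hy])
  | exSO X β ih =>
    intro σ τ h h'
    refine exists_congr fun i => and_congr_right fun _ => ih _ _ h fun y hy => ?_
    by_cases e : y = X
    · subst e; simp [Assignment.updSO]
    · simpa [Assignment.updSO, e] using h' y (by simp [BFormula.freeSO, e, hy])

theorem WFormula.sem_congr {A : Type u} {K : Type v} [Semiring K] (M : OPM A) (w : List A)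
    (φ : WFormula A K) : ∀ σ τ : Assignment, (∀ x ∈ φ.freeFO, σ.fo x = τ.fo x) →
      (∀ X ∈ φ.freeSO, σ.so X = τ.so X) → φ.sem M w σ = φ.sem M w τ := by
  induction φ with
  | bool β =>
    intro σ τ h h'
    simp only [WFormula.sem]
    have e := BFormula.sat_congr M w β σ τ h h'
    by_cases hs : β.Sat M w σ
    · rw [if_pos hs, if_pos (e.1 hs)]
    · rw [if_neg hs, if_neg fun ht => hs (e.2 ht)]
  | const k => intros; rfl
  | add φ ψ ihφ ihψ =>
    intro σ τ h h'
    simp only [WFormula.freeFO, WFormula.freeSO, Finset.mem_union] at h h'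
    exact congrArg₂ (· + ·)
      (ihφ σ τ (fun x hx => h x (Or.inl hx)) fun x hx => h' x (Or.inl hx))
      (ihψ σ τ (fun x hx => h x (Or.inr hx)) fun x hx => h' x (Or.inr hx))
  | mul φ ψ ihφ ihψ =>
    intro σ τ h h'
    simp only [WFormula.freeFO, WFormula.freeSO, Finset.mem_union] at h h'
    exact congrArg₂ (· * ·)
      (ihφ σ τ (fun x hx => h x (Or.inl hx)) fun x hx => h' x (Or.inl hx))
      (ihψ σ τ (fun x hx => h x (Or.inr hx)) fun x hx => h' x (Or.inr hx))
  | sumFO x φ ih =>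
    intro σ τ h h'
    refine Finset.sum_congr rfl fun i _ => ih _ _ (fun y hy => ?_) h'
    by_cases e : y = x
    · subst e; simp [Assignment.updFO]
    · simpa [Assignment.updFO, e] using h y (by simp [WFormula.freeFO, e, hy])
  | sumSO X φ ih =>
    intro σ τ h h'
    refine Finset.sum_congr rfl fun i _ => ih _ _ h fun y hy => ?_
    by_cases e : y = X
    · subst e; simp [Assignment.updSO]
    · simpa [Assignment.updSO, e] using h' y (by simp [WFormula.freeSO, e, hy])
  | prodFO x φ ih =>
    intro σ τ h h'
    refine congrArg List.prod (List.map_congr_left fun i _ => ih _ _ (fun y hy => ?_) h')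
    by_cases e : y = x
    · subst e; simp [Assignment.updFO]
    · simpa [Assignment.updFO, e] using h y (by simp [WFormula.freeFO, e, hy])

theorem WFormula.sem_eq_series {A : Type u} {K : Type v} [Semiring K] (M : OPM A)
    (φ : WFormula A K) (hφ : φ.IsSentence) (w : OPWord M) (σ : Assignment) :
    φ.sem M w.1 σ = φ.series M w :=
  WFormula.sem_congr M w.1 φ _ _ (by simp [hφ.1]) (by simp [hφ.2])

end OPL

/-! Whether the next move is a push, a shift or a pop depends only on the topmost symbol and the
lookahead, never on the states. So a compatible word has a single parse, common to all automata, and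
a run is nothing but a sequence of states indexed by the times of this parse (`mem_acc_iff`). The
chain relation is the static picture of the parse: `v` and `y` are adjacent or in the chain relation
iff at some time `v` is the top position and `y` the lookahead (`link_iff_exists_time`).

From formulas to automata, every restricted formula is brought into a normal form, `LabelSeries`: a
sum over the labellings of the positions by a finite set, restricted to a regular set of labellings,
of the products of the label weights in the order of the positions. Regular sets are accepted by
deterministic recognizers whose stack follows the parse. They are closed under boolean operations
and, by a subset construction with binary relations as states, under projection (`Regular.proj`);
hence boolean formulas define regular predicates (`BFormula.regular`). In the normal form a sum is a
disjoint union of label sets, a product of commuting series uses pairs of labels, an almost boolean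
left factor is absorbed piece by piece with its constants placed on the first position, and the sums
over variables are extra boolean labels. An almost boolean formula takes finitely many values on
regular sets, so under a weighted product the values themselves are the only admissible labelling
(`Steps.prodFO`). An automaton that guesses the labels while reading and runs the recognizer has the
required behavior; its pops carry no weight (`ofRecognizer_behavior`).

From automata to formulas, a run is written on the word. A position is popped at most once
(`pop_unique`), so its label can hold both the transition reading it and the one popping it. Chains
locate the preceding state of each move (`Arrives`), so the consistency of the labels is definable,
and consistent labellings correspond bijectively to accepting runs (`behavior_eq_labelling_sum`).
The reading weights already come in the order of the positions; the pop weights must be moved to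
their positions, which needs them to be central. They are if they equal `1` or if the semiring is
commutative, so one construction serves both parts of the theorem. -/

namespace OPL

universe u v

/-! ## The deterministic parse of a word -/

/-- The moves of the parser of an operator precedence matrix. -/
inductive Op (A : Type u) : Type u
  | push (a : A)
  | shift (a : A)
  | pop
  | halt

/-- A configuration of the parser. A cell `(a, v, t)` of the stack consists of a letter, the
position from which it was read, and the time at which the cell was pushed. -/
structure Parse (A : Type u) : Type u where
  stack : List (A × ℕ × ℕ)
  look : ℕ

namespace Parse

variable {A : Type u}

/-- The topmost symbol. -/
def sym (p : Parse A) : Option A := p.stack.head?.map fun x => x.1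

/-- The position of the topmost symbol. -/
def top (p : Parse A) : ℕ := (p.stack.head?.map fun x => x.2.1).getD 0

/-- The time at which the topmost cell was pushed. -/
def born (p : Parse A) : ℕ := (p.stack.head?.map fun x => x.2.2).getD 0

/-- The next move of the parser. -/
def op (M : OPM A) (w : List A) (p : Parse A) : Op A :=
  match M.rel p.sym (letterAt w p.look), letterAt w p.look, p.stack with
  | some .yields, some a, _ => .push a
  | some .equal, some a, _ :: _ => .shift a
  | some .takes, _, _ :: _ => .pop
  | _, _, _ => .halt

/-- The configuration after a move at time `t`. -/
def apply (t : ℕ) (p : Parse A) : Op A → Parse A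
  | .push a => ⟨(a, p.look, t) :: p.stack, p.look + 1⟩
  | .shift a => ⟨(a, p.look, p.born) :: p.stack.tail, p.look + 1⟩
  | .pop => ⟨p.stack.tail, p.look⟩
  | .halt => p

/-- The possible moves of the parser. -/
inductive Move (M : OPM A) (w : List A) (t : ℕ) : Parse A → Op A → Parse A → Prop
  | push (s : List (A × ℕ × ℕ)) (j : ℕ) (a : A) (ha : letterAt w j = some a)
      (h : M.rel (sym ⟨s, j⟩) (some a) = some .yields) :
      Move M w t ⟨s, j⟩ (.push a) ⟨(a, j, t) :: s, j + 1⟩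
  | shift (b : A) (v r : ℕ) (s : List (A × ℕ × ℕ)) (j : ℕ) (a : A) (ha : letterAt w j = some a)
      (h : M.rel (some b) (some a) = some .equal) :
      Move M w t ⟨(b, v, r) :: s, j⟩ (.shift a) ⟨(a, j, r) :: s, j + 1⟩
  | pop (b : A) (v r : ℕ) (s : List (A × ℕ × ℕ)) (j : ℕ)
      (h : M.rel (some b) (letterAt w j) = some .takes) :
      Move M w t ⟨(b, v, r) :: s, j⟩ .pop ⟨s, j⟩
  | halt (p : Parse A) (h : p.op M w = .halt) : Move M w t p .halt p

theorem op_push {M : OPM A} {w : List A} {p : Parse A} {a : A}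
    (h : M.rel p.sym (some a) = some .yields) (ha : letterAt w p.look = some a) :
    p.op M w = .push a := by
  unfold op; rw [ha, h]

theorem op_shift {M : OPM A} {w : List A} {p : Parse A} {a : A}
    (h : M.rel p.sym (some a) = some .equal) (ha : letterAt w p.look = some a)
    (hp : p.stack ≠ []) : p.op M w = .shift a := by
  obtain ⟨s, j⟩ := p
  cases s with
  | nil => exact absurd rfl hp
  | cons x s => unfold op; simp only at ha ⊢; rw [ha, h]

theorem op_pop {M : OPM A} {w : List A} {p : Parse A}
    (h : M.rel p.sym (letterAt w p.look) = some .takes) (hp : p.stack ≠ []) :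
    p.op M w = .pop := by
  obtain ⟨s, j⟩ := p
  cases s with
  | nil => exact absurd rfl hp
  | cons x s => unfold op; rw [h]

/-- This replaces the nested match in `op` by an inductive relation. Every later induction along the
parse splits on `Move`. -/
theorem move_op (M : OPM A) (w : List A) (t : ℕ) (p : Parse A) :
    Move M w t p (p.op M w) (p.apply t (p.op M w)) := by
  by_cases hh : p.op M w = .halt
  · rw [hh]; exact .halt p hh
  obtain ⟨s, j⟩ := p
  rcases hr : M.rel (sym ⟨s, j⟩) (letterAt w j) with _ | _ | _ | _
  · exact absurd (by unfold op; simp only; rw [hr]) hh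
  · rcases ha : letterAt w j with _ | a
    · exact absurd (by unfold op; simp only; rw [hr, ha]) hh
    · rw [ha] at hr
      rw [op_push hr ha]; exact .push s j a ha hr
  · rcases ha : letterAt w j with _ | a
    · exact absurd (by unfold op; simp only; rw [hr, ha]) hh
    · rw [ha] at hr
      rcases s with _ | ⟨⟨b, v, r⟩, s⟩
      · exact absurd (by unfold op; simp only; rw [ha, hr]) hh
      · rw [op_shift hr ha (by simp)]; exact .shift b v r s j a ha hr
  · rcases s with _ | ⟨⟨b, v, r⟩, s⟩
    · exact absurd (by unfold op; simp only; rw [hr]) hh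
    · rw [op_pop hr (by simp)]; exact .pop b v r s j hr

end Parse

section parse

variable {A : Type u} (M : OPM A) (w : List A)

/-- The configuration of the parser at time `t`. -/
def parse : ℕ → Parse A
  | 0 => ⟨[], 1⟩
  | t + 1 => (parse t).apply t ((parse t).op M w)

/-- The move of the parser at time `t`. -/
def opAt (t : ℕ) : Op A := (parse M w t).op M w

/-- The top position of the parser at time `t`. -/
def topAt (t : ℕ) : ℕ := (parse M w t).top

/-- The lookahead of the parser at time `t`. -/
def lookAt (t : ℕ) : ℕ := (parse M w t).look

theorem parse_move (t : ℕ) :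
    Parse.Move M w t (parse M w t) (opAt M w t) (parse M w (t + 1)) :=
  Parse.move_op M w t _

variable {w} in
theorem letterAt_eq_some {j : ℕ} {a : A} (h : letterAt w j = some a) : 1 ≤ j ∧ j ≤ w.length := by
  cases j with
  | zero => simp [letterAt] at h
  | succ j =>
    simp only [letterAt] at h
    have := (List.getElem?_eq_some_iff.1 h).1
    omega

variable {w} in
theorem exists_letterAt {j : ℕ} (h : 1 ≤ j) (h' : j ≤ w.length) : ∃ a, letterAt w j = some a := by
  obtain ⟨j, rfl⟩ : ∃ i, j = i + 1 := ⟨j - 1, by omega⟩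
  exact ⟨w[j], by simp only [letterAt]; exact List.getElem?_eq_getElem (by omega)⟩

theorem letterAt_length_succ : letterAt w (w.length + 1) = none := by
  simp [letterAt]

/-- The structural properties of all parser configurations. -/
structure Parse.Wf (t : ℕ) (p : Parse A) : Prop where
  one_le : 1 ≤ p.look
  le : p.look ≤ w.length + 1
  letter : ∀ x ∈ p.stack, letterAt w x.2.1 = some x.1
  lt : ∀ x ∈ p.stack, x.2.1 < p.look
  sorted : p.stack.Pairwise fun x y => y.2.1 < x.2.1
  time : ∀ x ∈ p.stack, x.2.2 < t

theorem parse_wf (t : ℕ) : (parse M w t).Wf w t := by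
  induction t with
  | zero => constructor <;> simp [parse]
  | succ t ih =>
    have h := parse_move M w t
    generalize parse M w t = p, opAt M w t = o, parse M w (t + 1) = p' at *
    obtain ⟨h1, h2, h3, h4, h5, h6⟩ := ih
    cases h with
    | push s j a ha h =>
      have := letterAt_eq_some ha
      simp only at *
      refine ⟨by simp, by simp; omega, ?_, ?_, ?_, ?_⟩
      · simp only [List.mem_cons, forall_eq_or_imp]; exact ⟨ha, h3⟩
      · simp only [List.mem_cons, forall_eq_or_imp]
        exact ⟨by omega, fun x hx => (h4 x hx).trans (by omega)⟩
      · exact List.pairwise_cons.2 ⟨fun x hx => h4 x hx, h5⟩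
      · simp only [List.mem_cons, forall_eq_or_imp]
        exact ⟨by omega, fun x hx => (h6 x hx).trans (by omega)⟩
    | shift b v r s j a ha h =>
      have := letterAt_eq_some ha
      simp only [List.mem_cons, forall_eq_or_imp] at *
      refine ⟨by simp, by simp; omega, ?_, ?_, ?_, ?_⟩
      · simp only [List.mem_cons, forall_eq_or_imp]; exact ⟨ha, h3.2⟩
      · simp only [List.mem_cons, forall_eq_or_imp]
        exact ⟨by omega, fun x hx => (h4.2 x hx).trans (by omega)⟩
      · exact List.pairwise_cons.2 ⟨fun x hx => h4.2 x hx, (List.pairwise_cons.1 h5).2⟩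
      · simp only [List.mem_cons, forall_eq_or_imp]
        exact ⟨by omega, fun x hx => (h6.2 x hx).trans (by omega)⟩
    | pop b v r s j h =>
      simp only [List.mem_cons, forall_eq_or_imp] at *
      exact ⟨h1, h2, h3.2, h4.2, (List.pairwise_cons.1 h5).2,
        fun x hx => (h6.2 x hx).trans (by omega)⟩
    | halt p h => exact ⟨h1, h2, h3, h4, h5, fun x hx => (h6 x hx).trans (by omega)⟩

variable {w} in
theorem Parse.Wf.letterAt_top {t : ℕ} {p : Parse A} (h : p.Wf w t) :
    letterAt w p.top = p.sym := by
  obtain ⟨s, j⟩ := p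
  cases s with
  | nil => rfl
  | cons x s => exact h.letter x (by simp)

variable {w} in
theorem Parse.Wf.top_lt {t : ℕ} {p : Parse A} (h : p.Wf w t) : p.top < p.look := by
  obtain ⟨s, j⟩ := p
  cases s with
  | nil => exact h.one_le
  | cons x s => exact h.lt x (by simp)

/-! ### The chain relation as seen by the parser -/

/-- The chain relation or direct succession. -/
def Link (i j : ℕ) : Prop := i + 1 = j ∨ Chain M w i j

variable {M w} in
theorem Chain.lt {i j : ℕ} (h : Chain M w i j) : i + 1 < j ∧ j ≤ w.length + 1 := by
  obtain ⟨i, j, m, k, first, last, bound, mono, -⟩ := h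
  have key : ∀ s, s ≤ m + 2 → k 0 + s ≤ k s := by
    intro s
    induction s with
    | zero => simp
    | succ s ih => intro hs; have := ih (by omega); have := mono s (by omega); omega
  have := key (m + 2) le_rfl
  omega

/-- A chain without its right end. -/
def OpenChain (i l : ℕ) : Prop :=
  ∃ (m : ℕ) (k : ℕ → ℕ), k 0 = i ∧ k (m + 1) = l ∧ (∀ s, s < m + 1 → k s < k (s + 1)) ∧
    M.rel (letterAt w (k 0)) (letterAt w (k 1)) = some .yields ∧
    (∀ s, 1 ≤ s → s < m + 1 →
        M.rel (letterAt w (k s)) (letterAt w (k (s + 1))) = some .equal) ∧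
    ∀ s, s < m + 1 → Link M w (k s) (k (s + 1))

variable {M w}

theorem Link.lt {i j : ℕ} (h : Link M w i j) : i < j := by
  rcases h with h | h
  · omega
  · have := h.lt; omega

theorem OpenChain.of_yields {i l : ℕ} (h : Link M w i l)
    (hr : M.rel (letterAt w i) (letterAt w l) = some .yields) : OpenChain M w i l := by
  refine ⟨0, fun s => if s = 0 then i else l, by simp, by simp, ?_, by simpa using hr, ?_, ?_⟩
  · intro s hs
    obtain rfl : s = 0 := by omega
    simpa using h.lt
  · intro s; omega
  · intro s hs
    obtain rfl : s = 0 := by omega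
    simpa using h

theorem OpenChain.snoc {i l j : ℕ} (h : OpenChain M w i l) (hl : Link M w l j)
    (hr : M.rel (letterAt w l) (letterAt w j) = some .equal) : OpenChain M w i j := by
  obtain ⟨m, k, h0, h1, h2, h3, h4, h5⟩ := h
  have hk : ∀ s, s ≤ m + 1 → (if s ≤ m + 1 then k s else j) = k s := fun s hs => if_pos hs
  refine ⟨m + 1, fun s => if s ≤ m + 1 then k s else j, by simpa using h0, by simp, ?_,
    by simpa using h3, ?_, ?_⟩
  all_goals
    intro s
    by_cases hs : s < m + 1
    · simp only [hk s (by omega), hk (s + 1) (by omega)]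
      intros
      first | exact h2 s hs | exact h5 s hs | exact h4 s (by omega) hs
    · intros
      obtain rfl : s = m + 1 := by omega
      simp only [h1]
      simpa using by first | exact hr | exact hl | exact hl.lt

theorem OpenChain.chain {i l j : ℕ} (h : OpenChain M w i l) (hl : Link M w l j)
    (hr : M.rel (letterAt w l) (letterAt w j) = some .takes) (hj : j ≤ w.length + 1) :
    Chain M w i j := by
  obtain ⟨m, k, h0, h1, h2, h3, h4, h5⟩ := h
  have hk : ∀ s, s ≤ m + 1 → (if s ≤ m + 1 then k s else j) = k s := fun s hs => if_pos hs
  refine .intro i j m (fun s => if s ≤ m + 1 then k s else j) (by simpa using h0) (by simp) hj ?_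
    (by simpa using h3) ?_ (by simpa [h1] using hr) ?_
  · intro s hs
    by_cases hs' : s < m + 1
    · simp only [hk s (by omega), hk (s + 1) (by omega)]; exact h2 s hs'
    · obtain rfl : s = m + 1 := by omega
      simpa [h1] using hl.lt
  · intro s hs hs'
    simp only [hk s (by omega), hk (s + 1) (by omega)]; exact h4 s hs hs'
  · intro s hs
    by_cases hs' : s < m + 1
    · simp only [hk s (by omega), hk (s + 1) (by omega)]; exact (h5 s hs').resolve_left
    · obtain rfl : s = m + 1 := by omega
      simp only [h1]
      simpa using hl.resolve_left

/-- Every cell of the stack is an open chain above the cell below it. -/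
def OpenStack (M : OPM A) (w : List A) : List (A × ℕ × ℕ) → Prop
  | [] => True
  | x :: s => OpenChain M w (Parse.top ⟨s, 0⟩) x.2.1 ∧ OpenStack M w s

/-- A push starts an open chain and a shift prolongs the topmost one. A pop closes it, and the
closed chain is exactly the link between the uncovered top and the lookahead. -/
theorem parse_openStack (t : ℕ) :
    OpenStack M w (parse M w t).stack ∧ Link M w (topAt M w t) (lookAt M w t) := by
  induction t with
  | zero => exact ⟨trivial, .inl rfl⟩
  | succ t ih =>
    have h := parse_move M w t
    have wf := parse_wf M w t
    unfold topAt lookAt at *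
    generalize parse M w t = p, opAt M w t = o, parse M w (t + 1) = p' at *
    have hs := wf.letterAt_top
    cases h with
    | push s j a ha h =>
      refine ⟨⟨.of_yields ih.2 ?_, ih.1⟩, .inl rfl⟩
      change letterAt w (Parse.top ⟨s, 0⟩) = _ at hs
      rw [hs, ha]; exact h
    | shift b v r s j a ha h =>
      refine ⟨⟨ih.1.1.snoc ih.2 ?_, ih.1.2⟩, .inl rfl⟩
      change letterAt w v = _ at hs
      rw [hs, ha]; exact h
    | pop b v r s j h =>
      refine ⟨ih.1.2, .inr (ih.1.1.chain ih.2 ?_ wf.le)⟩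
      change letterAt w v = _ at hs
      rw [hs]; exact h
    | halt p h => exact ih

theorem link_topAt (t : ℕ) : Link M w (topAt M w t) (lookAt M w t) := (parse_openStack t).2

theorem parse_succ_push {t : ℕ} {a : A} {s : List (A × ℕ × ℕ)} {j : ℕ} (h : parse M w t = ⟨s, j⟩)
    (ha : letterAt w j = some a)
    (hr : M.rel (letterAt w (Parse.top ⟨s, j⟩)) (some a) = some .yields) :
    parse M w (t + 1) = ⟨(a, j, t) :: s, j + 1⟩ := by
  have wf := (parse_wf M w t).letterAt_top
  rw [h] at wf
  rw [parse, h, Parse.op_push (by rw [← wf]; exact hr) ha]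
  rfl

theorem parse_succ_shift {t : ℕ} {a b : A} {v r : ℕ} {s : List (A × ℕ × ℕ)} {j : ℕ}
    (h : parse M w t = ⟨(b, v, r) :: s, j⟩) (ha : letterAt w j = some a)
    (hr : M.rel (letterAt w v) (some a) = some .equal) :
    parse M w (t + 1) = ⟨(a, j, r) :: s, j + 1⟩ := by
  have wf := (parse_wf M w t).letterAt_top
  rw [h] at wf
  rw [parse, h, Parse.op_shift (by rw [← wf]; exact hr) ha (by simp)]
  rfl

theorem parse_succ_pop {t : ℕ} {b : A} {v r : ℕ} {s : List (A × ℕ × ℕ)} {j : ℕ}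
    (h : parse M w t = ⟨(b, v, r) :: s, j⟩)
    (hr : M.rel (letterAt w v) (letterAt w j) = some .takes) :
    parse M w (t + 1) = ⟨s, j⟩ := by
  have wf := (parse_wf M w t).letterAt_top
  rw [h] at wf
  rw [parse, h, Parse.op_pop (by rw [← wf]; exact hr) (by simp)]
  rfl

/-- Induction on the chain. Its first interior point is pushed, the others are shifted into the same
cell, and the relation at the right end pops that cell, so the stack is restored. -/
theorem Chain.exists_parse {i j : ℕ} (h : Chain M w i j) :
    ∀ (t : ℕ) (s : List (A × ℕ × ℕ)), parse M w t = ⟨s, i + 1⟩ → Parse.top ⟨s, 0⟩ = i →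
      ∃ t', t ≤ t' ∧ parse M w t' = ⟨s, j⟩ := by
  induction h with
  | intro i j m k first last bound mono yields equal takes step ih =>
    intro t s ht hs
    subst first last
    -- Consecutive points are adjacent, and then no move is needed, or joined by an inner chain,
    -- whose parse gives back the same stack by induction.
    have next : ∀ r, r < m + 2 → ∀ t s, parse M w t = ⟨s, k r + 1⟩ → Parse.top ⟨s, 0⟩ = k r →
        ∃ t', t ≤ t' ∧ parse M w t' = ⟨s, k (r + 1)⟩ := by
      intro r hr t s ht hs
      by_cases e : k r + 1 = k (r + 1)
      · exact ⟨t, le_rfl, by rw [ht, e]⟩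
      · exact ih r hr e t s ht hs
    -- Interior points lie strictly between the two ends, so they carry letters and not the end
    -- marker.
    have mono' : ∀ r, 1 ≤ r → r ≤ m + 1 → 1 ≤ k r ∧ k r ≤ w.length := by
      have up : ∀ d r, r + d ≤ m + 2 → k r + d ≤ k (r + d) := by
        intro d
        induction d with
        | zero => simp
        | succ d ih =>
          intro r hr
          have := ih r (by omega)
          have := mono (r + d) (by omega)
          rw [show r + (d + 1) = r + d + 1 by omega]
          omega
      intro r h1 h2
      have h3 := up r 0 (by omega)
      have h4 := up (m + 2 - r) r (by omega)
      rw [show r + (m + 2 - r) = m + 2 by omega] at h4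
      rw [Nat.zero_add] at h3
      omega
    have key : ∀ r, r < m + 1 → ∃ t' a b, t ≤ t' ∧
        parse M w t' = ⟨(a, k (r + 1), b) :: s, k (r + 1) + 1⟩ := by
      intro r
      induction r with
      | zero =>
        intro _
        obtain ⟨t', h1, h2⟩ := next 0 (by omega) t s ht hs
        obtain ⟨a, ha⟩ := exists_letterAt (mono' 1 le_rfl (by omega)).1
          (mono' 1 le_rfl (by omega)).2
        refine ⟨t' + 1, a, t', by omega, parse_succ_push h2 ha ?_⟩
        rw [show Parse.top ⟨s, k (0 + 1)⟩ = k 0 from hs, ← ha]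
        exact yields
      | succ r ihr =>
        intro hr
        obtain ⟨t', a, b, h1, h2⟩ := ihr (by omega)
        obtain ⟨t'', h3, h4⟩ := next (r + 1) (by omega) t' _ h2 rfl
        obtain ⟨a', ha'⟩ := exists_letterAt (mono' (r + 2) (by omega) (by omega)).1
          (mono' (r + 2) (by omega) (by omega)).2
        refine ⟨t'' + 1, a', b, by omega, parse_succ_shift h4 ha' ?_⟩
        rw [← ha']
        exact equal (r + 1) (by omega) (by omega)
    obtain ⟨t', a, b, h1, h2⟩ := key m (by omega)
    obtain ⟨t'', h3, h4⟩ := next (m + 1) (by omega) t' _ h2 rfl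
    exact ⟨t'' + 1, by omega, parse_succ_pop h4 takes⟩

end parse

/-! ### The parse of a compatible word -/

section OPWord

variable {A : Type u} {M : OPM A}

theorem exists_parse_end (w : OPWord M) : ∃ t, parse M w.1 t = ⟨[], w.1.length + 1⟩ := by
  obtain ⟨t, -, ht⟩ := w.2.2.exists_parse 0 [] rfl rfl
  exact ⟨t, ht⟩

open Classical in
/-- The number of moves of the parser on a compatible word. -/
noncomputable def dur (w : OPWord M) : ℕ := Nat.find (exists_parse_end w)

variable (w : OPWord M)

theorem parse_dur : parse M w.1 (dur w) = ⟨[], w.1.length + 1⟩ := by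
  classical exact Nat.find_spec (exists_parse_end w)

theorem length_pos : 1 ≤ w.1.length := List.length_pos_iff.2 w.2.1

theorem op_final : Parse.op M w.1 ⟨[], w.1.length + 1⟩ = .halt := by
  unfold Parse.op
  rw [letterAt_length_succ]
  rcases M.rel _ _ with _ | _ | _ | _ <;> rfl

theorem opAt_dur : opAt M w.1 (dur w) = .halt := by
  rw [opAt, parse_dur, op_final]

theorem parse_of_halt {t : ℕ} (h : opAt M w.1 t = .halt) (d : ℕ) :
    parse M w.1 (t + d) = parse M w.1 t := by
  induction d with
  | zero => rfl
  | succ d ih =>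
    rw [← Nat.add_assoc, parse, ih]
    change Parse.apply _ _ (opAt M w.1 t) = _
    rw [h]; rfl

theorem opAt_ne_halt {t : ℕ} (h : t < dur w) : opAt M w.1 t ≠ .halt := by
  classical
  intro e
  refine Nat.find_min (exists_parse_end w) h ?_
  rw [← parse_of_halt w e (dur w - t), Nat.add_sub_cancel' h.le, parse_dur]

theorem parse_of_dur_le {t : ℕ} (h : dur w ≤ t) : parse M w.1 t = parse M w.1 (dur w) := by
  rw [← parse_of_halt w (opAt_dur w) (t - dur w), Nat.add_sub_cancel' h]

/-- The parser halts in this configuration, and it halts at no time before `dur w`. -/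
theorem eq_dur_of_parse {t : ℕ} (h : t ≤ dur w) (ht : parse M w.1 t = ⟨[], w.1.length + 1⟩) :
    t = dur w := by
  rcases h.lt_or_eq with h | h
  · exact absurd (by rw [opAt, ht, op_final]) (opAt_ne_halt w h)
  · exact h

theorem lookAt_dur : lookAt M w.1 (dur w) = w.1.length + 1 := by rw [lookAt, parse_dur]

theorem topAt_dur : topAt M w.1 (dur w) = 0 := by rw [topAt, parse_dur]; rfl

theorem topAt_lt_lookAt (w : List A) (t : ℕ) : topAt M w t < lookAt M w t :=
  (parse_wf M w t).top_lt

theorem lookAt_le (w : List A) (t : ℕ) : lookAt M w t ≤ w.length + 1 := (parse_wf M w t).le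

theorem one_le_lookAt (w : List A) (t : ℕ) : 1 ≤ lookAt M w t := (parse_wf M w t).one_le

/-- A move is either a reading move or a pop. -/
theorem read_or_pop {t : ℕ} (h : t < dur w) :
    ((lookAt M w.1 (t + 1) = lookAt M w.1 t + 1 ∧ topAt M w.1 (t + 1) = lookAt M w.1 t) ∧
      lookAt M w.1 t ≤ w.1.length ∧
      ((∃ a, opAt M w.1 t = .push a) ∨ ∃ a, opAt M w.1 t = .shift a)) ∨
    (lookAt M w.1 (t + 1) = lookAt M w.1 t ∧ topAt M w.1 (t + 1) < topAt M w.1 t) ∧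
      opAt M w.1 t = .pop := by
  have hm := parse_move M w.1 t
  have hh := opAt_ne_halt w h
  have wf := parse_wf M w.1 t
  have wf' := parse_wf M w.1 (t + 1)
  unfold topAt lookAt
  generalize parse M w.1 t = p, opAt M w.1 t = o, parse M w.1 (t + 1) = p' at *
  cases hm with
  | push s j a ha h => exact .inl ⟨⟨rfl, rfl⟩, (letterAt_eq_some ha).2, .inl ⟨a, rfl⟩⟩
  | shift b v r s j a ha h => exact .inl ⟨⟨rfl, rfl⟩, (letterAt_eq_some ha).2, .inr ⟨a, rfl⟩⟩
  | pop b v r s j h =>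
    refine .inr ⟨⟨rfl, ?_⟩, rfl⟩
    cases s with
    | nil =>
      change 0 < v
      exact (letterAt_eq_some (wf.letter (b, v, r) (by simp))).1
    | cons x s => exact (List.pairwise_cons.1 wf.sorted).1 x (by simp)
  | halt p h => exact absurd rfl hh

theorem lookAt_mono : Monotone (lookAt M w.1) := by
  refine monotone_nat_of_le_succ fun t => ?_
  by_cases h : t < dur w
  · rcases read_or_pop w h with h | h <;> omega
  · unfold lookAt
    rw [parse_of_dur_le w (show dur w ≤ t by omega),
      parse_of_dur_le w (show dur w ≤ t + 1 by omega)]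

/-- The lookahead grows from `1` to `|w| + 1` in steps of at most one, so it cannot jump over `y`.
-/
theorem exists_read {y : ℕ} (h : 1 ≤ y) (h' : y ≤ w.1.length) :
    ∃ t < dur w, lookAt M w.1 t = y ∧ lookAt M w.1 (t + 1) = y + 1 := by
  by_contra! hc
  have key : ∀ t ≤ dur w, lookAt M w.1 t ≤ y := by
    intro t
    induction t with
    | zero => intro _; exact h
    | succ t ih =>
      intro ht
      have := ih (by omega)
      have := hc t (by omega)
      rcases read_or_pop w (show t < dur w by omega) with h | h <;> omega
  have := key _ le_rfl
  rw [lookAt_dur] at this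
  omega

/-- While the lookahead stays fixed all moves are pops, and each of them lowers the top. -/
theorem topAt_lt_topAt {t t' : ℕ} (h : t < t') (h' : t' ≤ dur w)
    (hl : lookAt M w.1 t = lookAt M w.1 t') : topAt M w.1 t' < topAt M w.1 t := by
  induction t', h using Nat.le_induction with
  | base =>
    simp only [Nat.succ_eq_add_one] at *
    rcases read_or_pop w (show t < dur w by omega) with h | h <;> omega
  | succ t' h ih =>
    have h1 := lookAt_mono w (show t ≤ t' by omega)
    have h2 := lookAt_mono w (Nat.le_succ t')
    have := ih (by omega) (by simp only [Nat.succ_eq_add_one] at h2; omega)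
    rcases read_or_pop w (show t' < dur w by omega) with h | h <;>
      simp only [Nat.succ_eq_add_one] at h2 <;> omega

theorem read_unique {t t' : ℕ} (h : lookAt M w.1 (t + 1) = lookAt M w.1 t + 1)
    (h' : lookAt M w.1 (t' + 1) = lookAt M w.1 t' + 1)
    (hl : lookAt M w.1 t = lookAt M w.1 t') : t = t' := by
  rcases lt_trichotomy t t' with e | e | e
  · have := lookAt_mono w (show t + 1 ≤ t' by omega); omega
  · exact e
  · have := lookAt_mono w (show t' + 1 ≤ t by omega); omega

/-- The bridge between logic and automata: it is used both to recognize the chain relation and to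
find the moves of a run by means of chains. -/
theorem link_iff_exists_time {v y : ℕ} :
    (Link M w.1 v y ∧ y ≤ w.1.length + 1) ↔
      ∃ t ≤ dur w, topAt M w.1 t = v ∧ lookAt M w.1 t = y := by
  constructor
  · rintro ⟨h, hy⟩
    have hv := h.lt
    -- Begin just after `v` has been read, or at time `0` if `v` is the left marker.
    obtain ⟨t, ht, h1, h2⟩ : ∃ t ≤ dur w, topAt M w.1 t = v ∧ lookAt M w.1 t = v + 1 := by
      rcases Nat.eq_zero_or_pos v with rfl | hv0
      · exact ⟨0, by omega, rfl, rfl⟩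
      · obtain ⟨t, ht, h1, h2⟩ := exists_read w hv0 (by omega)
        refine ⟨t + 1, ht, ?_, h2⟩
        rcases read_or_pop w ht with h | h <;> omega
    rcases h with h | h
    · exact ⟨t, ht, h1, by omega⟩
    · obtain ⟨t', -, h3⟩ := h.exists_parse t (parse M w.1 t).stack
        (by rw [← h2]; rfl) h1
      have h4 : topAt M w.1 t' = v := by rw [topAt, h3]; exact h1
      have h5 : lookAt M w.1 t' = y := by rw [lookAt, h3]
      by_cases h6 : t' ≤ dur w
      · exact ⟨t', h6, h4, h5⟩
      -- `exists_parse` does not bound its time, but after `dur w` the parser stands still.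
      · refine ⟨dur w, le_rfl, ?_, ?_⟩
        · rw [topAt, ← parse_of_dur_le w (show dur w ≤ t' by omega)]; exact h4
        · rw [lookAt, ← parse_of_dur_le w (show dur w ≤ t' by omega)]; exact h5
  · rintro ⟨t, ht, rfl, rfl⟩
    exact ⟨link_topAt t, lookAt_le _ t⟩

end OPWord

end OPL

namespace OPL

universe u v

/-! ## Regular predicates on labelled words -/

/-- A deterministic and total pushdown recognizer for labelled words. The labels of the two end
markers are read by `init` and `final`; the flag of `read` distinguishes shifts from pushes. -/
structure Recognizer (A : Type*) (Γ : Type*) (D : Type) where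
  init : Γ → D
  read : Bool → D → A → Γ → D
  pop : D → D → D
  final : D → Γ → Prop

namespace Recognizer

variable {A : Type u} {Γ : Type*} {D : Type} (𝒟 : Recognizer A Γ D)

/-- The effect of a move on the stack of states and the current state. -/
def act (γ : Γ) : Op A → List D × D → List D × D
  | .push a, (s, q) => (q :: s, 𝒟.read false q a γ)
  | .shift a, (s, q) => (s, 𝒟.read true q a γ)
  | .pop, (p :: s, q) => (s, 𝒟.pop q p)
  | .pop, ([], q) => ([], q)
  | .halt, x => x

/-- The stack of states and the current state at time `t`. -/
def cfg (M : OPM A) (w : List A) (c : ℕ → Γ) : ℕ → List D × D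
  | 0 => ([], 𝒟.init (c 0))
  | t + 1 => 𝒟.act (c (lookAt M w t)) (opAt M w t) (cfg M w c t)

/-- Acceptance of a labelled word. -/
def Accepts {M : OPM A} (w : OPWord M) (c : ℕ → Γ) : Prop :=
  𝒟.final (𝒟.cfg M w.1 c (dur w)).2 (c (w.1.length + 1))

/-- The recognizer copies the stack moves of the parser. In particular, the default value of `act`
for a pop on the empty stack never matters. -/
theorem cfg_length (M : OPM A) (w : List A) (c : ℕ → Γ) (t : ℕ) :
    (𝒟.cfg M w c t).1.length = (parse M w t).stack.length := by
  induction t with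
  | zero => rfl
  | succ t ih =>
    rw [cfg]
    have h := parse_move M w t
    generalize lookAt M w t = l, parse M w t = p, opAt M w t = o, parse M w (t + 1) = p',
      𝒟.cfg M w c t = x at *
    obtain ⟨s', q⟩ := x
    cases h with
    | push s j a ha h => simpa [act] using ih
    | shift b v r s j a ha h => simpa [act] using ih
    | pop b v r s j h =>
      cases s' with
      | nil => simp at ih
      | cons p s' => simpa [act] using ih
    | halt p h => exact ih

theorem cfg_dur_stack {M : OPM A} (w : OPWord M) (c : ℕ → Γ) :
    (𝒟.cfg M w.1 c (dur w)).1 = [] := by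
  have := 𝒟.cfg_length M w.1 c (dur w)
  rw [parse_dur] at this
  exact List.length_eq_zero_iff.1 this

/-- Only the labels before the lookahead have been read, so the label at the lookahead can still be
chosen freely. The guesses in `guess_cfg` rest on this. -/
theorem cfg_congr {M : OPM A} (w : OPWord M) {c c' : ℕ → Γ} {t : ℕ} (ht : t ≤ dur w)
    (h : ∀ i < lookAt M w.1 t, c i = c' i) : 𝒟.cfg M w.1 c t = 𝒟.cfg M w.1 c' t := by
  induction t with
  | zero => simp only [cfg]; rw [h 0 (by simp [lookAt, parse])]
  | succ t ih =>
    have hl := lookAt_mono w (Nat.le_succ t)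
    have ih := ih (by omega) fun i hi => h i (hi.trans_le hl)
    rw [cfg, cfg, ih]
    rcases read_or_pop w (show t < dur w by omega) with h' | h'
    · rw [h _ (by omega)]
    · rw [h'.2]
      rcases 𝒟.cfg M w.1 c' t with ⟨_ | ⟨p, s⟩, q⟩ <;> rfl

end Recognizer

/-- A predicate on labelled words that is accepted by a finite deterministic recognizer. -/
def Regular {A : Type u} {M : OPM A} {Γ : Type*} (P : OPWord M → (ℕ → Γ) → Prop) : Prop :=
  ∃ (D : Type) (_ : Finite D) (𝒟 : Recognizer A Γ D), ∀ w c, P w c ↔ 𝒟.Accepts w c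

namespace Regular

variable {A : Type u} {M : OPM A} {Γ : Type*} {Γ' : Type*} {P Q : OPWord M → (ℕ → Γ) → Prop}

theorem congr (h : Regular P) (e : ∀ w c, Q w c ↔ P w c) : Regular Q := by
  obtain ⟨D, hD, 𝒟, h⟩ := h
  exact ⟨D, hD, 𝒟, fun w c => (e w c).trans (h w c)⟩

theorem const (p : Prop) : Regular fun (_ : OPWord M) (_ : ℕ → Γ) => p :=
  ⟨Unit, inferInstance, ⟨fun _ => (), fun _ _ _ _ => (), fun _ _ => (), fun _ _ => p⟩,
    fun _ _ => Iff.rfl⟩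

/-- Recognizers are deterministic and total, so it suffices to negate `final`; the configurations
stay the same. -/
theorem not (h : Regular P) : Regular fun w c => ¬ P w c := by
  obtain ⟨D, hD, 𝒟, h⟩ := h
  refine ⟨D, hD, ⟨𝒟.init, 𝒟.read, 𝒟.pop, fun q γ => ¬ 𝒟.final q γ⟩, fun w c => ?_⟩
  simp only [h]
  set ℰ : Recognizer A Γ D := ⟨𝒟.init, 𝒟.read, 𝒟.pop, fun q γ => ¬ 𝒟.final q γ⟩
  have key : ∀ t, ℰ.cfg M w.1 c t = 𝒟.cfg M w.1 c t := by
    intro t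
    induction t with
    | zero => rfl
    | succ t ih =>
      rw [Recognizer.cfg, Recognizer.cfg, ih]
      rcases opAt M w.1 t with a | a | _ | _ <;> rfl
  unfold Recognizer.Accepts
  rw [key]

theorem comap (h : Regular P) (f : Γ' → Γ) :
    Regular fun (w : OPWord M) (c : ℕ → Γ') => P w fun i => f (c i) := by
  obtain ⟨D, hD, 𝒟, h⟩ := h
  refine ⟨D, hD, ⟨fun γ => 𝒟.init (f γ), fun b q a γ => 𝒟.read b q a (f γ), 𝒟.pop,
    fun q γ => 𝒟.final q (f γ)⟩, fun w c => ?_⟩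
  simp only [h]
  set ℰ : Recognizer A Γ' D := ⟨fun γ => 𝒟.init (f γ), fun b q a γ => 𝒟.read b q a (f γ), 𝒟.pop,
    fun q γ => 𝒟.final q (f γ)⟩
  have key : ∀ t, ℰ.cfg M w.1 c t = 𝒟.cfg M w.1 (fun i => f (c i)) t := by
    intro t
    induction t with
    | zero => rfl
    | succ t ih =>
      rw [Recognizer.cfg, Recognizer.cfg, ih]
      rcases opAt M w.1 t with a | a | _ | _ <;> rfl
  unfold Recognizer.Accepts
  rw [key]

theorem or (h : Regular P) (h' : Regular Q) : Regular fun w c => P w c ∨ Q w c := by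
  obtain ⟨D, hD, 𝒟, h⟩ := h
  obtain ⟨E, hE, ℰ, h'⟩ := h'
  refine ⟨D × E, inferInstance, ⟨fun γ => (𝒟.init γ, ℰ.init γ),
    fun b q a γ => (𝒟.read b q.1 a γ, ℰ.read b q.2 a γ),
    fun q p => (𝒟.pop q.1 p.1, ℰ.pop q.2 p.2), fun q γ => 𝒟.final q.1 γ ∨ ℰ.final q.2 γ⟩,
    fun w c => ?_⟩
  simp only [h, h']
  set ℱ : Recognizer A Γ (D × E) := ⟨fun γ => (𝒟.init γ, ℰ.init γ),
    fun b q a γ => (𝒟.read b q.1 a γ, ℰ.read b q.2 a γ),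
    fun q p => (𝒟.pop q.1 p.1, ℰ.pop q.2 p.2), fun q γ => 𝒟.final q.1 γ ∨ ℰ.final q.2 γ⟩
  have key : ∀ t, 𝒟.cfg M w.1 c t = ((ℱ.cfg M w.1 c t).1.map Prod.fst, (ℱ.cfg M w.1 c t).2.1) ∧
      ℰ.cfg M w.1 c t = ((ℱ.cfg M w.1 c t).1.map Prod.snd, (ℱ.cfg M w.1 c t).2.2) := by
    intro t
    induction t with
    | zero => exact ⟨rfl, rfl⟩
    | succ t ih =>
      rw [Recognizer.cfg, Recognizer.cfg, Recognizer.cfg, ih.1, ih.2]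
      rcases opAt M w.1 t with a | a | _ | _ <;> try exact ⟨rfl, rfl⟩
      rcases ℱ.cfg M w.1 c t with ⟨_ | ⟨p, s⟩, q⟩ <;> exact ⟨rfl, rfl⟩
  unfold Recognizer.Accepts
  rw [(key _).1, (key _).2]

theorem and (h : Regular P) (h' : Regular Q) : Regular fun w c => P w c ∧ Q w c :=
  (h.not.or h'.not).not.congr fun w c => by tauto

theorem exists_finite {ι : Type*} [Finite ι] {P : ι → OPWord M → (ℕ → Γ) → Prop}
    (h : ∀ i, Regular (P i)) : Regular fun w c => ∃ i, P i w c := by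
  classical
  cases nonempty_fintype ι
  have key : ∀ s : Finset ι, Regular fun w c => ∃ i ∈ s, P i w c := by
    intro s
    induction s using Finset.induction_on with
    | empty => exact (const False).congr fun w c => by simp
    | insert i s _ ih => exact ((h i).or ih).congr fun w c => by simp
  exact (key Finset.univ).congr fun w c => by simp

/-- States of the subset construction: pairs of the state below the topmost stack symbol and the
current state. The recognizer guesses the second components of the labels. -/
def guess {D : Type} {Δ : Type*} (𝒟 : Recognizer A (Γ × Δ) D) :
    Recognizer A Γ (Set (D × D)) where
  init γ := {x | ∃ δ, x.2 = 𝒟.init (γ, δ)}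
  read b R a γ := match b with
    | false => {x | ∃ δ, x.2 = 𝒟.read false x.1 a (γ, δ)}
    | true => {x | ∃ q δ, (x.1, q) ∈ R ∧ x.2 = 𝒟.read true q a (γ, δ)}
  pop R R' := {x | ∃ p q, (p, q) ∈ R ∧ (x.1, p) ∈ R' ∧ x.2 = 𝒟.pop q p}
  final R γ := ∃ p q δ, (p, q) ∈ R ∧ 𝒟.final q (γ, δ)

/-- A stack of states is linked by a stack of relations. -/
def Linked {D : Type} : List D → D → List (Set (D × D)) → Set (D × D) → Prop
  | [], q, [], R => ∃ p, (p, q) ∈ R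
  | p :: s, q, R' :: S, R => (p, q) ∈ R ∧ Linked s p S R'
  | _, _, _, _ => False

/-- Correctness of the subset construction. A set of reachable states would forget which stored
state belongs to which current state; the relations keep this, and a reachable configuration of `𝒟`
is a path through the stack of relations. A pop composes the two topmost ones. -/
theorem guess_cfg {D : Type} {Δ : Type*} (𝒟 : Recognizer A (Γ × Δ) D) (w : OPWord M) (c : ℕ → Γ)
    (t : ℕ) (ht : t ≤ dur w) (s : List D) (q : D) :
    (∃ d : ℕ → Δ, 𝒟.cfg M w.1 (fun i => (c i, d i)) t = (s, q)) ↔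
      Linked s q ((guess 𝒟).cfg M w.1 c t).1 ((guess 𝒟).cfg M w.1 c t).2 := by
  classical
  induction t generalizing s q with
  | zero =>
    simp only [Recognizer.cfg, guess, Prod.mk.injEq]
    cases s with
    | nil =>
      simp only [Linked, true_and, Set.mem_ofPred_eq]
      exact ⟨fun ⟨d, h⟩ => ⟨q, d 0, h.symm⟩, fun ⟨_, δ, h⟩ => ⟨fun _ => δ, h.symm⟩⟩
    | cons p s => simp [Linked]
  | succ t ih =>
    have ht' : t < dur w := by omega
    have upd : ∀ (d : ℕ → Δ) (δ : Δ), 𝒟.cfg M w.1 (fun i => (c i,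
        Function.update d (lookAt M w.1 t) δ i)) t = 𝒟.cfg M w.1 (fun i => (c i, d i)) t := by
      intro d δ
      refine 𝒟.cfg_congr w ht'.le fun i hi => ?_
      rw [Function.update_of_ne (by omega)]
    have ih := ih ht'.le
    -- The guess splits into one for the past and a label `δ` for the lookahead, since changing `d`
    -- at the lookahead does not affect the past.
    have step : (∃ d : ℕ → Δ, 𝒟.cfg M w.1 (fun i => (c i, d i)) (t + 1) = (s, q)) ↔
        ∃ s' q' δ, (∃ d : ℕ → Δ, 𝒟.cfg M w.1 (fun i => (c i, d i)) t = (s', q')) ∧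
          𝒟.act (c (lookAt M w.1 t), δ) (opAt M w.1 t) (s', q') = (s, q) := by
      constructor
      · rintro ⟨d, hd⟩
        exact ⟨_, _, d (lookAt M w.1 t), ⟨d, rfl⟩, hd⟩
      · rintro ⟨s', q', δ, ⟨d, hd⟩, h⟩
        refine ⟨Function.update d (lookAt M w.1 t) δ, ?_⟩
        rw [Recognizer.cfg, upd, hd, Function.update_self]
        exact h
    rw [step, Recognizer.cfg]
    simp only [ih]
    -- A pop reads no label, yet `step` asks for some `δ`; a labelling behind a linked configuration
    -- provides one.
    have hΔ : ∀ s' q', Linked s' q' ((guess 𝒟).cfg M w.1 c t).1 ((guess 𝒟).cfg M w.1 c t).2 →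
        Nonempty Δ := fun s' q' h => by
      obtain ⟨d, -⟩ := (ih s' q').2 h
      exact ⟨d 0⟩
    have hlen := (guess 𝒟).cfg_length M w.1 c t
    have hm := parse_move M w.1 t
    have hh := opAt_ne_halt w ht'
    generalize lookAt M w.1 t = l, (guess 𝒟).cfg M w.1 c t = X, parse M w.1 t = p,
      parse M w.1 (t + 1) = p', opAt M w.1 t = o at *
    obtain ⟨S, R⟩ := X
    cases hm with
    | push s₁ j a ha h =>
      simp only [Recognizer.act, Prod.mk.injEq]
      constructor
      · rintro ⟨s', q', δ, h1, rfl, rfl⟩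
        exact ⟨⟨δ, rfl⟩, h1⟩
      · intro h1
        cases s with
        | nil => exact h1.elim
        | cons p s =>
          obtain ⟨⟨δ, h2⟩, h3⟩ := h1
          exact ⟨s, p, δ, h3, rfl, h2.symm⟩
    | shift b v r s₁ j a ha h =>
      simp only [Recognizer.act, Prod.mk.injEq]
      cases S with
      | nil => simp at hlen
      | cons R' S =>
        constructor
        · rintro ⟨s', q', δ, h1, rfl, rfl⟩
          cases s' with
          | nil => exact h1.elim
          | cons p s' => exact ⟨⟨q', δ, h1.1, rfl⟩, h1.2⟩
        · intro h1
          cases s with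
          | nil => exact h1.elim
          | cons p s =>
            obtain ⟨⟨q', δ, h2, h4⟩, h3⟩ := h1
            exact ⟨p :: s, q', δ, ⟨h2, h3⟩, rfl, h4.symm⟩
    | pop b v r s₁ j h =>
      cases S with
      | nil => simp at hlen
      | cons R' S =>
        simp only [Recognizer.act]
        constructor
        · rintro ⟨s', q', δ, h1, h2⟩
          cases s' with
          | nil => exact h1.elim
          | cons p s' =>
            simp only [Prod.mk.injEq] at h2
            obtain ⟨rfl, rfl⟩ := h2
            cases s' with
            | nil =>
              cases S with
              | nil =>
                obtain ⟨h2, p', h3⟩ := h1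
                exact ⟨p', p, q', h2, h3, rfl⟩
              | cons => exact h1.2.elim
            | cons p' s' =>
              cases S with
              | nil => exact h1.2.elim
              | cons R'' S => exact ⟨⟨p, q', h1.1, h1.2.1, rfl⟩, h1.2.2⟩
        · intro h1
          -- Unfolding the composed relation recovers the popped state `p`.
          have : ∃ p q', Linked (p :: s) q' (R' :: S) R ∧ q = 𝒟.pop q' p := by
            cases s with
            | nil =>
              cases S with
              | nil =>
                obtain ⟨p', p, q', h2, h3, h4⟩ := h1
                exact ⟨p, q', ⟨h2, p', h3⟩, h4⟩
              | cons => exact h1.elim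
            | cons p' s =>
              cases S with
              | nil => exact h1.elim
              | cons R'' S =>
                obtain ⟨⟨p, q', h2, h3, h4⟩, h5⟩ := h1
                exact ⟨p, q', ⟨h2, h3, h5⟩, h4⟩
          obtain ⟨p, q', h2, h3⟩ := this
          obtain ⟨δ⟩ := hΔ _ _ h2
          exact ⟨p :: s, q', δ, h2, by rw [h3]⟩
    | halt p h => exact absurd rfl hh

theorem proj {Δ : Type*} {P : OPWord M → (ℕ → Γ × Δ) → Prop} (h : Regular P) :
    Regular fun w c => ∃ d : ℕ → Δ, P w fun i => (c i, d i) := by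
  classical
  obtain ⟨D, hD, 𝒟, h⟩ := h
  refine ⟨Set (D × D), inferInstance, guess 𝒟, fun w c => ?_⟩
  simp only [h, Recognizer.Accepts]
  have hS := (guess 𝒟).cfg_dur_stack w c
  have key := guess_cfg 𝒟 w c (dur w) le_rfl []
  rw [hS] at key
  constructor
  · rintro ⟨d, hd⟩
    obtain ⟨p, hp⟩ := (key _).1 ⟨d, Prod.ext (𝒟.cfg_dur_stack w _) rfl⟩
    exact ⟨p, _, _, hp, hd⟩
  · rintro ⟨p, q, δ, hp, hf⟩
    obtain ⟨d, hd⟩ := (key q).2 ⟨p, hp⟩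
    -- The label of the right marker is read only by `final`, so it can be set after the rest of
    -- `d`.
    refine ⟨Function.update d (w.1.length + 1) δ, ?_⟩
    rw [𝒟.cfg_congr w (c' := fun i => (c i, d i)) le_rfl, hd, Function.update_self]
    · exact hf
    · intro i hi
      rw [lookAt_dur] at hi
      rw [Function.update_of_ne (by omega)]

end Regular

/-! ### Recognizers for the atomic formulas -/

namespace Recognizer

variable {A : Type u} {M : OPM A} {Γ : Type*} {D : Type} (𝒟 : Recognizer A Γ D)

/-- Invariants of recognizers that ignore the stack. -/
theorem cfg_scan {δ : D → Option A → Γ → D} (hp : ∀ q p, 𝒟.pop q p = q)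
    (hr : ∀ b q a γ, 𝒟.read b q a γ = δ q (some a) γ) (w : OPWord M) (c : ℕ → Γ)
    (I : ℕ → D → Prop) (h1 : I 1 (𝒟.init (c 0)))
    (h2 : ∀ j q, 1 ≤ j → I j q → I (j + 1) (δ q (letterAt w.1 j) (c j))) :
    I (w.1.length + 1) (𝒟.cfg M w.1 c (dur w)).2 := by
  rw [← lookAt_dur w]
  suffices ∀ t, I (lookAt M w.1 t) (𝒟.cfg M w.1 c t).2 from this _
  intro t
  induction t with
  | zero => exact h1
  | succ t ih =>
    rw [cfg]
    have hm := parse_move M w.1 t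
    have h3 := one_le_lookAt (M := M) w.1 t
    unfold lookAt at *
    generalize 𝒟.cfg M w.1 c t = X, parse M w.1 t = p, parse M w.1 (t + 1) = p',
      opAt M w.1 t = o at *
    obtain ⟨S, q⟩ := X
    cases hm with
    | push s j a ha h => simp only [act, hr]; rw [← ha]; exact h2 j q h3 ih
    | shift b v r s j a ha h => simp only [act, hr]; rw [← ha]; exact h2 j q h3 ih
    | pop b v r s j h =>
      cases S with
      | nil => exact ih
      | cons p S => simp only [act, hp]; exact ih
    | halt p h => exact ih

end Recognizer

namespace Regular

variable {A : Type u} {M : OPM A} {Γ : Type*}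

theorem exists_pos (R : Option A → Γ → Prop) :
    Regular fun (w : OPWord M) (c : ℕ → Γ) =>
      ∃ i, i ≤ w.1.length + 1 ∧ R (letterAt w.1 i) (c i) := by
  set 𝒟 : Recognizer A Γ Prop :=
    ⟨fun γ => R none γ, fun _ q a γ => q ∨ R (some a) γ, fun q _ => q, fun q γ => q ∨ R none γ⟩
  refine ⟨Prop, inferInstance, 𝒟, fun w c => ?_⟩
  have key := 𝒟.cfg_scan (δ := fun q a γ => q ∨ R a γ) (fun _ _ => rfl) (fun _ _ _ _ => rfl) w c
    (fun j q => q ↔ ∃ i < j, R (letterAt w.1 i) (c i)) (by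
      simp only [Nat.lt_one_iff, exists_eq_left]; rfl) (by
      intro j q _ h
      simp only [h, Nat.lt_succ_iff_lt_or_eq, or_and_right, exists_or, exists_eq_left])
  change _ ↔ (𝒟.cfg M w.1 c (dur w)).2 ∨ R none (c (w.1.length + 1))
  rw [key, ← letterAt_length_succ w.1]
  simp only [← Nat.lt_succ_iff, Nat.lt_succ_iff_lt_or_eq, or_and_right, exists_or, exists_eq_left]

theorem exists_lt (R S : Γ → Prop) :
    Regular fun (w : OPWord M) (c : ℕ → Γ) =>
      ∃ i j, i < j ∧ j ≤ w.1.length + 1 ∧ R (c i) ∧ S (c j) := by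
  set 𝒟 : Recognizer A Γ (Prop × Prop) :=
    ⟨fun γ => (R γ, False), fun _ q _ γ => (q.1 ∨ R γ, q.2 ∨ q.1 ∧ S γ), fun q _ => q,
      fun q γ => q.2 ∨ q.1 ∧ S γ⟩
  refine ⟨Prop × Prop, inferInstance, 𝒟, fun w c => ?_⟩
  have key := 𝒟.cfg_scan (δ := fun q _ γ => (q.1 ∨ R γ, q.2 ∨ q.1 ∧ S γ)) (fun _ _ => rfl)
    (fun _ _ _ _ => rfl) w c
    (fun l q => (q.1 ↔ ∃ i < l, R (c i)) ∧ (q.2 ↔ ∃ i j, i < j ∧ j < l ∧ R (c i) ∧ S (c j))) (by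
      refine ⟨by simp only [Nat.lt_one_iff, exists_eq_left]; rfl, ?_⟩
      simp only [Nat.lt_one_iff]
      exact ⟨fun h => h.elim, fun ⟨i, j, h1, h2, _⟩ => by omega⟩) (by
      rintro l q _ ⟨e1, e2⟩
      simp only [e1, e2]
      constructor
      · simp only [Nat.lt_succ_iff_lt_or_eq, or_and_right, exists_or, exists_eq_left]
      · constructor
        · rintro (⟨i, j, h1, h2, h3⟩ | ⟨⟨i, h1, h2⟩, h3⟩)
          · exact ⟨i, j, h1, by omega, h3⟩
          · exact ⟨i, l, h1, by omega, h2, h3⟩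
        · rintro ⟨i, j, h1, h2, h3, h4⟩
          rcases Nat.lt_succ_iff_lt_or_eq.1 h2 with h2 | rfl
          · exact .inl ⟨i, j, h1, h2, h3, h4⟩
          · exact .inr ⟨⟨i, h1, h3⟩, h4⟩)
  change _ ↔ (𝒟.cfg M w.1 c (dur w)).2.2 ∨ (𝒟.cfg M w.1 c (dur w)).2.1 ∧ S (c (w.1.length + 1))
  rw [key.1, key.2]
  constructor
  · rintro ⟨i, j, h1, h2, h3, h4⟩
    rcases h2.lt_or_eq with h2 | rfl
    · exact .inl ⟨i, j, h1, h2, h3, h4⟩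
    · exact .inr ⟨⟨i, h1, h3⟩, h4⟩
  · rintro (⟨i, j, h1, h2, h3⟩ | ⟨⟨i, h1, h2⟩, h3⟩)
    · exact ⟨i, j, h1, by omega, h3⟩
    · exact ⟨i, _, h1, le_rfl, h2, h3⟩

theorem exists_unique_pos (R : Γ → Prop) :
    Regular fun (w : OPWord M) (c : ℕ → Γ) =>
      ∃ i ≤ w.1.length + 1, ∀ j ≤ w.1.length + 1, R (c j) ↔ j = i := by
  refine ((exists_pos fun _ γ => R γ).and (exists_lt R R).not).congr fun w c => ?_
  constructor
  · rintro ⟨i, hi, h⟩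
    refine ⟨⟨i, hi, (h i hi).2 rfl⟩, ?_⟩
    rintro ⟨j, k, h1, h2, h3, h4⟩
    have := (h j (by omega)).1 h3
    have := (h k h2).1 h4
    omega
  · rintro ⟨⟨i, hi, h⟩, h'⟩
    refine ⟨i, hi, fun j hj => ⟨fun hR => ?_, fun e => e ▸ h⟩⟩
    rcases lt_trichotomy i j with e | e | e
    · exact absurd ⟨i, j, e, hj, h, hR⟩ h'
    · exact e.symm
    · exact absurd ⟨j, i, e, hi, hR, h⟩ h'

/-- The recognizer for a chain from a position with label in `R` to one with label in `S`. The
components of a state say that the topmost symbol has a label in `R`, that such a symbol has been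
uncovered by a pop under the current lookahead, and that a chain has been found. -/
def chainRecognizer (A : Type*) (R S : Γ → Prop) : Recognizer A Γ (Prop × Prop × Prop) where
  init γ := (R γ, False, False)
  read _ q _ γ := (R γ, False, q.2.2 ∨ q.2.1 ∧ S γ)
  pop q p := (p.1, q.2.1 ∨ p.1, q.2.2)
  final q γ := q.2.2 ∨ q.2.1 ∧ S γ

/-- The first components of the states on the stack describe the labels below. -/
def Below (R : ℕ → Prop) : List (Prop × Prop × Prop) → List (A × ℕ × ℕ) → Prop
  | [], [] => True
  | p :: S, _ :: s => (p.1 ↔ R (Parse.top ⟨s, 0⟩)) ∧ Below R S s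
  | _, _ => False

/-- After a read the top is adjacent to the new lookahead, so the second flag is reset, and what it
recorded for the old lookahead enters the third one. After a pop the top is not adjacent to the
lookahead, so its label counts for the second flag. -/
theorem chainRecognizer_cfg (R S : Γ → Prop) (w : OPWord M) (c : ℕ → Γ) (t : ℕ) (ht : t ≤ dur w) :
    Below (fun i => R (c i)) ((chainRecognizer A R S).cfg M w.1 c t).1 (parse M w.1 t).stack ∧
    (((chainRecognizer A R S).cfg M w.1 c t).2.1 ↔ R (c (topAt M w.1 t))) ∧
    (((chainRecognizer A R S).cfg M w.1 c t).2.2.1 ↔ ∃ r ≤ t, lookAt M w.1 r = lookAt M w.1 t ∧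
      topAt M w.1 r + 1 ≠ lookAt M w.1 r ∧ R (c (topAt M w.1 r))) ∧
    (((chainRecognizer A R S).cfg M w.1 c t).2.2.2 ↔ ∃ r ≤ t, lookAt M w.1 r < lookAt M w.1 t ∧
      topAt M w.1 r + 1 ≠ lookAt M w.1 r ∧ R (c (topAt M w.1 r)) ∧ S (c (lookAt M w.1 r))) := by
  induction t with
  | zero =>
    refine ⟨trivial, Iff.rfl, ?_, ?_⟩ <;>
    simp [chainRecognizer, Recognizer.cfg, topAt, lookAt, parse, Parse.top]
  | succ t ih =>
    obtain ⟨ih1, ih2, ih3, ih4⟩ := ih (by omega)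
    have ht' : t < dur w := by omega
    have hle : ∀ p : ℕ → Prop, (∃ r ≤ t + 1, p r) ↔ (∃ r ≤ t, p r) ∨ p (t + 1) := by
      intro p
      constructor
      · rintro ⟨r, hr, h⟩
        rcases hr.lt_or_eq with hr | rfl
        · exact .inl ⟨r, by omega, h⟩
        · exact .inr h
      · rintro (⟨r, hr, h⟩ | h)
        · exact ⟨r, by omega, h⟩
        · exact ⟨t + 1, le_rfl, h⟩
    rw [hle, hle, Recognizer.cfg]
    have hmono : ∀ r ≤ t, lookAt M w.1 r ≤ lookAt M w.1 t := fun r hr => lookAt_mono w hr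
    have hm := parse_move M w.1 t
    rcases read_or_pop w ht' with ⟨⟨h1, h2⟩, -, h3⟩ | ⟨⟨h1, h2⟩, h3⟩
    · have hst : Below (fun i => R (c i)) ((chainRecognizer A R S).act (c (lookAt M w.1 t))
          (opAt M w.1 t) ((chainRecognizer A R S).cfg M w.1 c t)).1 (parse M w.1 (t + 1)).stack ∧
          ((chainRecognizer A R S).act (c (lookAt M w.1 t))
          (opAt M w.1 t) ((chainRecognizer A R S).cfg M w.1 c t)).2 =
          (R (c (lookAt M w.1 t)), False, ((chainRecognizer A R S).cfg M w.1 c t).2.2.2 ∨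
            ((chainRecognizer A R S).cfg M w.1 c t).2.2.1 ∧ S (c (lookAt M w.1 t))) := by
        clear hle hmono h1 h2 ih3 ih4
        unfold topAt at ih2
        generalize (chainRecognizer A R S).cfg M w.1 c t = X, lookAt M w.1 t = l,
          parse M w.1 t = p, parse M w.1 (t + 1) = p', opAt M w.1 t = o at *
        obtain ⟨T, q⟩ := X
        cases hm with
        | push s j a ha h => exact ⟨⟨ih2, ih1⟩, rfl⟩
        | shift b v r s j a ha h =>
          refine ⟨?_, rfl⟩
          cases T with
          | nil => exact ih1.elim
          | cons p T => exact ih1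
        | pop => simp at h3
        | halt => simp at h3
      refine ⟨hst.1, ?_⟩
      rw [hst.2, h1, h2]
      refine ⟨Iff.rfl, ?_, ?_⟩
      · simp only [false_iff, not_or, not_exists, not_and]
        exact ⟨fun r hr h => absurd (hmono r hr) (by omega), fun _ h => absurd rfl h⟩
      · simp only [ih3, ih4]
        constructor
        · rintro (⟨r, hr, h4, h5⟩ | ⟨⟨r, hr, h4, h5, h6⟩, h7⟩)
          · exact .inl ⟨r, hr, by omega, h5⟩
          · exact .inl ⟨r, hr, by omega, h5, h6, h4 ▸ h7⟩
        · rintro (⟨r, hr, h4, h5, h6, h7⟩ | h)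
          · rcases (show lookAt M w.1 r < lookAt M w.1 t ∨ lookAt M w.1 r = lookAt M w.1 t by
              omega) with h4 | h4
            · exact .inl ⟨r, hr, h4, h5, h6, h7⟩
            · exact .inr ⟨⟨r, hr, h4, h5, h6⟩, h4 ▸ h7⟩
          · omega
    · have hst : Below (fun i => R (c i)) ((chainRecognizer A R S).act (c (lookAt M w.1 t))
          (opAt M w.1 t) ((chainRecognizer A R S).cfg M w.1 c t)).1 (parse M w.1 (t + 1)).stack ∧
          ∃ p : Prop, (p ↔ R (c (topAt M w.1 (t + 1)))) ∧
          ((chainRecognizer A R S).act (c (lookAt M w.1 t))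
          (opAt M w.1 t) ((chainRecognizer A R S).cfg M w.1 c t)).2 =
          (p, ((chainRecognizer A R S).cfg M w.1 c t).2.2.1 ∨ p,
            ((chainRecognizer A R S).cfg M w.1 c t).2.2.2) := by
        clear hle hmono h1 h2 ih3 ih4 ih2
        unfold topAt
        generalize (chainRecognizer A R S).cfg M w.1 c t = X, lookAt M w.1 t = l,
          parse M w.1 t = p, parse M w.1 (t + 1) = p', opAt M w.1 t = o at *
        obtain ⟨T, q⟩ := X
        cases hm with
        | pop b v r s j h =>
          cases T with
          | nil => exact ih1.elim
          | cons p T => exact ⟨ih1.2, p.1, ih1.1, rfl⟩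
        | push => simp at h3
        | shift => simp at h3
        | halt => simp at h3
      obtain ⟨hst, p, hp, e⟩ := hst
      refine ⟨hst, ?_⟩
      have h4 := topAt_lt_lookAt (M := M) w.1 t
      rw [e, h1]
      refine ⟨hp, ?_, ?_⟩
      · simp only [ih3, hp, true_and]
        -- The uncovered top lies below the old top, which itself lies below the lookahead; hence it
        -- is not adjacent.
        exact or_congr Iff.rfl ⟨fun h => ⟨by omega, h⟩, fun h => h.2⟩
      · simp only [ih4, lt_irrefl, false_and, or_false]

/-- By `link_iff_exists_time`, chains are the moments at which top and lookahead are not adjacent.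
Those ending at the right marker are not yet in the third flag at time `dur w`; `final` tests them.
-/
theorem exists_chain (R S : Γ → Prop) :
    Regular fun (w : OPWord M) (c : ℕ → Γ) => ∃ i j, Chain M w.1 i j ∧ R (c i) ∧ S (c j) := by
  refine ⟨_, inferInstance, chainRecognizer A R S, fun w c => ?_⟩
  obtain ⟨-, -, h1, h2⟩ := chainRecognizer_cfg R S w c (dur w) le_rfl
  change _ ↔ _ ∨ _ ∧ S (c (w.1.length + 1))
  have chain : ∀ {i j}, Chain M w.1 i j ↔
      ∃ r ≤ dur w, i + 1 ≠ j ∧ topAt M w.1 r = i ∧ lookAt M w.1 r = j := by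
    intro i j
    constructor
    · intro h
      obtain ⟨r, hr, h1⟩ := (link_iff_exists_time w).1 ⟨.inr h, h.lt.2⟩
      have := h.lt
      exact ⟨r, hr, by omega, h1⟩
    · rintro ⟨r, hr, h1, h2⟩
      exact ((link_iff_exists_time w).2 ⟨r, hr, h2⟩).1.resolve_left h1
  rw [h1, h2, lookAt_dur]
  constructor
  · rintro ⟨i, j, h, h3, h4⟩
    obtain ⟨r, hr, h5, rfl, rfl⟩ := chain.1 h
    rcases (lookAt_le w.1 r).lt_or_eq with h6 | h6
    · exact .inl ⟨r, hr, h6, h5, h3, h4⟩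
    · exact .inr ⟨⟨r, hr, h6, h5, h3⟩, h6 ▸ h4⟩
  · rintro (⟨r, hr, -, h3, h4, h5⟩ | ⟨⟨r, hr, h3, h4, h5⟩, h6⟩)
    · exact ⟨_, _, chain.2 ⟨r, hr, h3, rfl, rfl⟩, h4, h5⟩
    · exact ⟨_, _, chain.2 ⟨r, hr, h4, rfl, rfl⟩, h5, by rw [h3]; exact h6⟩

end Regular

end OPL

namespace OPL

universe u v

/-! ## Boolean formulas define regular predicates -/

/-- A recognizer reads only the positions of `#w#`. This matters because `proj` guesses labels at
all natural numbers. -/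
theorem Regular.label_congr {A : Type u} {M : OPM A} {Γ : Type*} {P : OPWord M → (ℕ → Γ) → Prop}
    (h : Regular P) {w : OPWord M} {c c' : ℕ → Γ} (e : ∀ i ≤ w.1.length + 1, c i = c' i) :
    P w c ↔ P w c' := by
  obtain ⟨D, hD, 𝒟, h⟩ := h
  rw [h, h, Recognizer.Accepts, Recognizer.Accepts, e _ le_rfl,
    𝒟.cfg_congr w le_rfl fun i hi => e i (by rw [lookAt_dur] at hi; omega)]

/-- The variables that are marked at a position: the first-order variables with this value, and the
second-order variables whose value contains it. -/
abbrev Mark : Type := (ℕ → Prop) × (ℕ → Prop)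

/-- The encoding of an assignment by labels. -/
def Assignment.marks (σ : Assignment) (i : ℕ) : Mark :=
  (fun x => σ.fo x = i, fun X => i ∈ σ.so X)

theorem Assignment.marks_updFO (σ : Assignment) (x j i : ℕ) :
    (σ.updFO x j).marks i = (Function.update (σ.marks i).1 x (i = j), (σ.marks i).2) := by
  refine Prod.ext (funext fun y => ?_) rfl
  by_cases h : y = x
  · subst h; simp [marks, updFO, eq_comm]
  · simp [marks, updFO, h]

theorem Assignment.marks_updSO (σ : Assignment) (X : ℕ) (I : Finset ℕ) (i : ℕ) :
    (σ.updSO X I).marks i = ((σ.marks i).1, Function.update (σ.marks i).2 X (i ∈ I)) := by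
  refine Prod.ext rfl (funext fun y => ?_)
  by_cases h : y = X
  · subst h; simp [marks, updSO]
  · simp [marks, updSO, h]

/-- All first-order variables have positions of `#w#` as values. -/
def Assignment.Valid (σ : Assignment) (n : ℕ) : Prop := ∀ x, σ.fo x ≤ n + 1

theorem Assignment.Valid.updFO {σ : Assignment} {n : ℕ} (h : σ.Valid n) (x : ℕ) {i : ℕ}
    (hi : i ≤ n + 1) : (σ.updFO x i).Valid n := by
  intro y
  by_cases e : y = x
  · subst e; simpa [Assignment.updFO] using hi
  · simpa [Assignment.updFO, e] using h y

section

variable {A : Type u} {M : OPM A}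

/-- The value of the variable is guessed as a mark that occurs exactly once. The second predicate is
trivial for boolean formulas; it lets `Steps.prodFO` inspect the label at the marked position. -/
theorem Regular.exFO {Γ : Type*} {P : OPWord M → (ℕ → Mark × Γ) → Prop} (h : Regular P) (x : ℕ)
    {Q : OPWord M → (ℕ → Γ × Prop) → Prop} (hQ : Regular Q) :
    Regular fun (w : OPWord M) (c : ℕ → Mark × Γ) => ∃ j ≤ w.1.length + 1,
      P w (fun i => ((Function.update (c i).1.1 x (i = j), (c i).1.2), (c i).2)) ∧
        Q w (fun i => ((c i).2, i = j)) := by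
  have h1 : Regular fun (w : OPWord M) (c : ℕ → (Mark × Γ) × Prop) =>
      (∃ j ≤ w.1.length + 1, ∀ i ≤ w.1.length + 1, (c i).2 ↔ i = j) ∧
      P w (fun i => ((Function.update (c i).1.1.1 x (c i).2, (c i).1.1.2), (c i).1.2)) ∧
      Q w (fun i => ((c i).1.2, (c i).2)) :=
    (Regular.exists_unique_pos fun γ : (Mark × Γ) × Prop => γ.2).and
      ((h.comap fun γ : (Mark × Γ) × Prop =>
        ((Function.update γ.1.1.1 x γ.2, γ.1.1.2), γ.1.2)).and
        (hQ.comap fun γ : (Mark × Γ) × Prop => (γ.1.2, γ.2)))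
  refine h1.proj.congr fun w c => ?_
  constructor
  · rintro ⟨j, hj, h2⟩
    exact ⟨fun i => i = j, ⟨j, hj, fun i _ => Iff.rfl⟩, h2⟩
  · rintro ⟨d, ⟨j, hj, hd⟩, h2, h3⟩
    refine ⟨j, hj, (h.label_congr fun i hi => ?_).1 h2, (hQ.label_congr fun i hi => ?_).1 h3⟩
    · have e : d i = (i = j) := propext (hd i hi)
      simp only [e]
    · have e : d i = (i = j) := propext (hd i hi)
      simp only [e]

/-- The theorem of Büchi, Elgot and Trakhtenbrot for operator precedence languages: variables become
marks in the labels and quantifiers become projections. -/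
theorem BFormula.regular (β : BFormula A) :
    ∃ P : OPWord M → (ℕ → Mark) → Prop, Regular P ∧
      ∀ w σ, σ.Valid w.1.length → (β.Sat M w.1 σ ↔ P w σ.marks) := by
  induction β with
  | lab a x =>
    refine ⟨_, Regular.exists_pos fun b γ => b = a ∧ γ.1 x, fun w σ hσ => ?_⟩
    exact ⟨fun h => ⟨_, hσ x, h, rfl⟩, fun ⟨i, _, h, e⟩ => by subst e; exact h⟩
  | le x y =>
    refine ⟨_, (Regular.exists_pos fun _ γ => γ.1 x ∧ γ.1 y).or
      (Regular.exists_lt (fun γ => γ.1 x) fun γ => γ.1 y), fun w σ hσ => ?_⟩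
    constructor
    · intro h
      rcases (show σ.fo x ≤ σ.fo y from h).lt_or_eq with h | h
      · exact .inr ⟨_, _, h, hσ y, rfl, rfl⟩
      · exact .inl ⟨_, hσ y, h, rfl⟩
    · rintro (⟨i, _, h, h'⟩ | ⟨i, j, h1, _, h, h'⟩)
      · exact (h.trans h'.symm).le
      · exact (h.trans_lt (h1.trans_eq h'.symm)).le
  | chain x y =>
    refine ⟨_, Regular.exists_chain (fun γ => γ.1 x) fun γ => γ.1 y, fun w σ _ => ?_⟩
    exact ⟨fun h => ⟨_, _, h, rfl, rfl⟩, fun ⟨i, j, h, h1, h2⟩ => by subst h1 h2; exact h⟩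
  | mem x X =>
    refine ⟨_, Regular.exists_pos fun _ γ => γ.1 x ∧ γ.2 X, fun w σ hσ => ?_⟩
    exact ⟨fun h => ⟨_, hσ x, rfl, h⟩, fun ⟨i, _, h1, h2⟩ => by subst h1; exact h2⟩
  | not β ih =>
    obtain ⟨P, hP, h⟩ := ih
    exact ⟨_, hP.not, fun w σ hσ => not_congr (h w σ hσ)⟩
  | or β γ ihβ ihγ =>
    obtain ⟨P, hP, h⟩ := ihβ
    obtain ⟨Q, hQ, h'⟩ := ihγ
    exact ⟨_, hP.or hQ, fun w σ hσ => or_congr (h w σ hσ) (h' w σ hσ)⟩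
  | exFO x β ih =>
    obtain ⟨P, hP, h⟩ := ih
    refine ⟨_, ((hP.comap (Prod.fst : Mark × Unit → Mark)).exFO x (Regular.const True)).comap
      fun γ => (γ, ()), fun w σ hσ => ?_⟩
    refine exists_congr fun j => and_congr_right fun hj => ?_
    rw [h w _ (hσ.updFO x hj), and_true, funext (σ.marks_updFO x j)]
  | exSO X β ih =>
    obtain ⟨P, hP, h⟩ := ih
    have h1 := (hP.comap fun γ : Mark × Prop =>
      (γ.1.1, Function.update γ.1.2 X γ.2)).proj
    refine ⟨_, h1, fun w σ hσ => ?_⟩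
    constructor
    · rintro ⟨I, hI, hs⟩
      refine ⟨fun i => i ∈ I, ?_⟩
      have := (h w (σ.updSO X I) hσ).1 hs
      rwa [funext (σ.marks_updSO X I)] at this
    · rintro ⟨d, hd⟩
      classical
      -- The guessed set may leave `#w#`; it is cut down to the positions `0, …, |w| + 1`, the only
      -- ones that are read.
      refine ⟨(Finset.range (w.1.length + 2)).filter d, fun i hi => ?_, (h w (σ.updSO X _) hσ).2 ?_⟩
      · simp only [Finset.mem_filter, Finset.mem_range] at hi; omega
      · rw [funext (σ.marks_updSO X _)]
        refine (hP.label_congr fun i hi => ?_).1 hd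
        simp [show i < w.1.length + 2 by omega]

end

/-! ## Series given by regular sets of labellings -/

/-- The label of a position of `#w#` under a labelling of the positions of `w`. -/
def ext {C : Type*} {n : ℕ} (c : Fin n → C) : ℕ → Option C
  | 0 => none
  | i + 1 => if h : i < n then some (c ⟨i, h⟩) else none

theorem ext_map {C C' : Type*} {n : ℕ} (c : Fin n → C) (f : C → C') (i : ℕ) :
    ext (fun k => f (c k)) i = (ext c i).map f := by
  cases i with
  | zero => rfl
  | succ i => by_cases h : i < n <;> simp [ext, h]

theorem ext_eq_some {C : Type*} {n : ℕ} {c : Fin n → C} {i : ℕ} {a : C} :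
    ext c i = some a ↔ ∃ k : Fin n, (k : ℕ) + 1 = i ∧ c k = a := by
  cases i with
  | zero => simp [ext]
  | succ i =>
    by_cases h : i < n
    · simp only [ext, h, dif_pos, Option.some.injEq, Nat.add_right_cancel_iff]
      exact ⟨fun e => ⟨⟨i, h⟩, rfl, e⟩, fun ⟨k, hk, e⟩ => by subst hk; exact e⟩
    · simp only [ext, h, dif_neg, not_false_iff, Nat.add_right_cancel_iff, reduceCtorEq, false_iff]
      rintro ⟨k, hk, -⟩
      exact h (hk ▸ k.2)

theorem ext_succ {C : Type*} {n : ℕ} (c : Fin n → C) (k : Fin n) :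
    ext c ((k : ℕ) + 1) = some (c k) := ext_eq_some.2 ⟨k, rfl, rfl⟩

section

variable {A : Type u} {M : OPM A} {K : Type v} [Semiring K]

open Classical in
/-- The sum of the weights of the labellings `c` of `w` with `P w (σ, c)`, where the weight of a
labelling is the product of the weights of the labels. -/
noncomputable def labelSum {C : Type} [Fintype C] (val : C → K)
    (P : OPWord M → (ℕ → Mark × Option C) → Prop) (w : OPWord M) (σ : Assignment) : K :=
  ∑ c : Fin w.1.length → C,
    if P w (fun i => (σ.marks i, ext c i)) then (List.ofFn fun k => val (c k)).prod else 0

/-- Series that are given by a regular set of labellings with weights generated by `T`. -/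
def LabelSeries (f : OPWord M → Assignment → K) (T : Set K) : Prop :=
  ∃ (C : Type) (_ : Fintype C) (val : C → K) (P : OPWord M → (ℕ → Mark × Option C) → Prop),
    Regular P ∧ (∀ c, val c ∈ Subsemiring.closure T) ∧
      ∀ w σ, σ.Valid w.1.length → f w σ = labelSum val P w σ

namespace LabelSeries

variable {f g : OPWord M → Assignment → K} {T U : Set K}

theorem congr (h : LabelSeries f T) (e : ∀ w σ, σ.Valid w.1.length → g w σ = f w σ) :
    LabelSeries g T := by
  obtain ⟨C, hC, val, P, hP, hv, h⟩ := h
  exact ⟨C, hC, val, P, hP, hv, fun w σ hσ => (e w σ hσ).trans (h w σ hσ)⟩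

theorem one : LabelSeries (fun (_ : OPWord M) (_ : Assignment) => (1 : K)) T := by
  refine ⟨Unit, inferInstance, fun _ => 1, fun _ _ => True, Regular.const True,
    fun _ => one_mem _, fun w σ _ => ?_⟩
  simp [labelSum]

theorem mono (h : LabelSeries f T) (hT : T ⊆ U) : LabelSeries f U := by
  obtain ⟨C, hC, val, P, hP, hv, h⟩ := h
  exact ⟨C, hC, val, P, hP, fun c => Subsemiring.closure_mono hT (hv c), h⟩

open Classical in
theorem bool_mul (h : LabelSeries f T) (β : BFormula A) :
    LabelSeries (fun w σ => (if β.Sat M w.1 σ then 1 else 0) * f w σ) T := by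
  obtain ⟨C, hC, val, P, hP, hv, h⟩ := h
  obtain ⟨Q, hQ, hβ⟩ := β.regular (M := M)
  refine ⟨C, hC, val, _, (hQ.comap Prod.fst).and hP, hv, fun w σ hσ => ?_⟩
  beta_reduce
  rw [h w σ hσ, labelSum, labelSum, Finset.mul_sum]
  refine Finset.sum_congr rfl fun c _ => ?_
  by_cases h1 : Q w σ.marks
  · simp [hβ w σ hσ, h1]
  · simp [hβ w σ hσ, h1]

theorem prod_ofFn_first {n : ℕ} (hn : 1 ≤ n) (k : K) (f : Fin n → K) :
    (List.ofFn fun i => if (i : ℕ) = 0 then k * f i else f i).prod = k * (List.ofFn f).prod := by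
  obtain ⟨m, rfl⟩ : ∃ m, n = m + 1 := ⟨n - 1, by omega⟩
  simp [List.ofFn_succ, mul_assoc]

/-- The factor `k` is charged to the first position, which exists because words are non-empty. It is
the leftmost factor there, so nothing has to commute. A boolean flag marks the position; that the
flag sits exactly on the first position is expressed by the order of flagged and unflagged
positions. -/
theorem const_mul (h : LabelSeries f T) {k : K} (hk : k ∈ T) :
    LabelSeries (fun w σ => k * f w σ) T := by
  classical
  obtain ⟨C, hC, val, P, hP, hv, h⟩ := h
  let flag : Bool → Mark × Option (C × Bool) → Prop := fun b γ => ∃ a, γ.2 = some (a, b)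
  refine ⟨C × Bool, inferInstance, fun x => if x.2 then k * val x.1 else val x.1, _,
    (((Regular.exists_lt (flag false) (flag true)).or
      (Regular.exists_lt (flag true) (flag true))).not.and
      (Regular.exists_pos fun _ => flag true)).and
      (hP.comap fun γ => (γ.1, γ.2.map Prod.fst)), fun x => ?_, fun w σ hσ => ?_⟩
  · have hk' : k ∈ Subsemiring.closure T := Subsemiring.subset_closure hk
    beta_reduce
    split_ifs
    · exact mul_mem hk' (hv _)
    · exact hv _
  beta_reduce
  rw [h w σ hσ, labelSum, labelSum, Finset.mul_sum]
  have hn := length_pos w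
  have hflag : ∀ (c : Fin w.1.length → C × Bool) b i, flag b (σ.marks i, ext c i) ↔
      ∃ k : Fin w.1.length, (k : ℕ) + 1 = i ∧ (c k).2 = b := by
    intro c b i
    simp only [flag, ext_eq_some]
    exact ⟨fun ⟨a, k, hk, e⟩ => ⟨k, hk, by rw [e]⟩,
      fun ⟨k, hk, e⟩ => ⟨(c k).1, k, hk, Prod.ext rfl e⟩⟩
  have hfirst : ∀ c : Fin w.1.length → C × Bool,
      ((¬((∃ i j, i < j ∧ j ≤ w.1.length + 1 ∧ flag false (σ.marks i, ext c i) ∧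
        flag true (σ.marks j, ext c j)) ∨
        ∃ i j, i < j ∧ j ≤ w.1.length + 1 ∧ flag true (σ.marks i, ext c i) ∧
        flag true (σ.marks j, ext c j))) ∧
        ∃ i, i ≤ w.1.length + 1 ∧ flag true (σ.marks i, ext c i)) ↔
      ∀ k : Fin w.1.length, (c k).2 = decide ((k : ℕ) = 0) := by
    intro c
    simp only [hflag]
    constructor
    · rintro ⟨h1, i, -, k, rfl, hk⟩
      push Not at h1
      have h2 : ∀ k' : Fin w.1.length, k' < k → False := by
        intro k' hlt
        rcases e : (c k').2 with _ | _
        · exact h1.1 _ _ (Nat.succ_lt_succ hlt) (by have := k.2; omega) ⟨k', rfl, e⟩ k rfl hk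
        · exact h1.2 _ _ (Nat.succ_lt_succ hlt) (by have := k.2; omega) ⟨k', rfl, e⟩ k rfl hk
      have h3 : (k : ℕ) = 0 := by
        by_contra h3
        exact h2 ⟨0, hn⟩ (Nat.pos_of_ne_zero h3)
      intro k'
      by_cases e : (k' : ℕ) = 0
      · rw [show k' = k from Fin.ext (by omega), hk]; simp [h3]
      · rcases e' : (c k').2 with _ | _
        · simp [e]
        · exact absurd e' (h1.2 _ _ (show (k : ℕ) + 1 < (k' : ℕ) + 1 by omega)
            (by have := k'.2; omega) ⟨k, rfl, hk⟩ k' rfl)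
    · intro hc
      refine ⟨?_, 1, by omega, ⟨0, hn⟩, rfl, by simp [hc]⟩
      rintro (⟨i, j, hij, -, ⟨k, rfl, hk⟩, k', rfl, hk'⟩ |
        ⟨i, j, hij, -, ⟨k, rfl, hk⟩, k', rfl, hk'⟩)
      all_goals
        rw [hc] at hk hk'
        simp only [decide_eq_true_eq, decide_eq_false_iff_not] at hk hk'
        omega
  -- Labellings with misplaced flags contribute `0`; the others are the labellings for `f` with the
  -- forced flag.
  refine Fintype.sum_of_injective
    (fun (c : Fin w.1.length → C) k => (c k, decide ((k : ℕ) = 0)))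
    (fun c c' e => funext fun k => congrArg Prod.fst (congrFun e k)) _ _ ?_ ?_
  · intro c hc
    refine if_neg fun hc' => hc ⟨fun k => (c k).1, funext fun k => Prod.ext rfl ?_⟩
    exact ((hfirst c).1 hc'.1 k).symm
  · intro c
    have e : ∀ i, (ext (fun k => (c k, decide ((k : ℕ) = 0))) i).map Prod.fst = ext c i :=
      fun i => (ext_map _ Prod.fst i).symm
    have hf := (hfirst fun k => (c k, decide ((k : ℕ) = 0))).2 fun k => rfl
    simp only [e]
    by_cases hPw : P w fun i => (σ.marks i, ext c i)
    · rw [if_pos hPw, if_pos ⟨hf, hPw⟩, ← prod_ofFn_first hn]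
      simp
    · rw [if_neg hPw, if_neg fun h => hPw h.2, mul_zero]

/-- A labelling by the disjoint union counts only if all its labels come from one side. The word
being non-empty, they cannot come from both, so no labelling is shared by the two sums. -/
theorem add (h : LabelSeries f T) (h' : LabelSeries g T) :
    LabelSeries (fun w σ => f w σ + g w σ) T := by
  classical
  obtain ⟨C, hC, val, P, hP, hv, h⟩ := h
  obtain ⟨C', hC', val', P', hP', hv', h'⟩ := h'
  have left : Regular fun (w : OPWord M) (c : ℕ → Mark × Option (C ⊕ C')) =>
      (¬∃ i, i ≤ w.1.length + 1 ∧ ∃ b, (c i).2 = some (Sum.inr b)) ∧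
        P w fun i => ((c i).1, (c i).2.bind Sum.getLeft?) :=
    (Regular.exists_pos fun _ γ => ∃ b, γ.2 = some (Sum.inr b)).not.and
      (hP.comap fun γ : Mark × Option (C ⊕ C') => (γ.1, γ.2.bind Sum.getLeft?))
  have right : Regular fun (w : OPWord M) (c : ℕ → Mark × Option (C ⊕ C')) =>
      (¬∃ i, i ≤ w.1.length + 1 ∧ ∃ b, (c i).2 = some (Sum.inl b)) ∧
        P' w fun i => ((c i).1, (c i).2.bind Sum.getRight?) :=
    (Regular.exists_pos fun _ γ => ∃ b, γ.2 = some (Sum.inl b)).not.and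
      (hP'.comap fun γ : Mark × Option (C ⊕ C') => (γ.1, γ.2.bind Sum.getRight?))
  refine ⟨C ⊕ C', inferInstance, Sum.elim val val', _, left.or right, ?_, fun w σ hσ => ?_⟩
  · rintro (c | c)
    · exact hv c
    · exact hv' c
  have hn := length_pos w
  have hl : ∀ c : Fin w.1.length → C ⊕ C',
      (¬∃ i, i ≤ w.1.length + 1 ∧ ∃ b, ext c i = some (Sum.inr b)) ↔
        ∃ d : Fin w.1.length → C, c = fun k => .inl (d k) := by
    intro c
    constructor
    · intro hc
      have : ∀ k, ∃ d, c k = .inl d := by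
        intro k
        rcases e : c k with d | d
        · exact ⟨d, rfl⟩
        · exact absurd ⟨(k : ℕ) + 1, by have := k.2; omega, d, by rw [ext_succ, e]⟩ hc
      choose d hd using this
      exact ⟨d, funext hd⟩
    · rintro ⟨d, rfl⟩ ⟨i, -, b, hb⟩
      obtain ⟨k, -, hk⟩ := ext_eq_some.1 hb
      simp at hk
  have hr : ∀ c : Fin w.1.length → C ⊕ C',
      (¬∃ i, i ≤ w.1.length + 1 ∧ ∃ b, ext c i = some (Sum.inl b)) ↔
        ∃ d : Fin w.1.length → C', c = fun k => .inr (d k) := by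
    intro c
    constructor
    · intro hc
      have : ∀ k, ∃ d, c k = .inr d := by
        intro k
        rcases e : c k with d | d
        · exact absurd ⟨(k : ℕ) + 1, by have := k.2; omega, d, by rw [ext_succ, e]⟩ hc
        · exact ⟨d, rfl⟩
      choose d hd using this
      exact ⟨d, funext hd⟩
    · rintro ⟨d, rfl⟩ ⟨i, -, b, hb⟩
      obtain ⟨k, -, hk⟩ := ext_eq_some.1 hb
      simp at hk
  beta_reduce
  rw [h w σ hσ, h' w σ hσ]
  simp only [labelSum, hl, hr]
  have split : ∀ (p q : Prop) (x : K) [Decidable (p ∨ q)], ¬(p ∧ q) →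
      (if p ∨ q then x else 0) = (if p then x else 0) + if q then x else 0 := by
    intro p q x _ hpq
    by_cases hp : p <;> by_cases hq : q <;> simp_all
  refine Eq.trans ?_ (Finset.sum_congr rfl fun c _ => (split _ _ _ ?_).symm)
  · rw [Finset.sum_add_distrib]
    congr 1
    · refine Fintype.sum_of_injective (fun (d : Fin w.1.length → C) k => .inl (d k))
        (fun c c' e => funext fun k => Sum.inl_injective (congrFun e k)) _ _ ?_ ?_
      · intro c hc
        exact if_neg fun hc' => hc (hc'.1.imp fun d hd => hd.symm)
      · intro d
        have e : ∀ i, (ext (fun k => (Sum.inl (d k) : C ⊕ C')) i).bind Sum.getLeft? = ext d i := by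
          intro i
          rw [ext_map d Sum.inl]
          cases ext d i <;> rfl
        have hd : ∃ d' : Fin w.1.length → C,
            (fun k => (.inl (d k) : C ⊕ C')) = fun k => .inl (d' k) := ⟨d, rfl⟩
        simp [e, hd]
    · refine Fintype.sum_of_injective (fun (d : Fin w.1.length → C') k => .inr (d k))
        (fun c c' e => funext fun k => Sum.inr_injective (congrFun e k)) _ _ ?_ ?_
      · intro c hc
        exact if_neg fun hc' => hc (hc'.1.imp fun d hd => hd.symm)
      · intro d
        have e : ∀ i, (ext (fun k => (Sum.inr (d k) : C ⊕ C')) i).bind Sum.getRight? = ext d i := by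
          intro i
          rw [ext_map d Sum.inr]
          cases ext d i <;> rfl
        have hd : ∃ d' : Fin w.1.length → C',
            (fun k => (.inr (d k) : C ⊕ C')) = fun k => .inr (d' k) := ⟨d, rfl⟩
        simp [e, hd]
  · rintro ⟨⟨⟨d, h1⟩, -⟩, ⟨d', h2⟩, -⟩
    have := congrFun (h1.symm.trans h2) ⟨0, hn⟩
    simp at this

/-- Each factor of `g` moves left past the later factors of `f`. -/
theorem prod_ofFn_mul {n : ℕ} (f g : Fin n → K) (h : ∀ i j, Commute (f i) (g j)) :
    (List.ofFn f).prod * (List.ofFn g).prod = (List.ofFn fun i => f i * g i).prod := by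
  induction n with
  | zero => simp
  | succ n ih =>
    simp only [List.ofFn_succ, List.prod_cons]
    rw [← ih (fun i => f i.succ) (fun i => g i.succ) fun i j => h _ _]
    have : Commute (g 0) (List.ofFn fun i : Fin n => f i.succ).prod := by
      refine Commute.list_prod_right _ _ fun x hx => ?_
      obtain ⟨i, rfl⟩ := List.mem_ofFn.1 hx
      exact (h _ _).symm
    rw [mul_assoc, mul_assoc, ← mul_assoc (g 0), this.eq, mul_assoc]

/-- Centralizers are subsemirings, so commutation passes from `U` to its closure and then from `T`
to its closure. -/
theorem commute_closure (h : ∀ k ∈ T, ∀ l ∈ U, k * l = l * k) {a b : K}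
    (ha : a ∈ Subsemiring.closure T) (hb : b ∈ Subsemiring.closure U) : Commute a b := by
  have h1 : Subsemiring.closure U ≤ Subsemiring.centralizer T :=
    Subsemiring.closure_le.2 fun l hl => Subsemiring.mem_centralizer_iff.2 fun k hk => h k hk l hl
  have h2 : Subsemiring.closure T ≤ Subsemiring.centralizer (Subsemiring.closure U : Set K) :=
    Subsemiring.closure_le.2 fun k hk => Subsemiring.mem_centralizer_iff.2 fun l hl =>
      (Subsemiring.mem_centralizer_iff.1 (h1 hl) k hk).symm
  exact (Subsemiring.mem_centralizer_iff.1 (h2 ha) b hb).symm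

/-- Pairs of labels turn the product of two sums into one sum. Interleaving the two products of
weights needs commutation, which is why `LabelSeries` keeps track of the set generating the weights.
-/
theorem mul (h : LabelSeries f T) (h' : LabelSeries g U) (hc : ∀ k ∈ T, ∀ l ∈ U, k * l = l * k) :
    LabelSeries (fun w σ => f w σ * g w σ) (T ∪ U) := by
  classical
  obtain ⟨C, hC, val, P, hP, hv, h⟩ := h
  obtain ⟨C', hC', val', P', hP', hv', h'⟩ := h'
  refine ⟨C × C', inferInstance, fun x => val x.1 * val' x.2, _,
    (hP.comap fun γ : Mark × Option (C × C') => (γ.1, γ.2.map Prod.fst)).and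
      (hP'.comap fun γ : Mark × Option (C × C') => (γ.1, γ.2.map Prod.snd)),
    fun x => mul_mem (Subsemiring.closure_mono Set.subset_union_left (hv _))
      (Subsemiring.closure_mono Set.subset_union_right (hv' _)), fun w σ hσ => ?_⟩
  beta_reduce
  rw [h w σ hσ, h' w σ hσ, labelSum, labelSum, labelSum, Finset.sum_mul_sum,
    ← Fintype.sum_prod_type']
  refine Fintype.sum_equiv (Equiv.arrowProdEquivProdArrow _ (fun _ => C) (fun _ => C')).symm _ _
    fun x => ?_
  obtain ⟨c, d⟩ := x
  have e1 : ∀ i, (ext (fun k => (c k, d k)) i).map Prod.fst = ext c i :=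
    fun i => (ext_map _ Prod.fst i).symm
  have e2 : ∀ i, (ext (fun k => (c k, d k)) i).map Prod.snd = ext d i :=
    fun i => (ext_map _ Prod.snd i).symm
  simp only [Equiv.arrowProdEquivProdArrow, Equiv.coe_fn_symm_mk, e1, e2, ite_and]
  rw [← prod_ofFn_mul _ _ fun i j => commute_closure hc (hv _) (hv' _)]
  by_cases h1 : P w fun i => (σ.marks i, ext c i) <;>
    by_cases h2 : P' w fun i => (σ.marks i, ext d i) <;> simp [h1, h2]

end LabelSeries

end

end OPL

namespace OPL

universe u v

/-! ### Weighted quantifiers and restricted formulas as label series -/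

section

variable {A : Type u} {M : OPM A} {K : Type v} [Semiring K]

namespace LabelSeries

variable {f g : OPWord M → Assignment → K} {T U : Set K}

/-- Summation over additional boolean labels. -/
theorem sum_labels {C : Type} [Fintype C] {val : C → K}
    {P : OPWord M → (ℕ → Mark × Option (C × Bool)) → Prop} (hP : Regular P)
    (hv : ∀ c, val c ∈ Subsemiring.closure T)
    (h : ∀ w σ, σ.Valid w.1.length → f w σ = ∑ d : Fin w.1.length → Bool,
      ∑ c : Fin w.1.length → C, open Classical in
        if P w (fun i => (σ.marks i, ext (fun k => (c k, d k)) i)) then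
          (List.ofFn fun k => val (c k)).prod else 0) : LabelSeries f T := by
  classical
  refine ⟨C × Bool, inferInstance, fun x => val x.1, P, hP, fun x => hv _, fun w σ hσ => ?_⟩
  rw [h w σ hσ, labelSum, Finset.sum_comm, ← Fintype.sum_prod_type']
  exact Fintype.sum_equiv (Equiv.arrowProdEquivProdArrow _ (fun _ => C) (fun _ => Bool)).symm _ _
    fun x => rfl

/-- The set of positions selected by boolean labels. -/
def positions {n : ℕ} (d : Fin n → Bool) : Finset ℕ :=
  (Finset.univ.filter fun k : Fin n => d k = true).image fun k : Fin n => (k : ℕ) + 1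

theorem mem_positions {n : ℕ} {d : Fin n → Bool} {i : ℕ} :
    i ∈ positions d ↔ ∃ k : Fin n, d k = true ∧ (k : ℕ) + 1 = i := by
  simp [positions]

theorem sum_powerset_Icc {n : ℕ} (f : Finset ℕ → K) :
    ∑ I ∈ (Finset.Icc 1 n).powerset, f I = ∑ d : Fin n → Bool, f (positions d) := by
  symm
  refine Finset.sum_nbij' positions (fun I k => decide ((k : ℕ) + 1 ∈ I)) ?_ ?_ ?_ ?_ ?_
  · intro d _
    rw [Finset.mem_powerset]
    intro i hi
    obtain ⟨k, -, rfl⟩ := mem_positions.1 hi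
    rw [Finset.mem_Icc]
    omega
  · simp
  · intro d _
    funext k
    simp [mem_positions, ← Fin.ext_iff]
  · intro I hI
    ext i
    rw [mem_positions]
    simp only [decide_eq_true_eq]
    refine ⟨fun ⟨k, h, e⟩ => e ▸ h, fun h => ?_⟩
    have := Finset.mem_Icc.1 (Finset.mem_powerset.1 hI h)
    exact ⟨⟨i - 1, by omega⟩, by simpa [Nat.sub_add_cancel this.1] using h,
      by simp [Nat.sub_add_cancel this.1]⟩
  · intro d _; rfl

theorem sum_Icc {n : ℕ} (f : ℕ → K) : ∑ i ∈ Finset.Icc 1 n, f i = ∑ k : Fin n, f ((k : ℕ) + 1) := by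
  rw [Fin.sum_univ_eq_sum_range (fun i => f (i + 1)), Finset.range_eq_Ico,
    Finset.sum_Ico_add' f 0 n 1]
  exact Finset.sum_congr (by ext; simp) fun _ _ => rfl

theorem sumSO (h : LabelSeries f T) (X : ℕ) : LabelSeries (fun w σ =>
    ∑ I ∈ (Finset.Icc 1 w.1.length).powerset, f w (σ.updSO X I)) T := by
  classical
  obtain ⟨C, hC, val, P, hP, hv, h⟩ := h
  refine sum_labels (hP.comap fun γ : Mark × Option (C × Bool) =>
    ((γ.1.1, Function.update γ.1.2 X (∃ a, γ.2 = some (a, true))), γ.2.map Prod.fst)) hv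
    fun w σ hσ => ?_
  rw [sum_powerset_Icc]
  refine Finset.sum_congr rfl fun d _ => ?_
  rw [h w (σ.updSO X _) hσ, labelSum]
  refine Finset.sum_congr rfl fun c _ => ?_
  have e1 : ∀ i, (ext (fun k => (c k, d k)) i).map Prod.fst = ext c i :=
    fun i => (ext_map _ Prod.fst i).symm
  have e2 : ∀ i, (∃ a, ext (fun k => (c k, d k)) i = some (a, true)) = (i ∈ positions d) := by
    intro i
    simp only [ext_eq_some, mem_positions, Prod.mk.injEq, eq_iff_iff]
    exact ⟨fun ⟨a, k, h1, _, h2⟩ => ⟨k, h2, h1⟩, fun ⟨k, h1, h2⟩ => ⟨c k, k, h2, rfl, h1⟩⟩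
  simp only [e1, e2, Assignment.marks_updSO]

/-- A position is a boolean labelling that is true exactly once; the two end markers carry no label
and are thereby excluded. -/
theorem sumFO (h : LabelSeries f T) (x : ℕ) : LabelSeries (fun w σ =>
    ∑ i ∈ Finset.Icc 1 w.1.length, f w (σ.updFO x i)) T := by
  classical
  obtain ⟨C, hC, val, P, hP, hv, h⟩ := h
  refine sum_labels ((Regular.exists_unique_pos fun γ : Mark × Option (C × Bool) =>
    ∃ a, γ.2 = some (a, true)).and (hP.comap fun γ : Mark × Option (C × Bool) =>
    ((Function.update γ.1.1 x (∃ a, γ.2 = some (a, true)), γ.1.2), γ.2.map Prod.fst))) hv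
    fun w σ hσ => ?_
  rw [sum_Icc]
  have e1 : ∀ (c : Fin w.1.length → C) (d : Fin w.1.length → Bool) i,
      (ext (fun k => (c k, d k)) i).map Prod.fst = ext c i :=
    fun c d i => (ext_map _ Prod.fst i).symm
  have e2 : ∀ (c : Fin w.1.length → C) (d : Fin w.1.length → Bool) i,
      (∃ a, ext (fun k => (c k, d k)) i = some (a, true)) ↔
        ∃ k : Fin w.1.length, (k : ℕ) + 1 = i ∧ d k = true := by
    intro c d i
    simp only [ext_eq_some, Prod.mk.injEq]
    exact ⟨fun ⟨a, k, h1, _, h2⟩ => ⟨k, h1, h2⟩, fun ⟨k, h1, h2⟩ => ⟨c k, k, h1, rfl, h2⟩⟩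
  simp only [e1, e2]
  refine Fintype.sum_of_injective (fun (l : Fin w.1.length) k => decide (k = l)) ?_ _ _ ?_ ?_
  · intro l l' e
    simpa using congrFun e l
  · intro d hd
    refine Finset.sum_eq_zero fun c _ => if_neg ?_
    rintro ⟨⟨i, hi, h1⟩, -⟩
    obtain ⟨l, rfl, hl⟩ := (h1 i hi).2 rfl
    refine hd ⟨l, funext fun k => ?_⟩
    have := h1 ((k : ℕ) + 1) (by omega)
    simp only [Nat.add_right_cancel_iff, ← Fin.ext_iff, exists_eq_left] at this
    rcases e : d k with _ | _
    · simpa [e] using this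
    · simpa [e] using this
  · intro l
    rw [h w _ (hσ.updFO x (by omega)), labelSum]
    refine Finset.sum_congr rfl fun c _ => ?_
    have h1 : ∃ i ≤ w.1.length + 1, ∀ j ≤ w.1.length + 1,
        (∃ k : Fin w.1.length, (k : ℕ) + 1 = j ∧ decide (k = l) = true) ↔ j = i :=
      ⟨(l : ℕ) + 1, by omega, fun j _ => by simp [eq_comm]⟩
    have h2 : ∀ j, (∃ k : Fin w.1.length, (k : ℕ) + 1 = j ∧ decide (k = l) = true) =
        (j = (l : ℕ) + 1) := fun j => by simp [eq_comm]
    simp only [h1, true_and]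
    simp only [h2, Assignment.marks_updFO]

/-- A series with finitely many values, each of them taken on a regular set. -/
def Steps (f : OPWord M → Assignment → K) (T : Set K) : Prop :=
  ∃ (C : Type) (_ : Fintype C) (val : C → K) (P : C → OPWord M → (ℕ → Mark) → Prop),
    (∀ c, Regular (P c)) ∧ (∀ c, val c ∈ Subsemiring.closure T) ∧
      ∀ w σ, σ.Valid w.1.length →
        ∃ c, (∀ c', P c' w σ.marks ↔ c' = c) ∧ f w σ = val c

/-- Pairs of values index the common refinement of the two partitions; `o` covers addition and
multiplication alike. -/
theorem Steps.op (h : Steps f T) (h' : Steps g U) {o : K → K → K}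
    (ho : ∀ x ∈ Subsemiring.closure (T ∪ U), ∀ y ∈ Subsemiring.closure (T ∪ U),
      o x y ∈ Subsemiring.closure (T ∪ U)) :
    Steps (fun w σ => o (f w σ) (g w σ)) (T ∪ U) := by
  obtain ⟨C, hC, val, P, hP, hv, h⟩ := h
  obtain ⟨C', hC', val', P', hP', hv', h'⟩ := h'
  refine ⟨C × C', inferInstance, fun x => o (val x.1) (val' x.2),
    fun x w c => P x.1 w c ∧ P' x.2 w c, fun x => (hP _).and (hP' _),
    fun x => ho _ (Subsemiring.closure_mono Set.subset_union_left (hv _)) _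
      (Subsemiring.closure_mono Set.subset_union_right (hv' _)), fun w σ hσ => ?_⟩
  obtain ⟨c, hc, e⟩ := h w σ hσ
  obtain ⟨c', hc', e'⟩ := h' w σ hσ
  refine ⟨(c, c'), fun x => ?_, by simp only [e, e']⟩
  beta_reduce
  rw [hc, hc', Prod.ext_iff]

theorem steps_of_almostBoolean {φ : WFormula A K} (h : φ.AlmostBoolean) :
    Steps (fun (w : OPWord M) σ => φ.sem M w.1 σ) φ.consts := by
  classical
  induction h with
  | bool β =>
    obtain ⟨P, hP, h⟩ := β.regular (M := M)
    refine ⟨Bool, inferInstance, fun b => if b then 1 else 0,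
      fun b w c => if b then P w c else ¬ P w c, ?_, ?_, fun w σ hσ => ?_⟩
    · rintro (_ | _)
      · simpa using hP.not
      · simpa using hP
    · rintro (_ | _)
      · simp
      · simp
    · by_cases hw : P w σ.marks
      · refine ⟨true, ?_, by simp [WFormula.sem, h w σ hσ, hw]⟩
        rintro (_ | _) <;> simp [hw]
      · refine ⟨false, ?_, by simp [WFormula.sem, h w σ hσ, hw]⟩
        rintro (_ | _) <;> simp [hw]
  | const k =>
    exact ⟨Unit, inferInstance, fun _ => k, fun _ _ _ => True, fun _ => Regular.const True,
      fun _ => Subsemiring.subset_closure rfl, fun w σ hσ => ⟨(), by simp, rfl⟩⟩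
  | add _ _ h1 h2 => exact h1.op h2 fun x hx y hy => add_mem hx hy
  | mul _ _ h1 h2 => exact h1.op h2 fun x hx y hy => mul_mem hx hy

theorem map_range'_eq_ofFn {B : Type*} (n : ℕ) (f : ℕ → B) :
    (List.range' 1 n).map f = List.ofFn fun k : Fin n => f ((k : ℕ) + 1) := by
  refine List.ext_getElem (by simp) fun i h1 h2 => ?_
  simp [Nat.add_comm]

/-- Each position is labelled with the index of the value that `f` takes when `x` is placed there.
Only one labelling is correct and its weight is the product. Correctness is regular: it says that no
label `a` sits at a position where `P a` fails. -/
theorem Steps.prodFO (h : Steps f T) (x : ℕ) : LabelSeries (fun w σ =>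
    ((List.range' 1 w.1.length).map fun i => f w (σ.updFO x i)).prod) T := by
  classical
  obtain ⟨C, hC, val, P, hP, hv, h⟩ := h
  have h1 : ∀ a, Regular fun (w : OPWord M) (c : ℕ → Mark × Option C) => ∃ j ≤ w.1.length + 1,
      (¬ P a w fun i => (Function.update (c i).1.1 x (i = j), (c i).1.2)) ∧
        ∃ i, i ≤ w.1.length + 1 ∧ (c i).2 = some a ∧ i = j := fun a =>
    ((hP a).not.comap (Prod.fst : Mark × Option C → Mark)).exFO x
      (Regular.exists_pos fun _ (γ : Option C × Prop) => γ.1 = some a ∧ γ.2)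
  refine ⟨C, hC, val, _, (Regular.exists_finite h1).not, hv, fun w σ hσ => ?_⟩
  have key : ∀ k : Fin w.1.length, ∃ c, (∀ c', (P c' w fun i =>
      (Function.update (σ.marks i).1 x (i = (k : ℕ) + 1), (σ.marks i).2)) ↔ c' = c) ∧
      f w (σ.updFO x ((k : ℕ) + 1)) = val c := by
    intro k
    obtain ⟨c, hc, e⟩ := h w _ (hσ.updFO x (show (k : ℕ) + 1 ≤ _ by omega))
    refine ⟨c, fun c' => ?_, e⟩
    rw [← hc, funext (σ.marks_updFO x _)]
  choose t ht hval using key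
  have hP' : ∀ c : Fin w.1.length → C, (¬∃ a, ∃ j ≤ w.1.length + 1,
      (¬ P a w fun i => (Function.update (σ.marks i).1 x (i = j), (σ.marks i).2)) ∧
        ∃ i, i ≤ w.1.length + 1 ∧ ext c i = some a ∧ i = j) ↔ c = t := by
    intro c
    constructor
    · intro hc
      push Not at hc
      funext k
      refine (ht k _).1 (by_contra fun hn => ?_)
      exact hc (c k) ((k : ℕ) + 1) (by omega) hn _ (by omega) (ext_succ c k) rfl
    · rintro rfl ⟨a, j, hj, hn, i, hi, he, rfl⟩
      obtain ⟨k, rfl, rfl⟩ := ext_eq_some.1 he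
      exact hn ((ht k _).2 rfl)
  beta_reduce
  rw [labelSum, map_range'_eq_ofFn]
  simp only [hP', hval]
  rw [Finset.sum_ite_eq' Finset.univ t]
  simp

/-- Induction on the left factor for all right factors: sums distribute and products reassociate,
until only `bool_mul` and `const_mul` remain. No commutation enters, which explains the first
alternative in the restriction on `⊗`. -/
theorem almostBoolean_mul {φ : WFormula A K} (hφ : φ.AlmostBoolean) (h : LabelSeries f T) :
    LabelSeries (fun w σ => φ.sem M w.1 σ * f w σ) (φ.consts ∪ T) := by
  induction hφ generalizing f T with
  | bool β => exact (h.bool_mul β).mono Set.subset_union_right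
  | const k => exact (h.mono Set.subset_union_right).const_mul (Or.inl rfl)
  | add _ _ h1 h2 =>
    refine ((h1 h).mono ?_ |>.add ((h2 h).mono ?_)).congr fun w σ _ => add_mul _ _ _
    · exact Set.union_subset_union_left _ Set.subset_union_left
    · exact Set.union_subset_union_left _ Set.subset_union_right
  | mul _ _ h1 h2 =>
    refine ((h1 (h2 h)).mono ?_).congr fun w σ _ => mul_assoc _ _ _
    rw [← Set.union_assoc]; rfl

theorem of_almostBoolean {φ : WFormula A K} (hφ : φ.AlmostBoolean) :
    LabelSeries (fun (w : OPWord M) σ => φ.sem M w.1 σ) φ.consts :=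
  ((almostBoolean_mul hφ (one (T := ∅))).mono (by simp)).congr fun w σ _ => (mul_one _).symm

/-- The two alternatives for `⊗` are handled by `almostBoolean_mul` and `mul`, and the restriction
on weighted products makes `Steps.prodFO` applicable. -/
theorem of_restricted {φ : WFormula A K} (hφ : φ.Restricted) :
    LabelSeries (fun (w : OPWord M) σ => φ.sem M w.1 σ) φ.consts := by
  induction φ with
  | bool β => exact of_almostBoolean (.bool β)
  | const k => exact of_almostBoolean (.const k)
  | add φ ψ h1 h2 =>
    refine ((h1 ⟨fun a b h => hφ.1 a b (.inl (.inr h)), fun a b h => hφ.2 a b (.inl (.inr h))⟩).mono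
      Set.subset_union_left).add ((h2 ⟨fun a b h => hφ.1 a b (.inr h),
        fun a b h => hφ.2 a b (.inr h)⟩).mono Set.subset_union_right)
  | mul φ ψ h1 h2 =>
    have h2 := h2 ⟨fun a b h => hφ.1 a b (.inr h), fun a b h => hφ.2 a b (.inr h)⟩
    rcases hφ.1 φ ψ (.inl (.inl rfl)) with h | h
    · exact almostBoolean_mul h h2
    · exact (h1 ⟨fun a b h => hφ.1 a b (.inl (.inr h)),
        fun a b h => hφ.2 a b (.inl (.inr h))⟩).mul h2 h
  | sumFO x φ h =>
    exact (h ⟨fun a b h => hφ.1 a b (.inr h), fun a b h => hφ.2 a b (.inr h)⟩).sumFO x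
  | sumSO X φ h =>
    exact (h ⟨fun a b h => hφ.1 a b (.inr h), fun a b h => hφ.2 a b (.inr h)⟩).sumSO X
  | prodFO x φ h => exact (steps_of_almostBoolean (hφ.2 x φ (.inl rfl))).prodFO x

end LabelSeries

end

end OPL

namespace OPL

universe u v

/-! ### Runs as sequences of states along the parse -/

namespace WOPA

variable {A : Type u} {K : Type v} {Q : Type} [Semiring K] (M : OPM A) (𝒜 : WOPA A K Q)
  (w : List A)

open Classical in
/-- The weight of a push transition, `0` for triples that are not transitions. -/
noncomputable def pushWt (x : Q × A × Q) : K := if h : x ∈ 𝒜.push then 𝒜.wtPush ⟨x, h⟩ else 0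

open Classical in
/-- The weight of a shift transition, `0` for triples that are not transitions. -/
noncomputable def shiftWt (x : Q × A × Q) : K := if h : x ∈ 𝒜.shift then 𝒜.wtShift ⟨x, h⟩ else 0

open Classical in
/-- The weight of a pop transition, `0` for triples that are not transitions. -/
noncomputable def popWt (x : Q × Q × Q) : K := if h : x ∈ 𝒜.pop then 𝒜.wtPop ⟨x, h⟩ else 0

/-- A sequence of states makes a transition at time `t`. -/
def Trans (q : ℕ → Q) (t : ℕ) : Prop :=
  match opAt M w t with
  | .push a => (q t, a, q (t + 1)) ∈ 𝒜.push
  | .shift a => (q t, a, q (t + 1)) ∈ 𝒜.shift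
  | .pop => (q t, q (parse M w t).born, q (t + 1)) ∈ 𝒜.pop
  | .halt => False

/-- The weight of the transition at time `t`. -/
noncomputable def transWt (q : ℕ → Q) (t : ℕ) : K :=
  match opAt M w t with
  | .push a => 𝒜.pushWt (q t, a, q (t + 1))
  | .shift a => 𝒜.shiftWt (q t, a, q (t + 1))
  | .pop => 𝒜.popWt (q t, q (parse M w t).born, q (t + 1))
  | .halt => 1

/-- The product of the weights of the transitions before time `t`. -/
noncomputable def seqWt (q : ℕ → Q) : ℕ → K
  | 0 => 1
  | t + 1 => seqWt q t * 𝒜.transWt M w q t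

/-- The configuration at time `t` of a sequence of states. -/
noncomputable def conf (q : ℕ → Q) (t : ℕ) : Config A K Q :=
  ⟨(parse M w t).stack.map fun x => (x.1, q x.2.2), q t, w.drop (lookAt M w t - 1),
    𝒜.seqWt M w q t⟩

variable {M 𝒜 w}

theorem pushWt_of_mem {x : Q × A × Q} (h : x ∈ 𝒜.push) : 𝒜.pushWt x = 𝒜.wtPush ⟨x, h⟩ := dif_pos h

theorem shiftWt_of_mem {x : Q × A × Q} (h : x ∈ 𝒜.shift) :
    𝒜.shiftWt x = 𝒜.wtShift ⟨x, h⟩ := dif_pos h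

theorem popWt_of_mem {x : Q × Q × Q} (h : x ∈ 𝒜.pop) : 𝒜.popWt x = 𝒜.wtPop ⟨x, h⟩ := dif_pos h

theorem born_le (t : ℕ) : (parse M w t).born ≤ t := by
  have wf := parse_wf M w t
  generalize parse M w t = p at *
  obtain ⟨s, j⟩ := p
  cases s with
  | nil => exact Nat.zero_le _
  | cons x s => exact (wf.time x (by simp)).le

theorem transWt_congr {q q' : ℕ → Q} {t : ℕ} (h : ∀ s ≤ t + 1, q s = q' s) :
    𝒜.transWt M w q t = 𝒜.transWt M w q' t := by
  have := born_le (M := M) (w := w) t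
  unfold transWt
  rw [h t (by omega), h (t + 1) le_rfl, h _ (show (parse M w t).born ≤ t + 1 by omega)]

omit [Semiring K] in
theorem trans_congr {q q' : ℕ → Q} {t : ℕ} (h : ∀ s ≤ t + 1, q s = q' s) :
    𝒜.Trans M w q t ↔ 𝒜.Trans M w q' t := by
  have := born_le (M := M) (w := w) t
  unfold Trans
  rw [h t (by omega), h (t + 1) le_rfl, h _ (show (parse M w t).born ≤ t + 1 by omega)]

theorem seqWt_congr {q q' : ℕ → Q} {t : ℕ} (h : ∀ s ≤ t, q s = q' s) :
    𝒜.seqWt M w q t = 𝒜.seqWt M w q' t := by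
  induction t with
  | zero => rfl
  | succ t ih => rw [seqWt, seqWt, ih fun s hs => h s (by omega), transWt_congr h]

theorem conf_congr {q q' : ℕ → Q} {t : ℕ} (h : ∀ s ≤ t, q s = q' s) :
    𝒜.conf M w q t = 𝒜.conf M w q' t := by
  unfold conf
  rw [seqWt_congr h, h t le_rfl]
  congr 1
  refine List.map_congr_left fun x hx => ?_
  rw [h _ ((parse_wf M w t).time x hx).le]

theorem drop_of_letterAt {j : ℕ} {a : A} (h : letterAt w j = some a) :
    w.drop (j - 1) = a :: w.drop j := by
  obtain ⟨i, rfl⟩ : ∃ i, j = i + 1 := ⟨j - 1, by have := letterAt_eq_some h; omega⟩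
  simp only [letterAt] at h
  obtain ⟨hi, rfl⟩ := List.getElem?_eq_some_iff.1 h
  exact List.drop_eq_getElem_cons hi

theorem head?_drop_look {j : ℕ} (h : 1 ≤ j) : (w.drop (j - 1)).head? = letterAt w j := by
  obtain ⟨i, rfl⟩ : ∃ i, j = i + 1 := ⟨j - 1, by omega⟩
  rw [List.head?_drop]; rfl

theorem topSymbol_map (s : List (A × ℕ × ℕ)) (j : ℕ) (q : ℕ → Q) :
    topSymbol (s.map fun x => (x.1, q x.2.2)) = Parse.sym ⟨s, j⟩ := by
  cases s <;> rfl

theorem step_conf {q : ℕ → Q} {t : ℕ} (h : 𝒜.Trans M w q t) :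
    Step M 𝒜 (𝒜.conf M w q t) (𝒜.conf M w q (t + 1)) := by
  have hm := parse_move M w t
  have h1 := one_le_lookAt (M := M) w t
  unfold conf
  rw [seqWt]
  unfold Trans at h
  unfold transWt
  unfold lookAt at *
  generalize 𝒜.seqWt M w q t = k, parse M w t = p, parse M w (t + 1) = p',
    opAt M w t = o at *
  cases hm with
  | push s j a ha hr =>
    simp only [Nat.add_sub_cancel, drop_of_letterAt ha, pushWt_of_mem h]
    exact .push _ _ _ _ _ _ (by rw [topSymbol_map s j]; exact hr) h
  | shift b v r s j a ha hr =>
    simp only [Nat.add_sub_cancel, drop_of_letterAt ha, shiftWt_of_mem h]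
    exact .shift _ _ _ _ _ _ _ _ hr h
  | pop b v r s j hr =>
    simp only [popWt_of_mem h]
    exact .pop _ _ _ _ _ _ _ (by rw [head?_drop_look h1]; exact hr) h
  | halt p hp => exact h.elim

/-- The precedence relation at the top fixes the kind of move, so only the new state `r` is free.
Changing `q` at `t + 1` leaves the configuration at time `t` intact. -/
theorem conf_of_step {q : ℕ → Q} {t : ℕ} {d : Config A K Q} (h : Step M 𝒜 (𝒜.conf M w q t) d) :
    ∃ r, 𝒜.Trans M w (Function.update q (t + 1) r) t ∧
      d = 𝒜.conf M w (Function.update q (t + 1) r) (t + 1) := by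
  have h1 := one_le_lookAt (M := M) w t
  have hq : ∀ r, ∀ s ≤ t, Function.update q (t + 1) r s = q s := fun r s hs =>
    Function.update_of_ne (by omega) _ _
  have hmap : ∀ r, (parse M w t).stack.map (fun x => (x.1, Function.update q (t + 1) r x.2.2)) =
      (parse M w t).stack.map fun x => (x.1, q x.2.2) := fun r =>
    List.map_congr_left fun x hx => by rw [hq r _ ((parse_wf M w t).time x hx).le]
  have hhead := head?_drop_look (w := w) h1
  have hparse : parse M w (t + 1) = (parse M w t).apply t (opAt M w t) := rfl
  generalize hc : 𝒜.conf M w q t = c at h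
  have hb := born_le (M := M) (w := w) t
  cases h with
  | push stack p r b x k prec mem =>
    simp only [conf, Config.mk.injEq] at hc
    obtain ⟨rfl, rfl, hx, rfl⟩ := hc
    rw [hx] at hhead
    have ho : opAt M w t = .push b :=
      Parse.op_push (by rw [← topSymbol_map]; exact prec) hhead.symm
    have hx' := drop_of_letterAt hhead.symm
    rw [hx] at hx'
    refine ⟨r, by simpa [Trans, ho, hq] using mem, ?_⟩
    simp only [conf, seqWt, transWt, ho, lookAt, hparse, Parse.apply, List.map_cons, hmap,
      hq _ t le_rfl,
      seqWt_congr (hq r), Function.update_self, pushWt_of_mem mem, Nat.add_sub_cancel]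
    rw [List.tail_eq_of_cons_eq hx']; rfl
  | shift stack a p p' r b x k prec mem =>
    simp only [conf, Config.mk.injEq] at hc
    obtain ⟨hs, rfl, hx, rfl⟩ := hc
    rw [hx] at hhead
    have hsym : (parse M w t).sym = some a := by
      rw [← topSymbol_map (q := q), hs]; rfl
    have hne : (parse M w t).stack ≠ [] := by
      intro e; rw [e] at hs; simp at hs
    have ho : opAt M w t = .shift b := Parse.op_shift (by rw [hsym]; exact prec) hhead.symm hne
    have hx' := drop_of_letterAt hhead.symm
    rw [hx] at hx'
    refine ⟨r, by simpa [Trans, ho, hq] using mem, ?_⟩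
    have hp : q (parse M w t).born = p ∧
        (parse M w t).stack.tail.map (fun x => (x.1, q x.2.2)) = stack := by
      unfold Parse.born
      rcases e : (parse M w t).stack with _ | ⟨y, s⟩
      · exact absurd e hne
      · rw [e] at hs
        simp only [List.map_cons, List.cons.injEq, Prod.mk.injEq] at hs
        exact ⟨hs.1.2, hs.2⟩
    have hmap' : ∀ r, (parse M w t).stack.tail.map
        (fun x => (x.1, Function.update q (t + 1) r x.2.2)) =
        (parse M w t).stack.tail.map fun x => (x.1, q x.2.2) := fun r => by
      rw [List.map_tail, hmap, List.map_tail]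
    simp only [conf, seqWt, transWt, ho, lookAt, hparse, Parse.apply, List.map_cons, hmap',
      hq _ t le_rfl,
      seqWt_congr (hq r), Function.update_self, shiftWt_of_mem mem, Nat.add_sub_cancel,
      hq _ _ hb, hp]
    rw [List.tail_eq_of_cons_eq hx']; rfl
  | pop stack a p p' r y k prec mem =>
    simp only [conf, Config.mk.injEq] at hc
    obtain ⟨hs, rfl, hx, rfl⟩ := hc
    rw [hx] at hhead
    have hsym : (parse M w t).sym = some a := by
      rw [← topSymbol_map (q := q), hs]; rfl
    have hne : (parse M w t).stack ≠ [] := by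
      intro e; rw [e] at hs; simp at hs
    have ho : opAt M w t = .pop :=
      Parse.op_pop (by
        rw [hsym]; change M.rel _ (letterAt w (lookAt M w t)) = _; rw [← hhead]; exact prec) hne
    have hp : q (parse M w t).born = p ∧
        (parse M w t).stack.tail.map (fun x => (x.1, q x.2.2)) = stack := by
      unfold Parse.born
      rcases e : (parse M w t).stack with _ | ⟨y, s⟩
      · exact absurd e hne
      · rw [e] at hs
        simp only [List.map_cons, List.cons.injEq, Prod.mk.injEq] at hs
        exact ⟨hs.1.2, hs.2⟩
    have hmap' : ∀ r, (parse M w t).stack.tail.map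
        (fun x => (x.1, Function.update q (t + 1) r x.2.2)) =
        (parse M w t).stack.tail.map fun x => (x.1, q x.2.2) := fun r => by
      rw [List.map_tail, hmap, List.map_tail]
    refine ⟨r, by simpa [Trans, ho, hq, hq _ _ hb, hp.1] using mem, ?_⟩
    simp only [conf, seqWt, transWt, ho, lookAt, hparse, Parse.apply, hmap', hq _ t le_rfl,
      seqWt_congr (hq r), Function.update_self, popWt_of_mem mem, hq _ _ hb, hp]
    rw [← hx]; rfl

/-- A sequence of states that describes an accepting run on a compatible word. -/
structure IsRun (𝒜 : WOPA A K Q) (w : OPWord M) (q : ℕ → Q) : Prop where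
  init : q 0 ∈ 𝒜.init
  final : q (dur w) ∈ 𝒜.final
  trans : ∀ t < dur w, 𝒜.Trans M w.1 q t

/-- Induction from the end: the last configuration is removed and its state is appended to the
sequence by `conf_of_step`. -/
theorem exists_seq_of_isChain {q₀ : Q} (n : ℕ) :
    ∀ ρ : List (Config A K Q), ρ.length = n + 1 → ρ.IsChain (Step M 𝒜) →
      ρ.head? = some ⟨[], q₀, w, 1⟩ →
      ∃ q : ℕ → Q, q 0 = q₀ ∧ (∀ t < n, 𝒜.Trans M w q t) ∧
        ρ = (List.range (n + 1)).map (𝒜.conf M w q) := by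
  induction n with
  | zero =>
    intro ρ hl _ hh
    obtain ⟨c, rfl⟩ := List.length_eq_one_iff.1 hl
    simp only [List.head?_cons, Option.some.injEq] at hh
    subst hh
    exact ⟨fun _ => q₀, rfl, by simp, rfl⟩
  | succ n ih =>
    intro ρ hl hc hh
    rcases List.eq_nil_or_concat ρ with rfl | ⟨ρ', d, rfl⟩
    · simp at hl
    rw [List.concat_eq_append] at *
    rw [List.isChain_append] at hc
    have hl' : ρ'.length = n + 1 := by simpa using hl
    obtain ⟨q, h0, ht, hρ⟩ := ih ρ' hl' hc.1 (by
      rwa [List.head?_append_of_ne_nil] at hh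
      intro e; simp [e] at hl')
    have hlast : ρ'.getLast? = some (𝒜.conf M w q n) := by
      rw [hρ, List.range_succ]; simp
    obtain ⟨r, h1, rfl⟩ := conf_of_step (hc.2.2 _ hlast d rfl)
    have hq : ∀ s ≤ n, Function.update q (n + 1) r s = q s := fun s hs =>
      Function.update_of_ne (by omega) _ _
    refine ⟨Function.update q (n + 1) r, (hq 0 (by omega)).trans h0, fun t h => ?_, ?_⟩
    · rcases (Nat.lt_succ_iff.1 h).lt_or_eq with h | rfl
      · exact (trans_congr fun s hs => hq s (by omega)).2 (ht t h)
      · exact h1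
    · rw [List.range_succ (n := n + 1), List.map_append, hρ]
      congr 1
      refine List.map_congr_left fun t h => (conf_congr fun s hs => hq s ?_).symm
      rw [List.mem_range] at h
      omega

/-- No move is possible at time `dur w`, where the parser halts, and acceptance forces the final
parser configuration. Hence all accepting runs have the same length. -/
theorem mem_acc_iff {w : OPWord M} {ρ : List (Config A K Q)} :
    ρ ∈ acc M 𝒜 w.1 ↔
      ∃ q, IsRun 𝒜 w q ∧ ρ = (List.range (dur w + 1)).map (𝒜.conf M w.1 q) := by
  constructor
  · rintro ⟨hc, ⟨q₀, hq₀, hh⟩, q₁, hq₁, k, hl⟩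
    have hlen : ρ.length = ρ.length - 1 + 1 := by
      cases ρ with
      | nil => simp at hh
      | cons => simp
    obtain ⟨q, h0, ht, hρ⟩ := exists_seq_of_isChain _ ρ hlen hc hh
    generalize ρ.length - 1 = n at *
    rw [hρ, List.range_succ] at hl
    simp only [List.map_append, List.map_cons, List.map_nil, List.getLast?_append, conf,
      List.getLast?_singleton, Option.some_or, Option.some.injEq, Config.mk.injEq,
      List.map_eq_nil_iff, List.drop_eq_nil_iff] at hl
    obtain ⟨hs, hq, hd, -⟩ := hl
    have hle : n ≤ dur w := by
      by_contra hn
      have := ht (dur w) (by omega)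
      rw [Trans, opAt_dur] at this
      exact this
    have hn : n = dur w := by
      refine eq_dur_of_parse w hle ?_
      have := lookAt_le (M := M) w.1 n
      have := one_le_lookAt (M := M) w.1 n
      have e : lookAt M w.1 n = w.1.length + 1 := by omega
      rw [← e, ← hs]; rfl
    subst hn
    exact ⟨q, ⟨by rwa [h0], by rwa [hq], ht⟩, hρ⟩
  · rintro ⟨q, hq, rfl⟩
    refine ⟨?_, ⟨q 0, hq.init, ?_⟩, q (dur w), hq.final, 𝒜.seqWt M w.1 q (dur w), ?_⟩
    · rw [List.isChain_iff_getElem]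
      intro i hi
      simp only [List.getElem_map, List.getElem_range]
      simp only [List.length_map, List.length_range] at hi
      exact step_conf (hq.trans i (by omega))
    · rw [List.range_succ_eq_map]; rfl
    · rw [List.range_succ]
      simp [conf, parse_dur, lookAt]

/-- The behavior as a sum over a type that parametrizes the accepting runs. -/
theorem behavior_eq_sum [Finite A] [Finite Q] (w : OPWord M) {L : Type*} [Fintype L]
    (β : L → Prop) (q : L → ℕ → Q) (hrun : ∀ c, β c → IsRun 𝒜 w (q c))
    (hinj : ∀ c c', β c → β c' → (∀ t ≤ dur w, q c t = q c' t) → c = c')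
    (hsurj : ∀ q', IsRun 𝒜 w q' → ∃ c, β c ∧ ∀ t ≤ dur w, q c t = q' t) :
    𝒜.behavior M w = ∑ c, open Classical in if β c then 𝒜.seqWt M w.1 (q c) (dur w) else 0 := by
  classical
  rw [behavior, ← Finset.sum_filter]
  symm
  refine Finset.sum_bij (fun c _ => (List.range (dur w + 1)).map (𝒜.conf M w.1 (q c))) ?_ ?_ ?_ ?_
  · intro c hc
    rw [Set.Finite.mem_toFinset]
    exact mem_acc_iff.2 ⟨q c, hrun c (Finset.mem_filter.1 hc).2, rfl⟩
  · intro c hc c' hc' e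
    refine hinj c c' (Finset.mem_filter.1 hc).2 (Finset.mem_filter.1 hc').2 fun t ht => ?_
    exact congrArg Config.state (List.map_inj_left.1 e t (List.mem_range.2 (by omega)))
  · intro ρ hρ
    obtain ⟨q', hq', rfl⟩ := mem_acc_iff.1 ((Set.Finite.mem_toFinset _).1 hρ)
    obtain ⟨c, hc, h⟩ := hsurj q' hq'
    refine ⟨c, Finset.mem_filter.2 ⟨Finset.mem_univ c, hc⟩, List.map_congr_left fun t ht => ?_⟩
    rw [List.mem_range] at ht
    exact conf_congr fun s hs => h s (by omega)
  · intro c _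
    rw [runWeight, List.range_succ]
    simp [conf]

end WOPA

end OPL

namespace OPL

universe u v

/-! ## Label series are behaviors of restricted automata -/

namespace Recognizer

variable {A : Type u} {M : OPM A} {Γ : Type*} {D : Type} (𝒟 : Recognizer A Γ D)

/-- A cell stores the state at the time it was pushed, and shifts leave it alone. So the sequence of
current states determines the stack, just as in `conf`. -/
theorem cfg_stack (w : List A) (c : ℕ → Γ) (t : ℕ) :
    (𝒟.cfg M w c t).1 = (parse M w t).stack.map fun x => (𝒟.cfg M w c x.2.2).2 := by
  induction t with
  | zero => rfl
  | succ t ih =>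
    have hm := parse_move M w t
    generalize hX : 𝒟.cfg M w c (t + 1) = X
    rw [cfg] at hX
    subst hX
    generalize hX : 𝒟.cfg M w c t = X at *
    generalize parse M w t = p, parse M w (t + 1) = p', opAt M w t = o at *
    obtain ⟨S, q⟩ := X
    simp only at ih
    subst ih
    cases hm with
    | push s j a ha h => simp [act, hX]
    | shift b v r s j a ha h => rfl
    | pop b v r s j h => rfl
    | halt p h => rfl

theorem cfg_succ (w : List A) (c : ℕ → Γ) (t : ℕ) :
    (𝒟.cfg M w c (t + 1)).2 = match opAt M w t with
      | .push a => 𝒟.read false (𝒟.cfg M w c t).2 a (c (lookAt M w t))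
      | .shift a => 𝒟.read true (𝒟.cfg M w c t).2 a (c (lookAt M w t))
      | .pop => 𝒟.pop (𝒟.cfg M w c t).2 (𝒟.cfg M w c (parse M w t).born).2
      | .halt => (𝒟.cfg M w c t).2 := by
  have hs := 𝒟.cfg_stack (M := M) w c t
  have hm := parse_move M w t
  rw [cfg]
  generalize hX : 𝒟.cfg M w c t = X at *
  generalize parse M w t = p, parse M w (t + 1) = p', opAt M w t = o at *
  obtain ⟨S, q⟩ := X
  simp only at hs
  subst hs
  cases hm <;> rfl

end Recognizer

theorem prod_range'_succ {K : Type*} [Monoid K] (f : ℕ → K) (m : ℕ) :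
    ((List.range' 1 (m + 1)).map f).prod = ((List.range' 1 m).map f).prod * f (m + 1) := by
  rw [List.range'_concat]
  simp [Nat.add_comm]

namespace WOPA

variable {A : Type u} {M : OPM A} {K : Type v} [Semiring K] {C D : Type}

/-- The automaton that guesses the labels of the positions and runs a recognizer on them. The
labels of all positions but `0` carry the mark `μ`. -/
def ofRecognizer (𝒟 : Recognizer A (Mark × Option C) D) (val : C → K) (μ₀ μ : Mark) :
    WOPA A K (D × Option C) where
  init := {(𝒟.init (μ₀, none), none)}
  final := {x | 𝒟.final x.1 (μ, none)}
  push := {x | ∃ c, x.2.2 = (𝒟.read false x.1.1 x.2.1 (μ, some c), some c)}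
  shift := {x | ∃ c, x.2.2 = (𝒟.read true x.1.1 x.2.1 (μ, some c), some c)}
  pop := {x | x.2.2 = (𝒟.pop x.1.1 x.2.1.1, x.1.2)}
  wtPush x := x.1.2.2.2.elim 1 val
  wtShift x := x.1.2.2.2.elim 1 val
  wtPop _ := 1

/-- The state keeps the last guessed label, so a run reveals its labelling; conversely, the
recognizer is deterministic and the labelling determines the run. Weights are charged when positions
are read, hence from left to right. -/
theorem ofRecognizer_behavior [Finite A] [Fintype C] [Finite D]
    (𝒟 : Recognizer A (Mark × Option C) D) (val : C → K) (μ₀ μ : Mark) (w : OPWord M) :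
    (ofRecognizer 𝒟 val μ₀ μ).behavior M w = ∑ c : Fin w.1.length → C, open Classical in
      if 𝒟.Accepts w (fun i => (if i = 0 then μ₀ else μ, ext c i)) then
        (List.ofFn fun k => val (c k)).prod else 0 := by
  classical
  set 𝒜 : WOPA A K (D × Option C) := ofRecognizer 𝒟 val μ₀ μ with h𝒜
  let lab : (Fin w.1.length → C) → ℕ → Mark × Option C :=
    fun c i => (if i = 0 then μ₀ else μ, ext c i)
  -- The position read last is one below the lookahead; before the first read this is position `0`,
  -- whose label is `none`.
  let q : (Fin w.1.length → C) → ℕ → D × Option C := fun c t =>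
    ((𝒟.cfg M w.1 (lab c) t).2, ext c (lookAt M w.1 t - 1))
  have hlab : ∀ c t, lab c (lookAt M w.1 t) = (μ, ext c (lookAt M w.1 t)) := by
    intro c t
    have := one_le_lookAt (M := M) w.1 t
    simp only [lab]
    rw [if_neg (by omega)]
  have hext : ∀ c : Fin w.1.length → C, ∀ j, 1 ≤ j → j ≤ w.1.length → ∃ a, ext c j = some a :=
    fun c j h h' => ⟨c ⟨j - 1, by omega⟩, ext_eq_some.2 ⟨_, by simp; omega, rfl⟩⟩
  have hend : ∀ c : Fin w.1.length → C, ext c (w.1.length + 1) = none := fun c => by simp [ext]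
  have htrans : ∀ c, ∀ t < dur w, 𝒜.Trans M w.1 (q c) t := by
    intro c t ht
    have h1 := one_le_lookAt (M := M) w.1 t
    rcases read_or_pop w ht with ⟨⟨h2, h3⟩, h4, h5⟩ | ⟨⟨h2, h3⟩, h4⟩
    · obtain ⟨a, ha⟩ := hext c _ h1 h4
      rcases h5 with ⟨b, hb⟩ | ⟨b, hb⟩
      · simp only [Trans, hb, q, h𝒜, ofRecognizer, Set.mem_ofPred_eq, Recognizer.cfg_succ, hlab, h2,
          Nat.add_sub_cancel, ha]
        exact ⟨a, rfl⟩
      · simp only [Trans, hb, q, h𝒜, ofRecognizer, Set.mem_ofPred_eq, Recognizer.cfg_succ, hlab, h2,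
          Nat.add_sub_cancel, ha]
        exact ⟨a, rfl⟩
    · simp only [Trans, h4, q, h𝒜, ofRecognizer, Set.mem_ofPred_eq, Recognizer.cfg_succ, h2]
  have hwt : ∀ c, ∀ t ≤ dur w, 𝒜.seqWt M w.1 (q c) t =
      ((List.range' 1 (lookAt M w.1 t - 1)).map fun i => (ext c i).elim 1 val).prod := by
    intro c t
    induction t with
    | zero => intro _; rfl
    | succ t ih =>
      intro ht
      have h1 := one_le_lookAt (M := M) w.1 t
      have htr := htrans c t ht
      rw [seqWt, ih (by omega)]
      rcases read_or_pop w ht with ⟨⟨h2, h3⟩, h4, h5⟩ | ⟨⟨h2, h3⟩, h4⟩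
      · rw [h2, show lookAt M w.1 t + 1 - 1 = lookAt M w.1 t - 1 + 1 by omega, prod_range'_succ]
        congr 1
        rw [show lookAt M w.1 t - 1 + 1 = lookAt M w.1 t by omega]
        rcases h5 with ⟨b, hb⟩ | ⟨b, hb⟩
        · simp only [Trans, hb] at htr
          simp only [transWt, hb, pushWt_of_mem htr]
          simp only [q, h2, Nat.add_sub_cancel]
          rfl
        · simp only [Trans, hb] at htr
          simp only [transWt, hb, shiftWt_of_mem htr]
          simp only [q, h2, Nat.add_sub_cancel]
          rfl
      · simp only [Trans, h4] at htr
        simp only [transWt, h4, popWt_of_mem htr]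
        have hone : 𝒜.wtPop ⟨_, htr⟩ = 1 := rfl
        rw [hone, h2, mul_one]
  rw [behavior_eq_sum w (fun c => 𝒟.Accepts w (lab c)) q ?_ ?_ ?_]
  · refine Finset.sum_congr rfl fun c _ => ?_
    rw [hwt c _ le_rfl, lookAt_dur, Nat.add_sub_cancel, LabelSeries.map_range'_eq_ofFn]
    simp only [ext_succ, Option.elim_some]
    rfl
  · refine fun c hc => ⟨rfl, ?_, htrans c⟩
    have h : 𝒟.final _ (lab c (w.1.length + 1)) := hc
    rw [← lookAt_dur, hlab, lookAt_dur, hend] at h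
    exact h
  · intro c c' _ _ h
    funext k
    obtain ⟨t, ht, h1, h2⟩ := exists_read w (show 1 ≤ (k : ℕ) + 1 by omega) (by omega)
    have := congrArg Prod.snd (h (t + 1) ht)
    simp only [q, h2, Nat.add_sub_cancel, ext_succ, Option.some.injEq] at this
    exact this
  · intro q' hq'
    have hc : ∀ k : Fin w.1.length, ∃ a : C, ∀ t < dur w, lookAt M w.1 t = (k : ℕ) + 1 →
        lookAt M w.1 (t + 1) = (k : ℕ) + 1 + 1 → (q' (t + 1)).2 = some a := by
      intro k
      obtain ⟨t, ht, h1, h2⟩ := exists_read w (show 1 ≤ (k : ℕ) + 1 by omega) (by omega)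
      have htr := hq'.trans t ht
      have : ∃ a, (q' (t + 1)).2 = some a := by
        rcases read_or_pop w ht with ⟨-, -, ⟨b, hb⟩ | ⟨b, hb⟩⟩ | ⟨h3, -⟩
        · simp only [Trans, hb] at htr
          obtain ⟨a, ha⟩ := htr
          exact ⟨a, congrArg Prod.snd ha⟩
        · simp only [Trans, hb] at htr
          obtain ⟨a, ha⟩ := htr
          exact ⟨a, congrArg Prod.snd ha⟩
        · omega
      obtain ⟨a, ha⟩ := this
      refine ⟨a, fun t' ht' h1' h2' => ?_⟩
      rw [← ha, read_unique w (show lookAt M w.1 (t' + 1) = _ by omega)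
        (show lookAt M w.1 (t + 1) = _ by omega) (by omega)]
    choose c hc using hc
    -- All earlier times are needed, since a pop refers back to the state at the time of the push.
    have key : ∀ t ≤ dur w, ∀ s ≤ t, q c s = q' s := by
      intro t
      induction t with
      | zero =>
        intro _ s hs
        obtain rfl : s = 0 := by omega
        exact (show q' 0 = _ from hq'.init).symm
      | succ t ih =>
        intro ht s hs
        have ih := ih (by omega)
        rcases hs.lt_or_eq with hs | rfl
        · exact ih s (by omega)
        have htr := hq'.trans t ht
        have h1 := one_le_lookAt (M := M) w.1 t
        have hqt := ih t le_rfl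
        have hb := ih _ (born_le (M := M) (w := w.1) t)
        rcases read_or_pop w ht with ⟨⟨h2, h3⟩, h4, h5⟩ | ⟨⟨h2, h3⟩, h4⟩
        · have hce : ext c (lookAt M w.1 t) = some (c ⟨lookAt M w.1 t - 1, by omega⟩) :=
            ext_eq_some.2 ⟨_, by simp; omega, rfl⟩
          have hl : (q' (t + 1)).2 = some (c ⟨lookAt M w.1 t - 1, by omega⟩) :=
            hc _ t ht (by simp; omega) (by simp; omega)
          rcases h5 with ⟨b, hb⟩ | ⟨b, hb⟩
          · simp only [Trans, hb] at htr
            obtain ⟨a, ha⟩ := htr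
            simp only at ha
            rw [ha, Option.some.injEq] at hl
            rw [ha, ← hqt]
            simp only [q, Recognizer.cfg_succ, hb, hlab, h2, Nat.add_sub_cancel, hce, hl]
          · simp only [Trans, hb] at htr
            obtain ⟨a, ha⟩ := htr
            simp only at ha
            rw [ha, Option.some.injEq] at hl
            rw [ha, ← hqt]
            simp only [q, Recognizer.cfg_succ, hb, hlab, h2, Nat.add_sub_cancel, hce, hl]
        · simp only [Trans, h4] at htr
          have ha : q' (t + 1) = _ := htr
          rw [ha, ← hqt, ← hb]
          simp only [q, Recognizer.cfg_succ, h4, h2]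
    have hq : ∀ t ≤ dur w, q c t = q' t := fun t ht => key _ le_rfl t ht
    refine ⟨c, ?_, hq⟩
    have hf : 𝒟.final (q' (dur w)).1 (μ, none) := hq'.final
    rw [← hq _ le_rfl] at hf
    change 𝒟.final _ (lab c (w.1.length + 1))
    rw [← lookAt_dur, hlab, lookAt_dur, hend]
    exact hf

end WOPA

theorem exists_restricted_wopa {A : Type u} {M : OPM A} {K : Type v} [Semiring K] [Finite A]
    {φ : WFormula A K} (hs : φ.IsSentence) (hr : φ.Restricted) :
    ∃ (Q : Type) (_ : Finite Q) (𝒜 : WOPA A K Q), 𝒜.Restricted ∧ φ.series M = 𝒜.behavior M := by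
  obtain ⟨C, hC, val, P, ⟨D, hD, 𝒟, h𝒟⟩, -, h⟩ := LabelSeries.of_restricted (M := M) hr
  -- With all variables at position `0` and all sets empty, the marks are one constant at `0` and
  -- another elsewhere, as `ofRecognizer` expects.
  let σ : Assignment := ⟨fun _ => 0, fun _ => ∅⟩
  refine ⟨D × Option C, inferInstance,
    WOPA.ofRecognizer 𝒟 val (fun _ => True, fun _ => False) (fun _ => False, fun _ => False),
    fun _ => rfl, funext fun w => ?_⟩
  rw [← φ.sem_eq_series M hs w σ, WOPA.ofRecognizer_behavior]
  refine (h w σ fun _ => Nat.zero_le _).trans ?_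
  have : ∀ i, σ.marks i = if i = 0 then (fun _ => True, fun _ => False)
      else (fun _ => False, fun _ => False) := by
    intro i
    split_ifs with hi
    · subst hi; simp [Assignment.marks, σ]
    · simp [Assignment.marks, σ, Ne.symm hi]
  rw [labelSum]
  refine Finset.sum_congr rfl fun c _ => ?_
  congr 1
  rw [h𝒟]
  simp only [this]

end OPL

namespace OPL

universe u v

/-! ## Runs as labellings -/

section parse

variable {A : Type u} {M : OPM A}

theorem rel_of_push {w : List A} {t : ℕ} {a : A} (h : opAt M w t = .push a) :
    letterAt w (lookAt M w t) = some a ∧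
      M.rel (letterAt w (topAt M w t)) (letterAt w (lookAt M w t)) = some .yields ∧
      (parse M w (t + 1)).born = t := by
  have hm := parse_move M w t
  have hs := (parse_wf M w t).letterAt_top
  unfold topAt lookAt
  generalize parse M w t = p, parse M w (t + 1) = p', opAt M w t = o at *
  subst h
  cases hm with
  | push s j a ha h => exact ⟨ha, by rw [hs, ha]; exact h, rfl⟩

theorem rel_of_shift {w : List A} {t : ℕ} {a : A} (h : opAt M w t = .shift a) :
    letterAt w (lookAt M w t) = some a ∧
      M.rel (letterAt w (topAt M w t)) (letterAt w (lookAt M w t)) = some .equal ∧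
      1 ≤ topAt M w t ∧ (parse M w (t + 1)).born = (parse M w t).born := by
  have hm := parse_move M w t
  have wf := parse_wf M w t
  have hs := wf.letterAt_top
  unfold topAt lookAt
  generalize parse M w t = p, parse M w (t + 1) = p', opAt M w t = o at *
  subst h
  cases hm with
  | shift b v r s j a ha h =>
    exact ⟨ha, by rw [hs, ha]; exact h,
      (letterAt_eq_some (wf.letter (b, v, r) (by simp))).1, rfl⟩

theorem rel_of_pop {w : List A} {t : ℕ} (h : opAt M w t = .pop) :
    M.rel (letterAt w (topAt M w t)) (letterAt w (lookAt M w t)) = some .takes ∧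
      1 ≤ topAt M w t := by
  have hm := parse_move M w t
  have wf := parse_wf M w t
  have hs := wf.letterAt_top
  unfold topAt lookAt
  generalize parse M w t = p, parse M w (t + 1) = p', opAt M w t = o at *
  subst h
  cases hm with
  | pop b v r s j h =>
    exact ⟨by rw [hs]; exact h, (letterAt_eq_some (wf.letter (b, v, r) (by simp))).1⟩

theorem stack_ne_nil_of_top {w : List A} {t : ℕ} (h : 1 ≤ topAt M w t) :
    (parse M w t).stack ≠ [] := by
  intro e
  rw [topAt, Parse.top, e] at h
  simp at h

theorem opAt_eq_push {w : List A} {t : ℕ} {a : A}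
    (h : M.rel (letterAt w (topAt M w t)) (letterAt w (lookAt M w t)) = some .yields)
    (ha : letterAt w (lookAt M w t) = some a) : opAt M w t = .push a := by
  refine Parse.op_push ?_ ha
  rw [← (parse_wf M w t).letterAt_top, ← ha]
  exact h

theorem opAt_eq_shift {w : List A} {t : ℕ} {a : A}
    (h : M.rel (letterAt w (topAt M w t)) (letterAt w (lookAt M w t)) = some .equal)
    (ha : letterAt w (lookAt M w t) = some a) (ht : 1 ≤ topAt M w t) :
    opAt M w t = .shift a := by
  refine Parse.op_shift ?_ ha (stack_ne_nil_of_top ht)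
  rw [← (parse_wf M w t).letterAt_top, ← ha]
  exact h

theorem opAt_eq_pop {w : List A} {t : ℕ}
    (h : M.rel (letterAt w (topAt M w t)) (letterAt w (lookAt M w t)) = some .takes)
    (ht : 1 ≤ topAt M w t) : opAt M w t = .pop := by
  refine Parse.op_pop ?_ (stack_ne_nil_of_top ht)
  rw [← (parse_wf M w t).letterAt_top]
  exact h

theorem lt_dur_of_op {w : OPWord M} {t : ℕ} (ht : t ≤ dur w) (h : opAt M w.1 t ≠ .halt) :
    t < dur w := by
  rcases ht.lt_or_eq with ht | rfl
  · exact ht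
  · exact absurd (opAt_dur w) h

/-- The topmost cell was created when its position was read. -/
theorem exists_read_of_mem_stack (w : List A) (t : ℕ) :
    ∀ x ∈ (parse M w t).stack, ∃ r < t, lookAt M w r = x.2.1 ∧
      lookAt M w (r + 1) = x.2.1 + 1 ∧ (parse M w (r + 1)).born = x.2.2 := by
  induction t with
  | zero => simp [parse]
  | succ t ih =>
    have hm := parse_move M w t
    have ih : ∀ x ∈ (parse M w t).stack, ∃ r < t + 1, lookAt M w r = x.2.1 ∧
        lookAt M w (r + 1) = x.2.1 + 1 ∧ (parse M w (r + 1)).born = x.2.2 := fun x hx => by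
      obtain ⟨r, hr, h⟩ := ih x hx
      exact ⟨r, by omega, h⟩
    generalize hp : parse M w t = p, hp' : parse M w (t + 1) = p', opAt M w t = o at *
    cases hm with
    | push s j a ha h =>
      simp only [List.mem_cons, forall_eq_or_imp]
      refine ⟨⟨t, by omega, by rw [lookAt, hp], by rw [lookAt, hp'], by rw [hp']; rfl⟩, ih⟩
    | shift b v r s j a ha h =>
      simp only [List.mem_cons, forall_eq_or_imp] at ih ⊢
      refine ⟨⟨t, by omega, by rw [lookAt, hp], by rw [lookAt, hp'], by rw [hp']; rfl⟩, ih.2⟩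
    | pop b v r s j h =>
      simp only [List.mem_cons, forall_eq_or_imp] at ih ⊢
      exact ih.2
    | halt p h => exact ih

theorem exists_mem_stack_top {w : List A} {t : ℕ} (h : 1 ≤ topAt M w t) :
    ∃ x ∈ (parse M w t).stack, x.2.1 = topAt M w t ∧ x.2.2 = (parse M w t).born := by
  have hne := stack_ne_nil_of_top h
  unfold topAt
  generalize parse M w t = p at *
  obtain ⟨_ | ⟨x, s⟩, j⟩ := p
  · exact absurd rfl hne
  · exact ⟨x, by simp, rfl, rfl⟩

theorem exists_read_of_top {w : List A} {t : ℕ} (h : 1 ≤ topAt M w t) :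
    ∃ r < t, lookAt M w r = topAt M w t ∧ lookAt M w (r + 1) = topAt M w t + 1 ∧
      (parse M w (r + 1)).born = (parse M w t).born := by
  obtain ⟨x, hx, h1, h2⟩ := exists_mem_stack_top h
  obtain ⟨r, hr, h3⟩ := exists_read_of_mem_stack w t x hx
  rw [h1, h2] at h3
  exact ⟨r, hr, h3⟩

variable (w : OPWord M)

/-- Only the lookahead ever enters the stack, and it already lies beyond the popped position. -/
theorem not_mem_stack_of_popped {s t : ℕ} (hs : opAt M w.1 s = .pop) (h : s < t) :
    ∀ x ∈ (parse M w.1 t).stack, x.2.1 ≠ topAt M w.1 s := by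
  induction t, h using Nat.le_induction with
  | base =>
    have hm := parse_move M w.1 s
    have wf := parse_wf M w.1 s
    simp only [Nat.succ_eq_add_one] at *
    unfold topAt
    generalize parse M w.1 s = p, parse M w.1 (s + 1) = p', opAt M w.1 s = o at *
    subst hs
    cases hm with
    | pop b v r s j h => exact fun x hx => ((List.pairwise_cons.1 wf.sorted).1 x hx).ne
  | succ t h ih =>
    have hm := parse_move M w.1 t
    have h1 := topAt_lt_lookAt (M := M) w.1 s
    have h2 := lookAt_mono w (show s ≤ t by omega)
    have h3 : topAt M w.1 s < lookAt M w.1 t := by omega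
    clear h1 h2
    rw [lookAt] at h3
    generalize topAt M w.1 s = v at *
    generalize parse M w.1 t = p, parse M w.1 (t + 1) = p', opAt M w.1 t = o at *
    cases hm with
    | push s j a ha h =>
      simp only [List.mem_cons, forall_eq_or_imp]
      exact ⟨h3.ne', ih⟩
    | shift b v r s j a ha h =>
      simp only [List.mem_cons, forall_eq_or_imp] at ih ⊢
      exact ⟨h3.ne', ih.2⟩
    | pop b v r s j h =>
      simp only [List.mem_cons, forall_eq_or_imp] at ih ⊢
      exact ih.2
    | halt p h => exact ih

theorem pop_unique {s t : ℕ} (hs : opAt M w.1 s = .pop) (ht : opAt M w.1 t = .pop)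
    (h : topAt M w.1 s = topAt M w.1 t) : s = t := by
  have key : ∀ s t, opAt M w.1 s = .pop → opAt M w.1 t = .pop →
      topAt M w.1 s = topAt M w.1 t → ¬ s < t := by
    intro s t hs ht h hlt
    obtain ⟨x, hx, h1, -⟩ := exists_mem_stack_top (rel_of_pop ht).2
    exact not_mem_stack_of_popped w hs hlt x hx (h1.trans h.symm)
  rcases lt_trichotomy s t with e | e | e
  · exact absurd e (key s t hs ht h)
  · exact e
  · exact absurd e (key t s ht hs h.symm)

theorem opAt_zero : ∃ a, opAt M w.1 0 = .push a ∧ 0 < dur w := by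
  have hn := length_pos w
  obtain ⟨a, ha⟩ := exists_letterAt (w := w.1) le_rfl hn
  have h : opAt M w.1 0 = .push a := opAt_eq_push (by
    change M.rel none (letterAt w.1 1) = _
    rw [ha]; exact M.hash_left a) ha
  exact ⟨a, h, lt_dur_of_op (Nat.zero_le _) (by rw [h]; simp)⟩

end parse

/-- The label of a position in the description of a run: the letter, whether it is shifted, the
states before and after reading it, the state stored in its cell, and the states before and after
popping the cell, if it is popped with this letter. -/
@[ext]
structure Lab (A : Type u) (Q : Type) : Type u where
  letter : A
  isShift : Bool
  pre : Q
  post : Q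
  stored : Q
  popped : Option (Q × Q)

instance {A : Type u} {Q : Type} [Finite A] [Finite Q] : Finite (Lab A Q) :=
  Finite.of_injective
    (fun l => (l.letter, l.isShift, l.pre, l.post, l.stored, l.popped)) fun l l' h => by
      simp only [Prod.mk.injEq] at h
      exact Lab.ext h.1 h.2.1 h.2.2.1 h.2.2.2.1 h.2.2.2.2.1 h.2.2.2.2.2

namespace WOPA

variable {A : Type u} {M : OPM A} {K : Type v} {Q : Type}

/-- `Arrives M w Z v y p` says that `p` is the state with top position `v` and lookahead `y`
according to the labels. The predicate `Z l i` says that position `i` has label `l`. -/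
def Arrives (M : OPM A) (w : List A) (Z : Lab A Q → ℕ → Prop) (v y : ℕ) (p : Q) : Prop :=
  (v + 1 = y ∧ ((letterAt w v = none ∧ ∃ l : Lab A Q, l.pre = p ∧ Z l y) ∨
    ∃ l : Lab A Q, l.post = p ∧ Z l v)) ∨
  ∃ u, u ≤ w.length + 1 ∧ v < u ∧ Link M w u y ∧
    (∀ t, t ≤ w.length + 1 → v < t → t < u → ¬ Link M w t y) ∧
    ∃ l : Lab A Q, (∃ p', l.popped = some (p', p)) ∧ Z l u

/-- The labels describe an accepting run. -/
structure RunLab (M : OPM A) (𝒜 : WOPA A K Q) (w : List A) (Z : Lab A Q → ℕ → Prop) : Prop where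
  letter : ∀ x ≤ w.length + 1, ∀ l, Z l x → letterAt w x = some l.letter
  push : ∀ v ≤ w.length + 1, ∀ y ≤ w.length + 1, Link M w v y →
    M.rel (letterAt w v) (letterAt w y) = some .yields → ∀ l, Z l y →
    (l.isShift = false ∧ l.stored = l.pre ∧ (l.pre, l.letter, l.post) ∈ 𝒜.push) ∧
      Arrives M w Z v y l.pre
  shift : ∀ v ≤ w.length + 1, ∀ y ≤ w.length + 1, Link M w v y →
    M.rel (letterAt w v) (letterAt w y) = some .equal → ∀ l, Z l y → ∀ l', Z l' v →
    (l.isShift = true ∧ l.stored = l'.stored ∧ (l.pre, l.letter, l.post) ∈ 𝒜.shift) ∧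
      Arrives M w Z v y l.pre
  pop : ∀ v ≤ w.length + 1, ∀ y ≤ w.length + 1, Link M w v y →
    M.rel (letterAt w v) (letterAt w y) = some .takes → ∀ l, Z l v →
    ∃ x : Q × Q, (l.popped = some x ∧ (x.1, l.stored, x.2) ∈ 𝒜.pop) ∧ Arrives M w Z v y x.1
  unpopped : ∀ v ≤ w.length + 1, ∀ l, Z l v → l.popped = none ∨ ∃ y ≤ w.length + 1,
    Link M w v y ∧ M.rel (letterAt w v) (letterAt w y) = some .takes
  init : ∀ v ≤ w.length + 1, ∀ y ≤ w.length + 1, v + 1 = y → letterAt w v = none →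
    ∀ l, Z l y → l.pre ∈ 𝒜.init
  final : ∀ v ≤ w.length + 1, ∀ y ≤ w.length + 1, v < y → letterAt w v = none →
    letterAt w y = none → ∃ p, p ∈ 𝒜.final ∧ Arrives M w Z v y p

variable {𝒜 : WOPA A K Q} {w : OPWord M}

/-- The label of position `y` describes its role in the sequence `q` of states. -/
structure Describes (w : OPWord M) (q : ℕ → Q) (y : ℕ) (l : Lab A Q) : Prop where
  letter : letterAt w.1 y = some l.letter
  read : ∀ t < dur w, lookAt M w.1 t = y → lookAt M w.1 (t + 1) = y + 1 →
    l.pre = q t ∧ l.post = q (t + 1) ∧ l.stored = q (parse M w.1 (t + 1)).born ∧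
      (l.isShift = true ↔ ∃ a, opAt M w.1 t = .shift a)
  pop : ∀ t < dur w, opAt M w.1 t = .pop → topAt M w.1 t = y → l.popped = some (q t, q (t + 1))
  unpopped : l.popped = none ∨ ∃ t < dur w, opAt M w.1 t = .pop ∧ topAt M w.1 t = y

theorem exists_describes (w : OPWord M) (q : ℕ → Q) {y : ℕ} (h : 1 ≤ y) (h' : y ≤ w.1.length) :
    ∃ l : Lab A Q, Describes w q y l := by
  classical
  obtain ⟨a, ha⟩ := exists_letterAt h h'
  obtain ⟨t, ht, h1, h2⟩ := exists_read w h h'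
  refine ⟨⟨a, decide (∃ a, opAt M w.1 t = .shift a), q t, q (t + 1),
    q (parse M w.1 (t + 1)).born,
    -- By `pop_unique` the chosen time is the only one at which `y` is popped.
    if hs : ∃ s < dur w, opAt M w.1 s = .pop ∧ topAt M w.1 s = y then
      some (q hs.choose, q (hs.choose + 1)) else none⟩, ha, ?_, ?_, ?_⟩
  · intro t' ht' h1' h2'
    obtain rfl := read_unique w (t := t') (t' := t) (by omega) (by omega) (by omega)
    simp
  · intro s hs h3 h4
    have hex : ∃ s < dur w, opAt M w.1 s = .pop ∧ topAt M w.1 s = y := ⟨s, hs, h3, h4⟩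
    have e : hex.choose = s := pop_unique w hex.choose_spec.2.1 h3
      (hex.choose_spec.2.2.trans h4.symm)
    simp only [dif_pos hex, e]
  · by_cases hs : ∃ s < dur w, opAt M w.1 s = .pop ∧ topAt M w.1 s = y
    · exact .inr hs
    · exact .inl (dif_neg hs)

/-- Here `unpopped` is essential: otherwise the component `popped` would be free at positions that
are never popped, and one run would be counted several times. -/
theorem Describes.unique {q q' : ℕ → Q} {y : ℕ} {l l' : Lab A Q} (h : Describes w q y l)
    (h' : Describes w q' y l') (hq : ∀ t ≤ dur w, q t = q' t) : l = l' := by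
  have hy := letterAt_eq_some h.letter
  obtain ⟨t, ht, h1, h2⟩ := exists_read w hy.1 hy.2
  obtain ⟨e1, e2, e3, e4⟩ := h.read t ht h1 h2
  obtain ⟨e1', e2', e3', e4'⟩ := h'.read t ht h1 h2
  refine Lab.ext ?_ (Bool.eq_iff_iff.2 (e4.trans e4'.symm)) ?_ ?_ ?_ ?_
  · exact Option.some_injective _ (h.letter.symm.trans h'.letter)
  · rw [e1, e1', hq t ht.le]
  · rw [e2, e2', hq _ ht]
  · rw [e3, e3', hq _ ((born_le _).trans ht)]
  · rcases h.unpopped with h3 | ⟨s, hs, h3, h4⟩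
    · rcases h'.unpopped with h4 | ⟨s, hs, h4, h5⟩
      · rw [h3, h4]
      · rw [h.pop s hs h4 h5] at h3; simp at h3
    · rw [h.pop s hs h3 h4, h'.pop s hs h3 h4, hq s hs.le, hq _ hs]

variable {c : Fin w.1.length → Lab A Q}

theorem exists_ext {C : Type*} {n : ℕ} (c : Fin n → C) {y : ℕ} (h : 1 ≤ y) (h' : y ≤ n) :
    ∃ l, ext c y = some l :=
  ⟨c ⟨y - 1, by omega⟩, ext_eq_some.2 ⟨_, by simp; omega, rfl⟩⟩

theorem ext_bounds {C : Type*} {n : ℕ} {c : Fin n → C} {y : ℕ} {l : C} (h : ext c y = some l) :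
    1 ≤ y ∧ y ≤ n := by
  obtain ⟨k, rfl, -⟩ := ext_eq_some.1 h
  omega

theorem ext_injOn {C : Type*} {n : ℕ} {c : Fin n → C} {y : ℕ} {l l' : C} (h : ext c y = some l)
    (h' : ext c y = some l') : l = l' := Option.some_injective _ (h.symm.trans h')

theorem arrives_zero {l : Lab A Q} (hl : ext c 1 = some l) (p : Q) :
    Arrives M w.1 (fun l i => ext c i = some l) 0 1 p ↔ l.pre = p := by
  constructor
  · rintro (⟨-, ⟨-, l', rfl, h⟩ | ⟨l', -, h⟩⟩ | ⟨u, -, h1, h2, -⟩)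
    · rw [ext_injOn hl h]
    · exact absurd (ext_bounds h).1 (by omega)
    · have := h2.lt; omega
  · exact fun h => .inl ⟨rfl, .inl ⟨rfl, l, h, hl⟩⟩

theorem arrives_read {t : ℕ} (ht : t < dur w)
    (h : lookAt M w.1 (t + 1) = lookAt M w.1 t + 1) {l : Lab A Q}
    (hl : ext c (lookAt M w.1 t) = some l) (p : Q) :
    Arrives M w.1 (fun l i => ext c i = some l) (topAt M w.1 (t + 1)) (lookAt M w.1 (t + 1)) p ↔
      l.post = p := by
  have h1 : topAt M w.1 (t + 1) = lookAt M w.1 t := by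
    rcases read_or_pop w ht with h2 | h2 <;> omega
  rw [h1, h]
  obtain ⟨a, ha⟩ := exists_letterAt (w := w.1) (ext_bounds hl).1 (ext_bounds hl).2
  constructor
  · rintro (⟨-, ⟨h2, -⟩ | ⟨l', rfl, h⟩⟩ | ⟨u, -, h1, h2, -⟩)
    · rw [ha] at h2; simp at h2
    · rw [ext_injOn hl h]
    · have := h2.lt; omega
  · exact fun h => .inl ⟨rfl, .inr ⟨l, h, hl⟩⟩

/-- The popped position is the least one above the new top that is linked to the lookahead; this is
how a formula finds the preceding pop. -/
theorem arrives_pop {t : ℕ} (ht : t < dur w) (h : opAt M w.1 t = .pop) {l : Lab A Q}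
    (hl : ext c (topAt M w.1 t) = some l) (p : Q) :
    Arrives M w.1 (fun l i => ext c i = some l) (topAt M w.1 (t + 1)) (lookAt M w.1 (t + 1)) p ↔
      ∃ p', l.popped = some (p', p) := by
  obtain ⟨h1, h2⟩ : lookAt M w.1 (t + 1) = lookAt M w.1 t ∧
      topAt M w.1 (t + 1) < topAt M w.1 t := by
    rcases read_or_pop w ht with ⟨-, -, ⟨a, h2⟩ | ⟨a, h2⟩⟩ | h2
    · rw [h] at h2; simp at h2
    · rw [h] at h2; simp at h2
    · exact h2.1
  have h3 := topAt_lt_lookAt (M := M) w.1 t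
  have h4 := lookAt_le (M := M) w.1 t
  -- Under a fixed lookahead tops strictly decrease in time, so none lies between two consecutive
  -- ones.
  have gap : ∀ u, topAt M w.1 (t + 1) < u → u < topAt M w.1 t →
      ¬ Link M w.1 u (lookAt M w.1 t) := by
    intro u hu hu' hlink
    obtain ⟨r, hr, rfl, h6⟩ := (link_iff_exists_time w).1 ⟨hlink, h4⟩
    rcases lt_trichotomy r t with e | e | e
    · have := topAt_lt_topAt w e ht.le h6; omega
    · subst e; omega
    · rcases (show t + 1 ≤ r by omega).lt_or_eq with e | e
      · have := topAt_lt_topAt w e hr (by omega); omega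
      · subst e; omega
  rw [h1]
  constructor
  · rintro (⟨h5, -⟩ | ⟨u, -, h5, h6, h7, l', hp, h8⟩)
    · omega
    · have : u = topAt M w.1 t := by
        rcases lt_trichotomy u (topAt M w.1 t) with e | e | e
        · exact absurd h6 (gap u h5 e)
        · exact e
        · exact absurd (link_topAt t) (h7 _ (by omega) h2 e)
      subst this
      rwa [ext_injOn hl h8]
  · intro hp
    exact .inr ⟨topAt M w.1 t, by omega, h2, link_topAt t, fun u _ hu hu' => gap u hu hu', l,
      hp, hl⟩

/-- The move before time `t` selects the clause of `Arrives`: the initial one if there is none, and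
otherwise the clause for reads or for pops. -/
theorem arrives_of_describes {q : ℕ → Q} (hd : ∀ k : Fin w.1.length, Describes w q (k + 1) (c k))
    {t : ℕ} (ht : t ≤ dur w) :
    Arrives M w.1 (fun l i => ext c i = some l) (topAt M w.1 t) (lookAt M w.1 t) (q t) := by
  have hd' : ∀ y l, ext c y = some l → Describes w q y l := by
    intro y l h
    obtain ⟨k, rfl, rfl⟩ := ext_eq_some.1 h
    exact hd k
  cases t with
  | zero =>
    obtain ⟨l, hl⟩ := exists_ext c le_rfl (length_pos w)
    refine (arrives_zero hl _).2 ?_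
    obtain ⟨a, h0, h1⟩ := opAt_zero w
    refine ((hd' _ _ hl).read 0 h1 rfl ?_).1
    rcases read_or_pop w h1 with h2 | h2
    · exact h2.1.1
    · rw [h0] at h2; simp at h2
  | succ t =>
    rcases read_or_pop w ht with h1 | h1
    · obtain ⟨l, hl⟩ := exists_ext c (one_le_lookAt (M := M) w.1 t) h1.2.1
      exact (arrives_read ht h1.1.1 hl _).2 ((hd' _ _ hl).read t ht rfl h1.1.1).2.1
    · have h2 := topAt_lt_lookAt (M := M) w.1 t
      have h3 := lookAt_le (M := M) w.1 t
      obtain ⟨l, hl⟩ := exists_ext c (rel_of_pop h1.2).2 (by omega)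
      exact (arrives_pop ht h1.2 hl _).2 ⟨_, (hd' _ _ hl).pop t ht h1.2 rfl⟩

theorem stored_of_describes {q : ℕ → Q} (hd : ∀ k : Fin w.1.length, Describes w q (k + 1) (c k))
    {t : ℕ} (ht : t ≤ dur w) {l : Lab A Q} (hl : ext c (topAt M w.1 t) = some l) :
    l.stored = q (parse M w.1 t).born := by
  obtain ⟨r, hr, h1, h2, h3⟩ := exists_read_of_top (ext_bounds hl).1
  rw [← h3]
  obtain ⟨k, hk, rfl⟩ := ext_eq_some.1 hl
  exact ((hd k).read r (by omega) (h1.trans hk.symm) (by omega)).2.2.1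

theorem letterAt_eq_none {w : List A} {i : ℕ} (h : i ≤ w.length + 1) (h' : letterAt w i = none) :
    i = 0 ∨ i = w.length + 1 := by
  by_contra hc
  obtain ⟨a, ha⟩ := exists_letterAt (w := w) (j := i) (by omega) (by omega)
  rw [ha] at h'
  simp at h'

variable [Semiring K]

omit [Semiring K] in
theorem runLab_of_describes {q : ℕ → Q} (hq : IsRun 𝒜 w q)
    (hd : ∀ k : Fin w.1.length, Describes w q (k + 1) (c k)) :
    RunLab M 𝒜 w.1 (fun l i => ext c i = some l) := by
  have hd' : ∀ y l, ext c y = some l → Describes w q y l := by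
    intro y l h
    obtain ⟨k, rfl, rfl⟩ := ext_eq_some.1 h
    exact hd k
  have time : ∀ {v y}, y ≤ w.1.length + 1 → Link M w.1 v y →
      ∃ t ≤ dur w, topAt M w.1 t = v ∧ lookAt M w.1 t = y :=
    fun h h' => (link_iff_exists_time w).1 ⟨h', h⟩
  constructor
  · exact fun x _ l hl => (hd' x l hl).letter
  · rintro v - y hy hlink hr l hl
    obtain ⟨t, ht, rfl, rfl⟩ := time hy hlink
    have hop := opAt_eq_push hr (hd' _ l hl).letter
    have ht := lt_dur_of_op ht (by rw [hop]; simp)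
    have htr := hq.trans t ht
    have hread : lookAt M w.1 (t + 1) = lookAt M w.1 t + 1 := by
      rcases read_or_pop w ht with h | h
      · exact h.1.1
      · rw [hop] at h; simp at h
    obtain ⟨e1, e2, e3, e4⟩ := (hd' _ l hl).read t ht rfl hread
    simp only [Trans, hop] at htr
    refine ⟨⟨?_, ?_, by rw [e1, e2]; exact htr⟩, by rw [e1]; exact arrives_of_describes hd ht.le⟩
    · rw [← Bool.not_eq_true, e4, hop]; simp
    · rw [e3, e1, (rel_of_push hop).2.2]
  · rintro v - y hy hlink hr l hl l' hl'
    obtain ⟨t, ht, rfl, rfl⟩ := time hy hlink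
    have hop := opAt_eq_shift hr (hd' _ l hl).letter (ext_bounds hl').1
    have ht := lt_dur_of_op ht (by rw [hop]; simp)
    have htr := hq.trans t ht
    have hread : lookAt M w.1 (t + 1) = lookAt M w.1 t + 1 := by
      rcases read_or_pop w ht with h | h
      · exact h.1.1
      · rw [hop] at h; simp at h
    obtain ⟨e1, e2, e3, e4⟩ := (hd' _ l hl).read t ht rfl hread
    simp only [Trans, hop] at htr
    refine ⟨⟨?_, ?_, by rw [e1, e2]; exact htr⟩, by rw [e1]; exact arrives_of_describes hd ht.le⟩
    · rw [e4, hop]; simp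
    · rw [e3, (rel_of_shift hop).2.2.2, stored_of_describes hd ht.le hl']
  · rintro v - y hy hlink hr l hl
    obtain ⟨t, ht, rfl, rfl⟩ := time hy hlink
    have hop := opAt_eq_pop hr (ext_bounds hl).1
    have ht := lt_dur_of_op ht (by rw [hop]; simp)
    have htr := hq.trans t ht
    simp only [Trans, hop] at htr
    refine ⟨(q t, q (t + 1)), ⟨(hd' _ l hl).pop t ht hop rfl, ?_⟩, arrives_of_describes hd ht.le⟩
    rw [stored_of_describes hd ht.le hl]
    exact htr
  · rintro v - l hl
    refine (hd' _ l hl).unpopped.imp_right ?_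
    rintro ⟨t, ht, hop, rfl⟩
    exact ⟨_, lookAt_le w.1 t, link_topAt t, (rel_of_pop hop).1⟩
  · rintro v hv y hy rfl hv0 l hl
    obtain rfl : v = 0 := by rcases letterAt_eq_none hv hv0 with h | h <;> omega
    have h := arrives_of_describes hd (Nat.zero_le (dur w))
    have e : l.pre = q 0 := (arrives_zero hl _).1 h
    rw [e]
    exact hq.init
  · rintro v hv y hy hlt hv0 hy0
    obtain rfl : v = 0 := by rcases letterAt_eq_none hv hv0 with h | h <;> omega
    obtain rfl : y = w.1.length + 1 := by rcases letterAt_eq_none hy hy0 with h | h <;> omega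
    have h := arrives_of_describes hd (le_refl (dur w))
    rw [topAt_dur, lookAt_dur] at h
    exact ⟨_, hq.final, h⟩

-- The states are recovered through `Arrives`, which singles out one state at every time; the local
-- conditions then turn into transitions.
omit [Semiring K] in
theorem exists_run_of_runLab (h : RunLab M 𝒜 w.1 (fun l i => ext c i = some l)) :
    ∃ q, IsRun 𝒜 w q ∧ ∀ k : Fin w.1.length, Describes w q (k + 1) (c k) := by
  have hv : ∀ t, topAt M w.1 t ≤ w.1.length + 1 := fun t =>
    (topAt_lt_lookAt w.1 t).le.trans (lookAt_le w.1 t)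
  have hlook : ∀ {t}, t < dur w → lookAt M w.1 (t + 1) = lookAt M w.1 t + 1 →
      ∃ l, ext c (lookAt M w.1 t) = some l := fun {t} ht h1 => by
    have := lookAt_le (M := M) w.1 (t + 1)
    exact exists_ext c (one_le_lookAt (M := M) w.1 t) (by omega)
  have htop : ∀ {t}, 1 ≤ topAt M w.1 t → ∃ l, ext c (topAt M w.1 t) = some l := fun {t} h1 => by
    have := topAt_lt_lookAt (M := M) w.1 t
    have := lookAt_le (M := M) w.1 t
    exact exists_ext c h1 (by omega)
  have hpop : ∀ {t} {l : Lab A Q}, opAt M w.1 t = .pop → ext c (topAt M w.1 t) = some l →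
      ∃ x : Q × Q, (l.popped = some x ∧ (x.1, l.stored, x.2) ∈ 𝒜.pop) ∧
        Arrives M w.1 (fun l i => ext c i = some l) (topAt M w.1 t) (lookAt M w.1 t) x.1 :=
    fun {t l} h1 h2 => h.pop _ (hv t) _ (lookAt_le w.1 t) (link_topAt t) (rel_of_pop h1).1 l h2
  -- Existence after a pop uses the pop condition of `RunLab`, which provides a label with `popped`
  -- filled in.
  have hex : ∀ t, t ≤ dur w → ∃ p, ∀ p', Arrives M w.1 (fun l i => ext c i = some l)
      (topAt M w.1 t) (lookAt M w.1 t) p' ↔ p = p' := by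
    intro t ht
    cases t with
    | zero =>
      obtain ⟨l, hl⟩ := exists_ext c le_rfl (length_pos w)
      exact ⟨l.pre, arrives_zero hl⟩
    | succ t =>
      rcases read_or_pop w ht with h1 | h1
      · obtain ⟨l, hl⟩ := hlook ht h1.1.1
        exact ⟨l.post, arrives_read ht h1.1.1 hl⟩
      · obtain ⟨l, hl⟩ := htop (rel_of_pop h1.2).2
        obtain ⟨x, ⟨hx, -⟩, -⟩ := hpop h1.2 hl
        refine ⟨x.2, fun p' => (arrives_pop ht h1.2 hl p').trans ?_⟩
        rw [hx]
        exact ⟨fun ⟨p, e⟩ => by cases e; rfl, fun e => ⟨x.1, by rw [← e]⟩⟩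
  obtain ⟨q, hq⟩ : ∃ q : ℕ → Q, ∀ t, t ≤ dur w → ∀ p', Arrives M w.1
      (fun l i => ext c i = some l) (topAt M w.1 t) (lookAt M w.1 t) p' ↔ q t = p' := by
    obtain ⟨p₀, -⟩ := hex 0 (Nat.zero_le _)
    have : ∀ t, ∃ p, t ≤ dur w → ∀ p', Arrives M w.1 (fun l i => ext c i = some l)
        (topAt M w.1 t) (lookAt M w.1 t) p' ↔ p = p' := fun t => by
      by_cases ht : t ≤ dur w
      · exact (hex t ht).imp fun p hp _ => hp
      · exact ⟨p₀, fun h => absurd h ht⟩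
    choose q hq using this
    exact ⟨q, hq⟩
  have hpost : ∀ {t} {l : Lab A Q}, t < dur w → lookAt M w.1 (t + 1) = lookAt M w.1 t + 1 →
      ext c (lookAt M w.1 t) = some l → q (t + 1) = l.post := fun {t l} ht h1 h2 =>
    (hq _ ht _).1 ((arrives_read ht h1 h2 _).2 rfl)
  have hpopped : ∀ {t} {l : Lab A Q}, t < dur w → opAt M w.1 t = .pop →
      ext c (topAt M w.1 t) = some l →
      l.popped = some (q t, q (t + 1)) ∧ (q t, l.stored, q (t + 1)) ∈ 𝒜.pop := by
    intro t l ht h1 h2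
    obtain ⟨x, ⟨hx, hm⟩, ha⟩ := hpop h1 h2
    have e1 : q t = x.1 := (hq t ht.le _).1 ha
    have e2 : q (t + 1) = x.2 := (hq _ ht _).1 ((arrives_pop ht h1 h2 _).2 ⟨_, hx⟩)
    rw [e1, e2]
    exact ⟨hx, hm⟩
  have hread : ∀ {t}, t < dur w → lookAt M w.1 (t + 1) = lookAt M w.1 t + 1 → ∀ {l : Lab A Q},
      ext c (lookAt M w.1 t) = some l →
      (opAt M w.1 t = .push l.letter ∧ l.isShift = false ∧ l.stored = l.pre ∧
        (l.pre, l.letter, l.post) ∈ 𝒜.push ∧ q t = l.pre) ∨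
      (opAt M w.1 t = .shift l.letter ∧ l.isShift = true ∧
        (∀ l', ext c (topAt M w.1 t) = some l' → l.stored = l'.stored) ∧
        (l.pre, l.letter, l.post) ∈ 𝒜.shift ∧ q t = l.pre) := by
    intro t ht h1 l hl
    have hlet := h.letter _ (lookAt_le w.1 t) l hl
    rcases read_or_pop w ht with ⟨-, -, ⟨a, hop⟩ | ⟨a, hop⟩⟩ | h2
    · obtain ⟨e1, e2, e3⟩ := rel_of_push hop
      obtain rfl : a = l.letter := Option.some_injective _ (e1.symm.trans hlet)
      obtain ⟨⟨e4, e5, e6⟩, e7⟩ :=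
        h.push _ (hv t) _ (lookAt_le w.1 t) (link_topAt t) e2 l hl
      exact .inl ⟨hop, e4, e5, e6, (hq t ht.le _).1 e7⟩
    · obtain ⟨e1, e2, e3, -⟩ := rel_of_shift hop
      obtain rfl : a = l.letter := Option.some_injective _ (e1.symm.trans hlet)
      have key := h.shift _ (hv t) _ (lookAt_le w.1 t) (link_topAt t) e2 l hl
      obtain ⟨l', hl'⟩ := htop e3
      obtain ⟨⟨e4, e5, e6⟩, e7⟩ := key l' hl'
      exact .inr ⟨hop, e4, fun l'' h'' => (key l'' h'').1.2.1, e6, (hq t ht.le _).1 e7⟩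
    · omega
  -- A shifted letter inherits the stored state of the letter it replaces, which was read earlier;
  -- hence the strong induction.
  have hstored : ∀ t, t < dur w → lookAt M w.1 (t + 1) = lookAt M w.1 t + 1 →
      ∀ l : Lab A Q, ext c (lookAt M w.1 t) = some l →
      l.stored = q (parse M w.1 (t + 1)).born := by
    intro t
    induction t using Nat.strong_induction_on with
    | _ t ih =>
      intro ht h1 l hl
      rcases hread ht h1 hl with ⟨hop, -, e1, -, e2⟩ | ⟨hop, -, e1, -, -⟩
      · rw [(rel_of_push hop).2.2, e1, e2]
      · obtain ⟨-, -, h2, h3⟩ := rel_of_shift hop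
        obtain ⟨l', hl'⟩ := htop h2
        obtain ⟨r, hr, h4, h5, h6⟩ := exists_read_of_top h2
        rw [e1 l' hl', h3, ← h6]
        exact ih r hr (by omega) (by omega) l' (by rw [h4]; exact hl')
  have hstored' : ∀ {t}, t < dur w → ∀ {l : Lab A Q}, ext c (topAt M w.1 t) = some l →
      l.stored = q (parse M w.1 t).born := by
    intro t ht l hl
    obtain ⟨r, hr, h4, h5, h6⟩ := exists_read_of_top (ext_bounds hl).1
    rw [← h6]
    exact hstored r (by omega) (by omega) l (by rw [h4]; exact hl)
  refine ⟨q, ⟨?_, ?_, ?_⟩, fun k => ⟨?_, ?_, ?_, ?_⟩⟩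
  · obtain ⟨l, hl⟩ := exists_ext c le_rfl (length_pos w)
    have : q 0 = l.pre := (hq 0 (Nat.zero_le _) _).1 ((arrives_zero hl _).2 rfl)
    rw [this]
    exact h.init 0 (by omega) 1 (by omega) rfl rfl l hl
  · obtain ⟨p, hp, ha⟩ := h.final 0 (by omega) _ le_rfl (by omega) rfl (letterAt_length_succ _)
    have h1 := hq _ le_rfl p
    rw [topAt_dur, lookAt_dur] at h1
    rwa [h1.1 ha]
  · intro t ht
    rcases read_or_pop w ht with h1 | ⟨-, h1⟩
    · obtain ⟨l, hl⟩ := hlook ht h1.1.1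
      rcases hread ht h1.1.1 hl with ⟨hop, -, -, e1, e2⟩ | ⟨hop, -, -, e1, e2⟩
      · simp only [Trans, hop, e2, hpost ht h1.1.1 hl, e1]
      · simp only [Trans, hop, e2, hpost ht h1.1.1 hl, e1]
    · obtain ⟨l, hl⟩ := htop (rel_of_pop h1).2
      simp only [Trans, h1]
      rw [← hstored' ht hl]
      exact (hpopped ht h1 hl).2
  · exact h.letter _ (by omega) _ (ext_succ c k)
  · intro t ht h1 h2
    have hl : ext c (lookAt M w.1 t) = some (c k) := by rw [h1, ext_succ]
    have h2 : lookAt M w.1 (t + 1) = lookAt M w.1 t + 1 := by omega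
    refine ⟨?_, (hpost ht h2 hl).symm, hstored t ht h2 _ hl, ?_⟩
    · rcases hread ht h2 hl with ⟨-, -, -, -, e⟩ | ⟨-, -, -, -, e⟩ <;> exact e.symm
    · rcases hread ht h2 hl with ⟨hop, e, -⟩ | ⟨hop, e, -⟩ <;> simp [hop, e]
  · intro t ht h1 h2
    exact (hpopped ht h1 (by rw [h2, ext_succ])).1
  · refine (h.unpopped _ (by omega) _ (ext_succ c k)).imp_right ?_
    rintro ⟨y, hy, hlink, hr⟩
    obtain ⟨t, ht, h1, rfl⟩ := (link_iff_exists_time w).1 ⟨hlink, hy⟩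
    have hop : opAt M w.1 t = .pop := opAt_eq_pop (by rw [h1]; exact hr) (by omega)
    exact ⟨t, lt_dur_of_op ht (by rw [hop]; simp), hop, h1⟩

theorem eq_of_describes {q q' : ℕ → Q}
    (h : ∀ k : Fin w.1.length, Describes w q (k + 1) (c k))
    (h' : ∀ k : Fin w.1.length, Describes w q' (k + 1) (c k)) {t : ℕ} (ht : t ≤ dur w) :
    q t = q' t := by
  have h1 := arrives_of_describes h ht
  have h2 := arrives_of_describes h' ht
  cases t with
  | zero =>
    obtain ⟨l, hl⟩ := exists_ext c le_rfl (length_pos w)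
    exact ((arrives_zero hl _).1 h1).symm.trans ((arrives_zero hl _).1 h2)
  | succ t =>
    rcases read_or_pop w ht with h3 | h3
    · obtain ⟨l, hl⟩ := exists_ext c (one_le_lookAt (M := M) w.1 t) h3.2.1
      exact ((arrives_read ht h3.1.1 hl _).1 h1).symm.trans ((arrives_read ht h3.1.1 hl _).1 h2)
    · have h4 := topAt_lt_lookAt (M := M) w.1 t
      have h5 := lookAt_le (M := M) w.1 t
      obtain ⟨l, hl⟩ := exists_ext c (rel_of_pop h3.2).2 (by omega)
      obtain ⟨p, hp⟩ := (arrives_pop ht h3.2 hl _).1 h1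
      obtain ⟨p', hp'⟩ := (arrives_pop ht h3.2 hl _).1 h2
      rw [hp] at hp'
      exact congrArg Prod.snd (Option.some_injective _ hp')

/-! ### The weight of a run as a product over positions -/

/-- The weight of the transition that reads a position with the given label. -/
noncomputable def readWt (𝒜 : WOPA A K Q) (l : Lab A Q) : K :=
  if l.isShift then 𝒜.shiftWt (l.pre, l.letter, l.post) else 𝒜.pushWt (l.pre, l.letter, l.post)

/-- The weight of the transition that pops a position with the given label. -/
noncomputable def poppedWt (𝒜 : WOPA A K Q) (l : Lab A Q) : K :=
  l.popped.elim 1 fun x => 𝒜.popWt (x.1, l.stored, x.2)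

theorem prod_range'_update {f g : ℕ → K} {m v : ℕ} {k : K} (hk : ∀ x, k * x = x * k)
    (hv : 1 ≤ v) (hv' : v ≤ m) (h : ∀ i, i ≠ v → g i = f i) (h' : g v = f v * k) :
    ((List.range' 1 m).map g).prod = ((List.range' 1 m).map f).prod * k := by
  induction m with
  | zero => omega
  | succ m ih =>
    rw [prod_range'_succ, prod_range'_succ]
    rcases hv'.lt_or_eq with e | e
    · rw [ih (by omega), h _ (by omega), mul_assoc, mul_assoc, hk]
    · rw [← e, h', ← mul_assoc]
      congr 2
      refine congrArg List.prod (List.map_congr_left fun i hi => h i ?_)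
      rw [List.mem_range'_1] at hi
      omega

/-- A run multiplies its weights in the order of time. Reads agree with the order of the positions;
each pop weight is moved, being central, next to the read of the popped position. -/
theorem seqWt_of_describes (hc : ∀ x y, 𝒜.popWt x * y = y * 𝒜.popWt x) {q : ℕ → Q}
    (hd : ∀ k : Fin w.1.length, Describes w q (k + 1) (c k)) :
    𝒜.seqWt M w.1 q (dur w) = (List.ofFn fun k => 𝒜.readWt (c k) * 𝒜.poppedWt (c k)).prod := by
  classical
  have hd' : ∀ y l, ext c y = some l → Describes w q y l := by
    intro y l h
    obtain ⟨k, rfl, rfl⟩ := ext_eq_some.1 h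
    exact hd k
  -- The contribution of position `i` at time `t`: its pop weight is counted only once the pop has
  -- taken place.
  let F : ℕ → ℕ → K := fun t i => (ext c i).elim 1 fun l => 𝒜.readWt l *
    if ∃ s < t, opAt M w.1 s = .pop ∧ topAt M w.1 s = i then 𝒜.poppedWt l else 1
  have key : ∀ t ≤ dur w, 𝒜.seqWt M w.1 q t =
      ((List.range' 1 (lookAt M w.1 t - 1)).map (F t)).prod := by
    intro t
    induction t with
    | zero => intro _; rfl
    | succ t ih =>
      intro ht
      have hlt : t < dur w := ht
      have h1 := one_le_lookAt (M := M) w.1 t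
      have hex : ∀ i, (∃ s < t + 1, opAt M w.1 s = .pop ∧ topAt M w.1 s = i) ↔
          (∃ s < t, opAt M w.1 s = .pop ∧ topAt M w.1 s = i) ∨
            (opAt M w.1 t = .pop ∧ topAt M w.1 t = i) := by
        intro i
        simp only [Nat.lt_succ_iff_lt_or_eq, or_and_right, exists_or, exists_eq_left]
      rw [seqWt, ih hlt.le]
      rcases read_or_pop w hlt with ⟨⟨h2, -⟩, h4, h5⟩ | ⟨⟨h2, -⟩, h4⟩
      · have hF : F (t + 1) = F t := by
          funext i
          have : opAt M w.1 t ≠ .pop := by rcases h5 with ⟨a, h⟩ | ⟨a, h⟩ <;> simp [h]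
          simp only [F, hex, this, false_and, or_false]
        rw [hF, h2, show lookAt M w.1 t + 1 - 1 = lookAt M w.1 t - 1 + 1 by omega,
          prod_range'_succ, show lookAt M w.1 t - 1 + 1 = lookAt M w.1 t by omega]
        congr 1
        obtain ⟨l, hl⟩ := exists_ext c h1 h4
        have hno : ¬∃ s < t, opAt M w.1 s = .pop ∧ topAt M w.1 s = lookAt M w.1 t := by
          rintro ⟨s, hs, -, e⟩
          have := topAt_lt_lookAt (M := M) w.1 s
          have := lookAt_mono w hs.le
          omega
        obtain ⟨e1, e2, -, e4⟩ := (hd' _ l hl).read t hlt rfl h2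
        simp only [F, hl, Option.elim_some, if_neg hno, mul_one, readWt, e1, e2]
        have hlet := (hd' _ l hl).letter
        rcases h5 with ⟨a, h⟩ | ⟨a, h⟩
        · have : l.isShift = false := by rw [← Bool.not_eq_true, e4, h]; simp
          obtain rfl : a = l.letter := Option.some_injective _ ((rel_of_push h).1.symm.trans hlet)
          simp [this, transWt, h]
        · have : l.isShift = true := by rw [e4, h]; simp
          obtain rfl : a = l.letter := Option.some_injective _ ((rel_of_shift h).1.symm.trans hlet)
          simp [this, transWt, h]
      · have h5 := topAt_lt_lookAt (M := M) w.1 t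
        have h6 := lookAt_le (M := M) w.1 t
        have h7 := (rel_of_pop h4).2
        obtain ⟨l, hl⟩ := exists_ext c h7 (show _ ≤ w.1.length by omega)
        have hpop := (hd' _ l hl).pop t hlt h4 rfl
        have hwt : 𝒜.transWt M w.1 q t = 𝒜.poppedWt l := by
          simp only [transWt, h4, poppedWt, hpop, Option.elim_some,
            stored_of_describes hd hlt.le hl]
        rw [h2]
        refine (prod_range'_update (v := topAt M w.1 t) (fun x => ?_) h7 (by omega)
          (fun i hi => ?_) ?_).symm
        · rw [hwt, poppedWt, hpop]; exact hc _ x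
        · simp only [F, hex, hi.symm, and_false, or_false]
        · have hno : ¬∃ s < t, opAt M w.1 s = .pop ∧ topAt M w.1 s = topAt M w.1 t := by
            rintro ⟨s, hs, h8, h9⟩
            exact hs.ne (pop_unique w h8 h4 h9)
          have hyes : ∃ s < t + 1, opAt M w.1 s = .pop ∧ topAt M w.1 s = topAt M w.1 t :=
            ⟨t, by omega, h4, rfl⟩
          simp only [F, hl, Option.elim_some, if_neg hno, if_pos hyes, mul_one, hwt]
  rw [key _ le_rfl, lookAt_dur, Nat.add_sub_cancel, LabelSeries.map_range'_eq_ofFn]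
  congr 1
  refine congrArg List.ofFn (funext fun k => ?_)
  simp only [F, ext_succ, Option.elim_some]
  rcases (hd k).unpopped with h | h
  · simp [poppedWt, h]
  · rw [if_pos h]

theorem behavior_eq_labelling_sum [Finite A] [Finite Q] [Fintype (Lab A Q)]
    (hc : ∀ x y, 𝒜.popWt x * y = y * 𝒜.popWt x) (w : OPWord M) :
    𝒜.behavior M w = ∑ c : Fin w.1.length → Lab A Q, open Classical in
      if RunLab M 𝒜 w.1 (fun l i => ext c i = some l) then
        (List.ofFn fun k => 𝒜.readWt (c k) * 𝒜.poppedWt (c k)).prod else 0 := by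
  classical
  have hq : ∀ c : Fin w.1.length → Lab A Q, ∃ q : ℕ → Q,
      RunLab M 𝒜 w.1 (fun l i => ext c i = some l) →
      IsRun 𝒜 w q ∧ ∀ k : Fin w.1.length, Describes w q (k + 1) (c k) := fun c => by
    by_cases h : RunLab M 𝒜 w.1 (fun l i => ext c i = some l)
    · exact (exists_run_of_runLab h).imp fun q hq _ => hq
    -- Any state will do; the first label supplies one.
    · exact ⟨fun _ => (c ⟨0, length_pos w⟩).pre, fun h' => absurd h' h⟩
  choose q hq using hq
  rw [behavior_eq_sum w _ q (fun c h => (hq c h).1) ?_ ?_]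
  · refine Finset.sum_congr rfl fun c _ => ?_
    by_cases h : RunLab M 𝒜 w.1 (fun l i => ext c i = some l)
    · rw [if_pos h, if_pos h, seqWt_of_describes hc (hq c h).2]
    · rw [if_neg h, if_neg h]
  · exact fun c c' h h' e => funext fun k => ((hq c h).2 k).unique ((hq c' h').2 k) e
  · intro q' hq'
    choose c hc using fun k : Fin w.1.length =>
      exists_describes w q' (show 1 ≤ (k : ℕ) + 1 by omega) (show (k : ℕ) + 1 ≤ _ by omega)
    have h := runLab_of_describes hq' hc
    exact ⟨c, h, fun t ht => eq_of_describes (hq c h).2 hc ht⟩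

end WOPA

end OPL

namespace OPL

universe u v

/-! ## Definable properties -/

/-- A property of words and assignments is definable if, for assignments of positions of `#w#`, it
is expressed by a boolean formula in the first-order variables below `n` and the second-order
variables below `m`. -/
def Definable {A : Type u} (M : OPM A) (m n : ℕ) (R : List A → Assignment → Prop) : Prop :=
  ∃ β : BFormula A, (∀ x ∈ β.freeFO, x < n) ∧ (∀ X ∈ β.freeSO, X < m) ∧
    ∀ w σ, (∀ x < n, σ.fo x ≤ w.length + 1) → (β.Sat M w σ ↔ R w σ)

namespace Definable

variable {A : Type u} {M : OPM A} {m n x y : ℕ} {R T : List A → Assignment → Prop}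

theorem congr (h : Definable M m n R)
    (e : ∀ w σ, (∀ x < n, σ.fo x ≤ w.length + 1) → (R w σ ↔ T w σ)) : Definable M m n T := by
  obtain ⟨β, h1, h2, h3⟩ := h
  exact ⟨β, h1, h2, fun w σ hσ => (h3 w σ hσ).trans (e w σ hσ)⟩

theorem lab (hx : x < n) (a : Option A) :
    Definable M m n fun w σ => letterAt w (σ.fo x) = a :=
  ⟨.lab a x, by simpa [BFormula.freeFO], by simp [BFormula.freeSO], fun _ _ _ => Iff.rfl⟩

theorem le (hx : x < n) (hy : y < n) : Definable M m n fun _ σ => σ.fo x ≤ σ.fo y :=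
  ⟨.le x y, by simp [BFormula.freeFO, hx, hy], by simp [BFormula.freeSO], fun _ _ _ => Iff.rfl⟩

theorem chain (hx : x < n) (hy : y < n) :
    Definable M m n fun w σ => Chain M w (σ.fo x) (σ.fo y) :=
  ⟨.chain x y, by simp [BFormula.freeFO, hx, hy], by simp [BFormula.freeSO], fun _ _ _ => Iff.rfl⟩

theorem mem (hx : x < n) {X : ℕ} (hX : X < m) : Definable M m n fun _ σ => σ.fo x ∈ σ.so X :=
  ⟨.mem x X, by simpa [BFormula.freeFO], by simpa [BFormula.freeSO], fun _ _ _ => Iff.rfl⟩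

theorem not (h : Definable M m n R) : Definable M m n fun w σ => ¬R w σ := by
  obtain ⟨β, h1, h2, h3⟩ := h
  exact ⟨.not β, h1, h2, fun w σ hσ => not_congr (h3 w σ hσ)⟩

theorem or (h : Definable M m n R) (h' : Definable M m n T) :
    Definable M m n fun w σ => R w σ ∨ T w σ := by
  obtain ⟨β, h1, h2, h3⟩ := h
  obtain ⟨γ, h1', h2', h3'⟩ := h'
  refine ⟨.or β γ, fun x hx => ?_, fun X hX => ?_, fun w σ hσ => or_congr (h3 w σ hσ) (h3' w σ hσ)⟩
  · exact (Finset.mem_union.1 hx).elim (h1 x) (h1' x)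
  · exact (Finset.mem_union.1 hX).elim (h2 X) (h2' X)

theorem and (h : Definable M m n R) (h' : Definable M m n T) :
    Definable M m n fun w σ => R w σ ∧ T w σ :=
  (h.not.or h'.not).not.congr fun _ _ _ => by tauto

theorem imp (h : Definable M m n R) (h' : Definable M m n T) :
    Definable M m n fun w σ => R w σ → T w σ :=
  (h.not.or h').congr fun _ _ _ => by tauto

/-- Variables are numbered by quantifier depth: the quantifier binds `n`, the first variable not in
scope, so no capture can occur. -/
theorem exFO (h : Definable M m (n + 1) R) :
    Definable M m n fun w σ => ∃ i ≤ w.length + 1, R w (σ.updFO n i) := by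
  obtain ⟨β, h1, h2, h3⟩ := h
  refine ⟨.exFO n β, fun x hx => ?_, h2, fun w σ hσ => exists_congr fun i =>
    and_congr_right fun hi => h3 w _ fun x hx => ?_⟩
  · have := Finset.mem_erase.1 hx
    have := h1 x this.2
    omega
  · by_cases e : x = n
    · simpa [Assignment.updFO, e] using hi
    · simpa [Assignment.updFO, e] using hσ x (by omega)

theorem allFO (h : Definable M m (n + 1) R) :
    Definable M m n fun w σ => ∀ i ≤ w.length + 1, R w (σ.updFO n i) :=
  h.not.exFO.not.congr fun _ _ _ => by simp

theorem const (p : Prop) : Definable M m n fun _ _ => p := by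
  have h : Definable M m n fun _ _ => True :=
    -- The tautology is that some position satisfies `x ≤ x`; position `0` is a witness.
    (le (M := M) (m := m) n.lt_succ_self n.lt_succ_self).exFO.congr fun w σ _ => by
      simpa using ⟨0, Nat.zero_le _⟩
  by_cases hp : p
  · simpa [hp] using h
  · simpa [hp] using h.not

theorem exists_finite {ι : Type*} [Finite ι] {R : ι → List A → Assignment → Prop}
    (h : ∀ i, Definable M m n (R i)) : Definable M m n fun w σ => ∃ i, R i w σ := by
  classical
  cases nonempty_fintype ι
  have key : ∀ s : Finset ι, Definable M m n fun w σ => ∃ i ∈ s, R i w σ := by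
    intro s
    induction s using Finset.induction_on with
    | empty => exact (const False).congr fun w c => by simp
    | insert i s _ ih => exact ((h i).or ih).congr fun w c => by simp
  exact (key Finset.univ).congr fun w c => by simp

theorem forall_finite {ι : Type*} [Finite ι] {R : ι → List A → Assignment → Prop}
    (h : ∀ i, Definable M m n (R i)) : Definable M m n fun w σ => ∀ i, R i w σ :=
  (exists_finite fun i => (h i).not).not.congr fun _ _ _ => by simp

theorem lt (hx : x < n) (hy : y < n) : Definable M m n fun _ σ => σ.fo x < σ.fo y :=
  (le hy hx).not.congr fun _ _ _ => by simp

theorem succ (hx : x < n) (hy : y < n) : Definable M m n fun _ σ => σ.fo x + 1 = σ.fo y := by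
  refine ((lt hx hy).and ((lt (hx.trans n.lt_succ_self) n.lt_succ_self).and
    (lt n.lt_succ_self (hy.trans n.lt_succ_self))).exFO.not).congr fun w σ hσ => ?_
  have hy' := hσ y hy
  simp only [Assignment.updFO, Function.update_self, Function.update_of_ne hx.ne,
    Function.update_of_ne hy.ne]
  refine ⟨fun ⟨h, h'⟩ => ?_, fun h => ⟨by omega, fun ⟨i, _, h', h''⟩ => by omega⟩⟩
  by_contra hne
  exact h' ⟨σ.fo x + 1, by omega, by omega, by omega⟩

theorem link (hx : x < n) (hy : y < n) :
    Definable M m n fun w σ => Link M w (σ.fo x) (σ.fo y) :=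
  (succ hx hy).or (chain hx hy)

/-- The alphabet is finite, so this is a disjunction over pairs of symbols. -/
theorem rel [Finite A] (hx : x < n) (hy : y < n) (p : Prec) :
    Definable M m n fun w σ => M.rel (letterAt w (σ.fo x)) (letterAt w (σ.fo y)) = some p :=
  (exists_finite fun ab : Option A × Option A =>
    ((lab hx ab.1).and (lab hy ab.2)).and (const (M.rel ab.1 ab.2 = some p))).congr fun _ _ _ =>
      ⟨fun ⟨_, ⟨h1, h2⟩, h⟩ => h1 ▸ h2 ▸ h, fun h => ⟨(_, _), ⟨rfl, rfl⟩, h⟩⟩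

theorem forall_position {R : List A → (ℕ → Finset ℕ) → ℕ → Prop}
    (h : Definable M m 1 fun w σ => R w σ.so (σ.fo 0)) :
    Definable M m 0 fun w σ => ∀ i ≤ w.length + 1, R w σ.so i :=
  h.allFO.congr fun _ _ _ => by simp [Assignment.updFO]

theorem forall_pair {R : List A → (ℕ → Finset ℕ) → ℕ → ℕ → Prop}
    (h : Definable M m 2 fun w σ => R w σ.so (σ.fo 0) (σ.fo 1)) :
    Definable M m 0 fun w σ => ∀ i ≤ w.length + 1, ∀ j ≤ w.length + 1, R w σ.so i j :=
  h.allFO.allFO.congr fun _ _ _ => by simp [Assignment.updFO]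

end Definable

/-! ## Sentences for automata -/

/-- The label predicates given by second-order variables. -/
def LabelsOf {L : Type*} {m : ℕ} (e : L ≃ Fin m) (s : ℕ → Finset ℕ) (l : L) (i : ℕ) : Prop :=
  i ∈ s (e l)

namespace Definable

section runs

variable {A : Type u} {M : OPM A} {m n x y : ℕ} {K : Type v} {Q : Type}

theorem labelsOf {L : Type*} (e : L ≃ Fin m) (hx : x < n) (l : L) :
    Definable M m n fun _ σ => LabelsOf e σ.so l (σ.fo x) :=
  mem hx (e l).2

variable [Finite A] [Finite Q] {e : Lab A Q ≃ Fin m}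

theorem arrives (hx : x < n) (hy : y < n) (p : Q) :
    Definable M m n fun w σ => WOPA.Arrives M w (LabelsOf e σ.so) (σ.fo x) (σ.fo y) p := by
  -- In the definition of `Arrives`, variable `n` plays the role of `u` and `n + 1` that of `t`.
  have h1 : Definable M m (n + 1 + 1) fun w σ => σ.fo x < σ.fo (n + 1) → σ.fo (n + 1) < σ.fo n →
      ¬Link M w (σ.fo (n + 1)) (σ.fo y) :=
    (lt (by omega) (by omega)).imp ((lt (by omega) (by omega)).imp
      (link (by omega) (by omega)).not)
  have h2 : Definable M m (n + 1) fun w σ => σ.fo x < σ.fo n ∧ Link M w (σ.fo n) (σ.fo y) ∧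
      (∀ t, t ≤ w.length + 1 → σ.fo x < t → t < σ.fo n → ¬Link M w t (σ.fo y)) ∧
        ∃ l : Lab A Q, (∃ p', l.popped = some (p', p)) ∧ LabelsOf e σ.so l (σ.fo n) := by
    refine (lt (by omega) (by omega)).and ((link (by omega) (by omega)).and (.and ?_
      (exists_finite fun l => (const _).and (labelsOf e (by omega) l))))
    refine h1.allFO.congr fun w σ _ => ?_
    simp [Assignment.updFO, show x ≠ n + 1 by omega, show y ≠ n + 1 by omega]
  refine ((succ hx hy).and (((lab hx none).and (exists_finite fun l : Lab A Q =>
    (const (l.pre = p)).and (labelsOf e hy l))).or (exists_finite fun l : Lab A Q =>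
      (const (l.post = p)).and (labelsOf e hx l)))).or (h2.exFO.congr fun w σ _ => ?_)
  simp [Assignment.updFO, hx.ne, hy.ne]

theorem runLab (𝒜 : WOPA A K Q) :
    Definable M m 0 fun w σ => WOPA.RunLab M 𝒜 w (LabelsOf e σ.so) := by
  have h0 : 0 < 2 := by omega
  have h1 : 1 < 2 := by omega
  refine (((((((forall_position (R := fun w s x => ∀ l, LabelsOf e s l x →
      letterAt w x = some l.letter) ?_).and
    (forall_pair (R := fun w s v y => Link M w v y →
      M.rel (letterAt w v) (letterAt w y) = some .yields → ∀ l, LabelsOf e s l y →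
      (l.isShift = false ∧ l.stored = l.pre ∧ (l.pre, l.letter, l.post) ∈ 𝒜.push) ∧
        WOPA.Arrives M w (LabelsOf e s) v y l.pre) ?_)).and
    (forall_pair (R := fun w s v y => Link M w v y →
      M.rel (letterAt w v) (letterAt w y) = some .equal → ∀ l, LabelsOf e s l y →
      ∀ l', LabelsOf e s l' v →
      (l.isShift = true ∧ l.stored = l'.stored ∧ (l.pre, l.letter, l.post) ∈ 𝒜.shift) ∧
        WOPA.Arrives M w (LabelsOf e s) v y l.pre) ?_)).and
    (forall_pair (R := fun w s v y => Link M w v y →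
      M.rel (letterAt w v) (letterAt w y) = some .takes → ∀ l, LabelsOf e s l v →
      ∃ x : Q × Q, (l.popped = some x ∧ (x.1, l.stored, x.2) ∈ 𝒜.pop) ∧
        WOPA.Arrives M w (LabelsOf e s) v y x.1) ?_)).and
    (forall_position (R := fun w s v => ∀ l, LabelsOf e s l v → l.popped = none ∨
      ∃ y ≤ w.length + 1, Link M w v y ∧
        M.rel (letterAt w v) (letterAt w y) = some .takes) ?_)).and
    (forall_pair (R := fun w s v y => v + 1 = y → letterAt w v = none →
      ∀ l, LabelsOf e s l y → l.pre ∈ 𝒜.init) ?_)).and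
    (forall_pair (R := fun w s v y => v < y → letterAt w v = none →
      letterAt w y = none → ∃ p, p ∈ 𝒜.final ∧
        WOPA.Arrives M w (LabelsOf e s) v y p) ?_)).congr fun w σ _ =>
    ⟨fun ⟨⟨⟨⟨⟨⟨h1, h2⟩, h3⟩, h4⟩, h5⟩, h6⟩, h7⟩ => ⟨h1, h2, h3, h4, h5, h6, h7⟩,
      fun ⟨h1, h2, h3, h4, h5, h6, h7⟩ => ⟨⟨⟨⟨⟨⟨h1, h2⟩, h3⟩, h4⟩, h5⟩, h6⟩, h7⟩⟩
  · exact forall_finite fun l => (labelsOf e one_pos l).imp (lab one_pos _)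
  · exact (link h0 h1).imp ((rel h0 h1 _).imp (forall_finite fun l => (labelsOf e h1 l).imp
      ((const _).and (arrives h0 h1 _))))
  · exact (link h0 h1).imp ((rel h0 h1 _).imp (forall_finite fun l => (labelsOf e h1 l).imp
      (forall_finite fun l' => (labelsOf e h0 l').imp ((const _).and (arrives h0 h1 _)))))
  · exact (link h0 h1).imp ((rel h0 h1 _).imp (forall_finite fun l => (labelsOf e h0 l).imp
      (exists_finite fun x => (const _).and (arrives h0 h1 _))))
  · exact forall_finite fun l => (labelsOf e one_pos l).imp ((const _).or
      (((link h0 h1).and (rel h0 h1 .takes)).exFO.congr fun w σ _ => by simp [Assignment.updFO]))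
  · exact (succ h0 h1).imp ((lab h0 _).imp (forall_finite fun l => (labelsOf e h1 l).imp
      (const _)))
  · exact (lt h0 h1).imp ((lab h0 _).imp ((lab h1 _).imp (exists_finite fun p =>
      (const _).and (arrives h0 h1 _))))

/-- The sets given by the second-order variables form a partition of the positions of the word. -/
theorem partition {L : Type*} [Finite L] (e : L ≃ Fin m) :
    Definable M m 0 fun w σ => ∀ i ≤ w.length + 1, (∃ a, letterAt w i = some a) →
      ∃ l, LabelsOf e σ.so l i ∧ ∀ l', l' ≠ l → ¬LabelsOf e σ.so l' i :=
  forall_position (R := fun w s i => (∃ a, letterAt w i = some a) →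
      ∃ l, LabelsOf e s l i ∧ ∀ l', l' ≠ l → ¬LabelsOf e s l' i)
    ((exists_finite fun _ => lab one_pos _).imp (exists_finite fun l => (labelsOf e one_pos l).and
      (forall_finite fun l' => (const _).imp (labelsOf e one_pos l').not)))

end runs

end Definable

/-! ### Restricted formulas and iterated sums over sets -/

namespace WFormula

variable {A : Type u} {K : Type v}

theorem AlmostBoolean.of_mem_subformulas {φ ψ : WFormula A K} (h : φ.AlmostBoolean)
    (hψ : ψ ∈ φ.subformulas) : ψ.AlmostBoolean := by
  induction h with
  | bool β => obtain rfl := hψ; exact .bool β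
  | const k => obtain rfl := hψ; exact .const k
  | add h h' ih ih' =>
    rcases hψ with (rfl | hψ) | hψ
    exacts [.add h h', ih hψ, ih' hψ]
  | mul h h' ih ih' =>
    rcases hψ with (rfl | hψ) | hψ
    exacts [.mul h h', ih hψ, ih' hψ]

theorem AlmostBoolean.restricted [Mul K] {φ : WFormula A K} (h : φ.AlmostBoolean) :
    φ.Restricted := by
  refine ⟨fun ψ θ hm => ?_, fun x ψ hm => nomatch h.of_mem_subformulas hm⟩
  have := h.of_mem_subformulas hm
  cases this with
  | mul h _ => exact .inl h

theorem Restricted.prodFO [Mul K] {φ : WFormula A K} (h : φ.AlmostBoolean) (x : ℕ) :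
    (prodFO x φ).Restricted := by
  refine ⟨fun ψ θ hm => ?_, fun y ψ hm => ?_⟩
  · exact h.restricted.1 ψ θ (hm.resolve_left nofun)
  · rcases hm with hm | hm
    · cases hm; exact h
    · exact h.restricted.2 y ψ hm

theorem Restricted.bool_mul [Mul K] {φ : WFormula A K} (h : φ.Restricted) (β : BFormula A) :
    (mul (bool β) φ).Restricted := by
  refine ⟨fun ψ θ hm => ?_, fun y ψ hm => ?_⟩
  · rcases hm with (hm | hm) | hm
    · cases hm; exact .inl (.bool β)
    · cases hm
    · exact h.1 ψ θ hm
  · exact h.2 y ψ (hm.resolve_left (Or.rec nofun nofun))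

theorem Restricted.sumSO [Mul K] {φ : WFormula A K} (h : φ.Restricted) (X : ℕ) :
    (sumSO X φ).Restricted :=
  ⟨fun ψ θ hm => h.1 ψ θ (hm.resolve_left nofun), fun y ψ hm => h.2 y ψ (hm.resolve_left nofun)⟩

/-- Summation over the second-order variables below `m`. -/
def sumSets (φ : WFormula A K) : ℕ → WFormula A K
  | 0 => φ
  | m + 1 => sumSO m (φ.sumSets m)

theorem Restricted.sumSets [Mul K] {φ : WFormula A K} (h : φ.Restricted) :
    ∀ m, (φ.sumSets m).Restricted
  | 0 => h
  | m + 1 => (Restricted.sumSets h m).sumSO m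

theorem freeFO_sumSets (φ : WFormula A K) : ∀ m, (φ.sumSets m).freeFO = φ.freeFO
  | 0 => rfl
  | m + 1 => freeFO_sumSets φ m

theorem mem_freeSO_sumSets {φ : WFormula A K} {X : ℕ} :
    ∀ {m}, X ∈ (φ.sumSets m).freeSO ↔ X ∈ φ.freeSO ∧ m ≤ X
  | 0 => by simp [sumSets]
  | m + 1 => by
    rw [sumSets, freeSO, Finset.mem_erase, mem_freeSO_sumSets]
    exact ⟨fun ⟨h, h', _⟩ => ⟨h', by omega⟩, fun ⟨h, _⟩ => ⟨by omega, h, by omega⟩⟩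

/-- The assignment of the sets `g` to the second-order variables below `m`. -/
def _root_.OPL.Assignment.updSets {m : ℕ} (σ : Assignment) (g : Fin m → Finset ℕ) : Assignment :=
  ⟨σ.fo, fun X => if h : X < m then g ⟨X, h⟩ else σ.so X⟩

theorem sem_sumSets [Semiring K] (M : OPM A) (w : List A) (φ : WFormula A K) (m : ℕ) :
    ∀ σ : Assignment, (φ.sumSets m).sem M w σ = ∑ d : Fin m → Fin w.length → Bool,
      φ.sem M w (σ.updSets fun X => LabelSeries.positions (d X)) := by
  induction m with
  | zero => intro σ; simp [sumSets, Assignment.updSets]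
  | succ m ih =>
    intro σ
    rw [sumSets, sem, LabelSeries.sum_powerset_Icc]
    simp only [ih]
    rw [← Fintype.sum_prod_type']
    -- The outermost sum binds variable `m`, the last component of the family of sets.
    refine Fintype.sum_equiv (Fin.snocEquiv fun _ : Fin (m + 1) => Fin w.length → Bool) _ _
      fun x => congrArg (φ.sem M w) ?_
    simp only [Assignment.updSets, Assignment.updSO, Assignment.mk.injEq, true_and]
    funext X
    rcases lt_trichotomy X m with h | rfl | h
    · simp [h, h.trans m.lt_succ_self, Fin.snocEquiv, Fin.snoc]
    · simp [Fin.snocEquiv, Fin.snoc]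
    · simp [show ¬X < m by omega, show ¬X < m + 1 by omega, h.ne']

/-- The sum of the weights `val X` over the `X < m` with `0 ∈ X`. -/
def select (val : ℕ → K) [Zero K] : ℕ → WFormula A K
  | 0 => const 0
  | m + 1 => add (select val m) (mul (bool (.mem 0 m)) (const (val m)))

theorem almostBoolean_select [Zero K] (val : ℕ → K) :
    ∀ m, (select val m : WFormula A K).AlmostBoolean
  | 0 => .const 0
  | m + 1 => .add (almostBoolean_select val m) (.mul (.bool _) (.const _))

theorem freeFO_select [Zero K] (val : ℕ → K) : ∀ m, (select val m : WFormula A K).freeFO ⊆ {0}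
  | 0 => by simp [select, freeFO]
  | m + 1 => Finset.union_subset (freeFO_select val m) (by simp [freeFO, BFormula.freeFO])

theorem lt_of_mem_freeSO_select [Zero K] {val : ℕ → K} {X : ℕ} :
    ∀ {m}, X ∈ (select val m : WFormula A K).freeSO → X < m
  | 0, h => by simp [select, freeSO] at h
  | m + 1, h => by
    simp only [select, freeSO, BFormula.freeSO, Finset.mem_union, Finset.mem_singleton,
      Finset.notMem_empty, or_false] at h
    rcases h with h | h
    · exact (lt_of_mem_freeSO_select h).trans m.lt_succ_self
    · omega

open Classical in
theorem sem_select [Semiring K] (M : OPM A) (w : List A) (val : ℕ → K) (σ : Assignment) (m : ℕ) :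
    (select val m : WFormula A K).sem M w σ =
      ∑ X ∈ Finset.range m, if σ.fo 0 ∈ σ.so X then val X else 0 := by
  induction m with
  | zero => simp [select, sem]
  | succ m ih =>
    by_cases h : σ.fo 0 ∈ σ.so m <;>
      simp [select, sem, ih, Finset.sum_range_succ, BFormula.Sat, h]

end WFormula

theorem labelsOf_positions {L : Type*} {m n : ℕ} (e : L ≃ Fin m) (d : Fin m → Fin n → Bool)
    (σ : Assignment) (l : L) (i : ℕ) :
    LabelsOf e (σ.updSets fun X => LabelSeries.positions (d X)).so l i ↔
      ∃ k : Fin n, d (e l) k = true ∧ (k : ℕ) + 1 = i := by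
  simp [LabelsOf, Assignment.updSets, LabelSeries.mem_positions]

/-- A labelling is a family of sets, one for each label, partitioning the positions. The sentence
sums over all families, tests with a boolean formula that the family is a partition satisfying `P`,
and multiplies the weights selected at the positions. The left factor is boolean and the body of the
product almost boolean, so it is restricted. -/
theorem exists_sentence_of_labelling_sum {A : Type u} [Finite A] {M : OPM A} {K : Type v}
    [Semiring K] {L : Type*} [Fintype L] {m : ℕ} (e : L ≃ Fin m)
    {P : List A → (L → ℕ → Prop) → Prop}
    (hP : Definable M m 0 fun w σ => P w (LabelsOf e σ.so)) (val : L → K) :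
    ∃ φ : WFormula A K, φ.IsSentence ∧ φ.Restricted ∧ ∀ w : OPWord M, φ.series M w =
      ∑ c : Fin w.1.length → L, open Classical in
        if P w.1 (fun l i => ext c i = some l) then (List.ofFn fun k => val (c k)).prod else 0 := by
  classical
  obtain ⟨β, h1, h2, h3⟩ := hP.and (Definable.partition e)
  let val' : ℕ → K := fun X => if h : X < m then val (e.symm ⟨X, h⟩) else 0
  let ψ : WFormula A K := .mul (.bool β) (.prodFO 0 (.select val' m))
  refine ⟨ψ.sumSets m, ⟨?_, ?_⟩,
    (WFormula.Restricted.bool_mul (.prodFO (WFormula.almostBoolean_select _ _) _) _).sumSets m,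
    fun w => ?_⟩
  · rw [WFormula.freeFO_sumSets]
    refine Finset.eq_empty_of_forall_notMem fun x hx => ?_
    rcases Finset.mem_union.1 hx with hx | hx
    · exact absurd (h1 x hx) (by omega)
    · have hx := Finset.mem_erase.1 hx
      exact hx.1 (Finset.mem_singleton.1 (WFormula.freeFO_select val' m hx.2))
  · refine Finset.eq_empty_of_forall_notMem fun X hX => ?_
    obtain ⟨hX, hm⟩ := WFormula.mem_freeSO_sumSets.1 hX
    have : X < m := (Finset.mem_union.1 hX).elim (h2 X) WFormula.lt_of_mem_freeSO_select
    omega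
  rw [WFormula.series, WFormula.sem_sumSets]
  generalize (⟨fun _ => 1, fun _ => ∅⟩ : Assignment) = σ
  have hsat := fun d : Fin m → Fin w.1.length → Bool =>
    h3 w.1 (σ.updSets fun X => LabelSeries.positions (d X)) (by simp)
  symm
  -- A labelling corresponds to the family of its fibres; a family that is not of this form fails
  -- the partition test and contributes `0`.
  refine Finset.sum_of_injOn (fun c X k => decide (c k = e.symm X)) ?_ (by simp) ?_ ?_
  · intro c _ c' _ h
    funext k
    simpa [eq_comm] using congrFun (congrFun h (e (c k))) k
  · intro d _ hd
    simp only [ψ, WFormula.sem]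
    rw [if_neg, zero_mul]
    rw [hsat]
    rintro ⟨-, h⟩
    have h (k : Fin w.1.length) : ∃ l, ∀ l', d (e l') k = true ↔ l' = l := by
      obtain ⟨l, hl, hl'⟩ := h (k + 1) (by omega) (exists_letterAt (by omega) (by omega))
      have key (l : L) : LabelsOf e (σ.updSets fun X => LabelSeries.positions (d X)).so l (k + 1) ↔
          d (e l) k = true := by
        simp [labelsOf_positions, ← Fin.ext_iff]
      simp only [key] at hl hl'
      exact ⟨l, fun l' => ⟨fun h => by_contra fun h' => hl' l' h' h, fun h => h ▸ hl⟩⟩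
    choose c hc using h
    refine hd ⟨c, by simp, funext fun X => funext fun k => ?_⟩
    have := hc k (e.symm X)
    rw [e.apply_symm_apply] at this
    rw [Bool.eq_iff_iff, this, decide_eq_true_iff, eq_comm]
  · intro c _
    have key (l : L) (i : ℕ) : LabelsOf e (σ.updSets fun X => LabelSeries.positions
        fun k => decide (c k = e.symm X)).so l i ↔ ext c i = some l := by
      simp [labelsOf_positions, ext_eq_some, and_comm]
    have hpart : ∀ i ≤ w.1.length + 1, (∃ a, letterAt w.1 i = some a) →
        ∃ l, ext c i = some l ∧ ∀ l', l' ≠ l → ¬ext c i = some l' := by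
      rintro i - ⟨a, ha⟩
      have hi := letterAt_eq_some ha
      refine ⟨c ⟨i - 1, by omega⟩, ext_eq_some.2 ⟨_, Nat.sub_add_cancel hi.1, rfl⟩, ?_⟩
      intro l hl h
      obtain ⟨k, rfl, rfl⟩ := ext_eq_some.1 h
      exact hl rfl
    have hprod : ((List.range' 1 w.1.length).map fun i => (WFormula.select val' m).sem M w.1
        ((σ.updSets fun X => LabelSeries.positions fun k => decide (c k = e.symm X)).updFO 0 i)) =
        List.ofFn fun k => val (c k) := by
      rw [LabelSeries.map_range'_eq_ofFn]
      refine congrArg List.ofFn (funext fun k => ?_)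
      -- For a family of fibres exactly one set contains the position, so the sum reduces to the
      -- weight of its label.
      rw [WFormula.sem_select, Finset.sum_range, ← e.sum_comp]
      have (l : L) : (k : ℕ) + 1 ∈ (σ.updSets fun X => LabelSeries.positions
          fun k => decide (c k = e.symm X)).so (e l) ↔ c k = l := by
        rw [← Option.some_inj, ← ext_succ c k, ← key]; rfl
      simp [Assignment.updFO, this, val']
    simp only [ψ, WFormula.sem]
    rw [hprod, ite_mul, one_mul, zero_mul]
    refine if_congr ?_ rfl rfl
    rw [hsat]
    simp only [funext₂ fun l i => propext (key l i)]
    exact (and_iff_left hpart).symm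

theorem WOPA.exists_restricted_sentence {A : Type u} {M : OPM A} {K : Type v} [Semiring K]
    {Q : Type} [Finite A] [Finite Q] {𝒜 : WOPA A K Q}
    (hc : ∀ x y, 𝒜.popWt x * y = y * 𝒜.popWt x) :
    ∃ φ : WFormula A K, φ.IsSentence ∧ φ.Restricted ∧ 𝒜.behavior M = φ.series M := by
  cases nonempty_fintype (Lab A Q)
  obtain ⟨m, ⟨e⟩⟩ := Finite.exists_equiv_fin (Lab A Q)
  obtain ⟨φ, h1, h2, h3⟩ := exists_sentence_of_labelling_sum e
    (P := WOPA.RunLab M 𝒜) (Definable.runLab (M := M) 𝒜)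
    fun l => 𝒜.readWt l * 𝒜.poppedWt l
  exact ⟨φ, h1, h2, funext fun w => (behavior_eq_labelling_sum hc w).trans (h3 w).symm⟩

end OPL
theorem mainTheorem1 {A : Type*} [Finite A] (M : OPL.OPM A) {K : Type*} [Semiring K]
    (S : OPL.OPWord M → K) :
    ((∃ (Q : Type) (_ : Finite Q) (𝒜 : OPL.WOPA A K Q), 𝒜.Restricted ∧ S = 𝒜.behavior M) ↔
      ∃ φ : OPL.WFormula A K, φ.IsSentence ∧ φ.Restricted ∧ S = φ.series M) ∧
    ((∀ a b : K, a * b = b * a) →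
      ((∃ (Q : Type) (_ : Finite Q) (𝒜 : OPL.WOPA A K Q), S = 𝒜.behavior M) ↔
        ∃ φ : OPL.WFormula A K, φ.IsSentence ∧ φ.Restricted ∧ S = φ.series M)) := by
  refine ⟨⟨?_, ?_⟩, fun hK => ⟨?_, ?_⟩⟩
  · rintro ⟨Q, _, 𝒜, h𝒜, rfl⟩
    -- Pop weights are `1` on transitions and, by the convention of `popWt`, `0` elsewhere; both are
    -- central in any semiring.
    refine OPL.WOPA.exists_restricted_sentence fun x y => ?_
    by_cases hx : x ∈ 𝒜.pop
    · rw [OPL.WOPA.popWt_of_mem hx, h𝒜, one_mul, mul_one]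
    · rw [OPL.WOPA.popWt, dif_neg hx, zero_mul, mul_zero]
  · rintro ⟨φ, hs, hr, rfl⟩
    exact OPL.exists_restricted_wopa hs hr
  · rintro ⟨Q, _, 𝒜, rfl⟩
    exact OPL.WOPA.exists_restricted_sentence fun x y => hK _ _
  · rintro ⟨φ, hs, hr, rfl⟩
    obtain ⟨Q, hQ, 𝒜, -, h⟩ := OPL.exists_restricted_wopa (M := M) hs hr
    exact ⟨Q, hQ, 𝒜, h⟩
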